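/- Let $k$ be a commutative ring. For a group $G$, a subgroup $H\subseteq G$ and a $kG$-module $M$, let $\mathrm{res}^G_H M$ be the restriction of $M$ to $kH$, and let $\mathrm{fd}$ denote flat dimension. For a subgroup $H\subseteq G$ of finite index, the triple $(G,H,k)$ satisfies *Moore's condition* if for every $g\in G\setminus H$ either $\langle g\rangle\cap H\neq 1$, or $g$ has finite order and this order is invertible in $k$. Let $\mathfrak M_{flat}=\mathfrak M_{flat}(k)$ be the class of those groups $G$ such that, for every subgroup $H\subseteq G$ of finite index for which $(G,H,k)$ satisfies Moore's condition, every $kG$-module $M$ with $\mathrm{res}^G_H M$ flat over $kH$ is flat over $kG$. Let $\mathfrak C$ be a class of groups. Define the classes $\mathbf H_\alpha\mathfrak C$ for ordinals $\alpha$ by $\mathbf H_0\mathfrak C=\mathfrak C$ and, for $\alpha>0$, let $\mathbf H_\alpha\mathfrak C$ consist of the groups $G$ that act cellularly (by homeomorphisms permuting the open cells) on a finite-dimensional contractible CW-complex such that the isotropy subgroup of each cell (the subgroup of elements mapping the open cell to itself) belongs to $\mathbf H_\beta\mathfrak C$ for some $\beta<\alpha$, which may depend on the cell. Let $\mathbf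 H\mathfrak C=\bigcup_\alpha\mathbf H_\alpha\mathfrak C$, and let $\mathbf{LH}\mathfrak C$ be the class of groups $G$ such that every finitely generated subgroup of $G$ is contained in a subgroup of $G$ belonging to $\mathbf H\mathfrak C$. Let $\Phi_{flat}\mathfrak C$ be the class of groups $G$ such that for every $kG$-module $M$ the following are equivalent: (a) $\mathrm{fd}_{kG}M<\infty$; (b) there is an integer $n$ with $\mathrm{fd}_{kF}\,\mathrm{res}^G_F M\le n$ for every subgroup $F\subseteq G$ belonging to $\mathfrak C$. **Theorem.** Let $G$ be a group and $H\subseteq G$ a subgroup of finite index such that $(G,H,k)$ satisfies Moore's condition. If $M$ is a $kG$-module with $\mathrm{res}^G_H M$ flat over $kH$, then: (i) $\mathrm{res}^G_S M$ is flat over $kS$ for every subgroup $S\subseteq G$ belonging to $\mathbf{LH}\mathfrak M_{flat}$; (ii) $\mathrm{res}^G_S M$ is flat over $kS$ for every subgroup $S\subseteq G$ belonging to $\Phi_{flat}\mathfrak M_{flat}$. -/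

import Mathlib

open scoped TensorProduct

universe u

namespace MooreFlat

/-! ### Flat modules and flat dimension over a (noncommutative) ring

Left modules over `A` are `Module A M`; right modules over `A` are `Module Aᵐᵒᵖ N`. -/

section Flat

/-- The subgroup of `N ⊗[ℤ] M` generated by the elements `(n a) ⊗ m - n ⊗ (a m)`. -/
def balancedRel (A : Type u) [Ring A] (N : Type u) [AddCommGroup N] [Module Aᵐᵒᵖ N]
    (M : Type u) [AddCommGroup M] [Module A M] : AddSubgroup (N ⊗[ℤ] M) :=
  AddSubgroup.closure
    {t | ∃ (n : N) (a : A) (m : M), t = (MulOpposite.op a • n) ⊗ₜ[ℤ] m - n ⊗ₜ[ℤ] (a • m)}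

/-- The abelian group `N ⊗_A M`, for a right `A`-module `N` and a left `A`-module `M`. -/
abbrev BalancedTensor (A : Type u) [Ring A] (N : Type u) [AddCommGroup N] [Module Aᵐᵒᵖ N]
    (M : Type u) [AddCommGroup M] [Module A M] : Type u :=
  (N ⊗[ℤ] M) ⧸ balancedRel A N M

theorem balancedRel_le_comap (A : Type u) [Ring A]
    {N : Type u} [AddCommGroup N] [Module Aᵐᵒᵖ N] {N' : Type u} [AddCommGroup N'] [Module Aᵐᵒᵖ N']
    (M : Type u) [AddCommGroup M] [Module A M] (f : N →ₗ[Aᵐᵒᵖ] N') :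
    balancedRel A N M ≤ (balancedRel A N' M).comap
      (LinearMap.rTensor M f.toAddMonoidHom.toIntLinearMap).toAddMonoidHom := by
  rw [balancedRel, AddSubgroup.closure_le]
  rintro _ ⟨n, a, m, rfl⟩
  refine AddSubgroup.subset_closure ⟨f n, a, m, ?_⟩
  simp

/-- The map `f ⊗ id : N ⊗_A M → N' ⊗_A M` induced by a map `f : N → N'` of right `A`-modules. -/
def BalancedTensor.map (A : Type u) [Ring A]
    {N : Type u} [AddCommGroup N] [Module Aᵐᵒᵖ N] {N' : Type u} [AddCommGroup N'] [Module Aᵐᵒᵖ N']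
    (M : Type u) [AddCommGroup M] [Module A M] (f : N →ₗ[Aᵐᵒᵖ] N') :
    BalancedTensor A N M →+ BalancedTensor A N' M :=
  QuotientAddGroup.map (balancedRel A N M) (balancedRel A N' M)
    (LinearMap.rTensor M f.toAddMonoidHom.toIntLinearMap).toAddMonoidHom
    (balancedRel_le_comap A M f)

/-- A left `A`-module `M` is flat if `- ⊗_A M` preserves injective maps of right `A`-modules. -/
def IsFlat (A : Type u) [Ring A] (M : Type u) [AddCommGroup M] [Module A M] : Prop :=
  ∀ (N : Type u) [AddCommGroup N] [Module Aᵐᵒᵖ N] (N' : Type u) [AddCommGroup N'] [Module Aᵐᵒᵖ N']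
    (f : N →ₗ[Aᵐᵒᵖ] N'), Function.Injective f → Function.Injective (BalancedTensor.map A M f)

/-- `fd_A M ≤ n`: there is an exact sequence `0 → F_n → ⋯ → F_0 → M → 0` with all `F_i` flat. -/
def FlatDimLE (A : Type u) [Ring A] :
    ℕ → ∀ (M : Type u) [AddCommGroup M] [Module A M], Prop
  | 0, M, _, _ => IsFlat A M
  | n + 1, M, _, _ => ∃ (F : Type u) (_ : AddCommGroup F) (_ : Module A F) (f : F →ₗ[A] M),
      IsFlat A F ∧ Function.Surjective f ∧ FlatDimLE A n (LinearMap.ker f)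

end Flat

/-! ### Restriction of modules over group algebras -/

section Restriction

/-- The restriction of a `kG`-module `M` to the subgroup `H`: the abelian group `M`, on which `kH`
acts through the inclusion `kH → kG`. -/
def Res (_k : Type u) {G : Type u} [Group G] (_H : Subgroup G) (M : Type u) : Type u := M

instance instAddCommGroupRes (k : Type u) {G : Type u} [Group G] (H : Subgroup G) (M : Type u)
    [AddCommGroup M] : AddCommGroup (Res k H M) :=
  inferInstanceAs (AddCommGroup M)

noncomputable instance instModuleRes (k : Type u) [CommRing k] {G : Type u} [Group G]
    (H : Subgroup G) (M : Type u) [AddCommGroup M] [Module (MonoidAlgebra k G) M] :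
    Module (MonoidAlgebra k H) (Res k H M) :=
  Module.compHom M (MonoidAlgebra.mapDomainRingHom k H.subtype)

end Restriction

/-! ### Group classes and the operations `LH` and `Φ_flat` -/

/-- A class of groups. -/
abbrev GroupClass : Type (u + 1) := ∀ (G : Type u) [Group G], Prop

section LH

open Topology

/-- The action of `G` on the CW-complex `X` is cellular: every element of `G` acts as a
homeomorphism (continuity is `ContinuousConstSMul`) which permutes the open cells. -/
def IsCellularAction (G : Type u) [Group G] (X : Type u) [TopologicalSpace X]
    [CWComplex (Set.univ : Set X)] [MulAction G X] : Prop :=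
  ContinuousConstSMul G X ∧
    ∀ (g : G) (n : ℕ) (e : RelCWComplex.cell (Set.univ : Set X) n),
      ∃ e' : RelCWComplex.cell (Set.univ : Set X) n,
        (fun x : X => g • x) '' RelCWComplex.openCell n e = RelCWComplex.openCell n e'

/-- The isotropy subgroup of a cell `e`: the elements of `G` that map the open cell `e` to itself. -/
def cellIsotropy (G : Type u) [Group G] (X : Type u) [TopologicalSpace X]
    [CWComplex (Set.univ : Set X)] [MulAction G X] (n : ℕ)
    (e : RelCWComplex.cell (Set.univ : Set X) n) : Subgroup G where
  carrier := {g | (fun x : X => g • x) '' RelCWComplex.openCell n e = RelCWComplex.openCell n e}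
  one_mem' := by simp
  mul_mem' := by
    intro a b ha hb
    simp only [Set.mem_ofPred_eq] at ha hb ⊢
    have h : (fun x : X => (a * b) • x) = (fun x : X => a • x) ∘ fun x : X => b • x := by
      funext x
      simp [mul_smul]
    rw [h, Set.image_comp, hb, ha]
  inv_mem' := by
    intro a ha
    simp only [Set.mem_ofPred_eq] at ha ⊢
    conv_lhs => rw [← ha]
    simp [Set.image_image]

/-- The classes `H_α C`, for `C` a group class and `α` an ordinal: `H_0 C = C`, and for `α > 0` the
class `H_α C` consists of the groups that act cellularly on a finite-dimensional contractible
CW-complex, the isotropy subgroup of each cell `e` lying in `H_β C` for some `β < α`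
(depending on `e`). -/
inductive HOrd (C : GroupClass.{u}) : Ordinal.{u} → ∀ (G : Type u) [Group G], Prop
  | zero (G : Type u) [Group G] (hG : C G) : HOrd C 0 G
  | step (α : Ordinal.{u}) (hα : 0 < α) (G : Type u) [Group G]
      (X : Type u) [TopologicalSpace X] [T2Space X] [ContractibleSpace X]
      [CWComplex (Set.univ : Set X)]
      (hfin : RelCWComplex.FiniteDimensional (Set.univ : Set X))
      [MulAction G X] (hact : IsCellularAction G X)
      (β : ∀ n : ℕ, RelCWComplex.cell (Set.univ : Set X) n → Ordinal.{u})
      (hβ : ∀ n e, β n e < α)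
      (hiso : ∀ n e, HOrd C (β n e) (cellIsotropy G X n e)) : HOrd C α G

/-- The class `H C`, the union of the classes `H_α C`. -/
def HClass (C : GroupClass.{u}) : GroupClass.{u} :=
  fun G _ => ∃ α : Ordinal.{u}, HOrd C α G

/-- The class `LH C`: every finitely generated subgroup is contained in an `H C`-subgroup. -/
def LHClass (C : GroupClass.{u}) : GroupClass.{u} :=
  fun G _ => ∀ F : Subgroup G, F.FG → ∃ K : Subgroup G, F ≤ K ∧ HClass C K

end LH

/-- The class `Φ_flat C` over `k`: the groups `G` such that, for every `kG`-module `M`, one has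
`fd_{kG} M < ∞` if and only if there is a uniform finite bound on the flat dimensions of the
restrictions of `M` to the `C`-subgroups of `G`. -/
def PhiFlat (k : Type u) [CommRing k] (C : GroupClass.{u}) : GroupClass.{u} :=
  fun G _ => ∀ (M : Type u) [AddCommGroup M] [Module (MonoidAlgebra k G) M],
    (∃ n : ℕ, FlatDimLE (MonoidAlgebra k G) n M) ↔
      ∃ n : ℕ, ∀ H : Subgroup G, C H → FlatDimLE (MonoidAlgebra k H) n (Res k H M)

/-! ### Moore's condition and the flat version of Moore's conjecture -/

/-- Moore's condition for `(G, H, k)` (where `H` is to be of finite index in `G`): for each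
`g ∈ G \ H`, either `⟨g⟩ ∩ H` is nontrivial, or `g` has finite order, which is invertible in `k`. -/
def MooreCondition (k : Type u) [CommRing k] {G : Type u} [Group G] (H : Subgroup G) : Prop :=
  ∀ g : G, g ∉ H →
    Subgroup.zpowers g ⊓ H ≠ ⊥ ∨ (IsOfFinOrder g ∧ IsUnit ((orderOf g : ℕ) : k))

/-- The class `M_flat(k)` of the groups which satisfy the flat version of Moore's conjecture
over `k`. -/
def MFlat (k : Type u) [CommRing k] : GroupClass.{u} :=
  fun G _ => ∀ H : Subgroup G, H.FiniteIndex → MooreCondition k H →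
    ∀ (M : Type u) [AddCommGroup M] [Module (MonoidAlgebra k G) M],
      IsFlat (MonoidAlgebra k H) (Res k H M) → IsFlat (MonoidAlgebra k G) M

end MooreFlat

-- Everything rests on one principle, `FlatDimLE.isFlat_of_finiteIndex`: a `kG`-module of finite
-- flat dimension that is flat over a subgroup of finite index is flat.
--
-- Finite index, Moore's condition and flatness of `M` all pass from `H` to its preimage under an
-- injective homomorphism `K → G`. So `M` is flat over every `MFlat`-subgroup (`isFlat_of_mFlat`).
-- If `S` belongs to `PhiFlat`, then `0` bounds the flat dimensions over the `MFlat`-subgroups of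
-- `S`, hence `M` has finite flat dimension over `kS` and the principle applies to `S ∩ H ⊆ S`. For
-- `LHClass`, flatness can be tested on finitely generated subgroups, which leaves the classes
-- `HOrd` and an induction (`isFlat_of_hOrd`). There `M` is flat over the isotropy groups of a
-- cellular action on a finite-dimensional contractible complex. The cellular chains with
-- coefficients in `M`, with diagonal action, then form a finite flat resolution of `M`, and the
-- principle applies again.
--
-- The principle is proved on duals: `M` is flat iff `M* = Hom(M, ℚ/ℤ)` is injective. Induction on
-- the dimension leaves an exact sequence `0 → K → F → M → 0` with `K` and `F` flat over `kG`. The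
-- dual sequence splits over `kH`, because `M*` is `kH`-injective. As `K*` is `kG`-injective, its
-- identity is a trace from `H`; averaging an `H`-section with it gives a `G`-section, so `M*` is a
-- summand of the injective module `F*`.
--
-- The resolution comes from normalised cubical singular chains. Cubes are arbitrary maps in curried
-- form, so that operators are defined by recursion through the path space without a topology on it;
-- continuity is imposed afterwards, on the cubes of a subset. Subdivision gives excision, excision
-- gives the homology of `(ℝ^p, ℝ^p \ 0)` and then that of successive skeleta: one copy of `M` for
-- each cell, permuted by `G` up to signs. Such a sum is flat if `M` is flat over the stabilizers
-- (`isFlat_of_monomial`).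

universe v w

namespace MooreFlat

/-! ### Flatness, relations, and injectivity of the character dual -/

section FlatCriteria

/-- The character dual `Hom_ℤ(M, ℚ/ℤ)` of a left `A`-module, a right `A`-module. -/
def CharDual (_A : Type u) (M : Type u) [AddCommGroup M] : Type u := M →+ AddCircle (1 : ℚ)

variable (A : Type u) (M : Type u) [AddCommGroup M]

instance : AddCommGroup (CharDual A M) := inferInstanceAs (AddCommGroup (M →+ AddCircle (1 : ℚ)))

instance : FunLike (CharDual A M) M (AddCircle (1 : ℚ)) :=
  inferInstanceAs (FunLike (M →+ AddCircle (1 : ℚ)) M (AddCircle (1 : ℚ)))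

instance : AddMonoidHomClass (CharDual A M) M (AddCircle (1 : ℚ)) :=
  inferInstanceAs (AddMonoidHomClass (M →+ AddCircle (1 : ℚ)) M (AddCircle (1 : ℚ)))

variable {A M}

@[ext] theorem CharDual.ext {χ ψ : CharDual A M} (h : ∀ x, χ x = ψ x) : χ = ψ :=
  DFunLike.ext _ _ h

@[simp] theorem CharDual.add_apply (χ ψ : CharDual A M) (x : M) : (χ + ψ) x = χ x + ψ x := rfl

@[simp] theorem CharDual.sub_apply (χ ψ : CharDual A M) (x : M) : (χ - ψ) x = χ x - ψ x := rfl

@[simp] theorem CharDual.zero_apply (x : M) : (0 : CharDual A M) x = 0 := rfl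

/-- Evaluation at `x`, as an additive map. -/
def CharDual.eval (A : Type u) {M : Type u} [AddCommGroup M] (x : M) :
    CharDual A M →+ AddCircle (1 : ℚ) :=
  (AddMonoidHom.eval x : (M →+ AddCircle (1 : ℚ)) →+ AddCircle (1 : ℚ))

@[simp] theorem CharDual.eval_apply (x : M) (χ : CharDual A M) : CharDual.eval A x χ = χ x := rfl

theorem CharDual.sum_apply {ι : Type*} (s : Finset ι) (χ : ι → CharDual A M) (x : M) :
    (∑ i ∈ s, χ i) x = ∑ i ∈ s, χ i x :=
  map_sum (CharDual.eval A x) χ s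

variable (A M) in
/-- A character, as an element of the right module `CharDual A M`. -/
def CharDual.mk : (M →+ AddCircle (1 : ℚ)) →+ CharDual A M := AddMonoidHom.id _

@[simp] theorem CharDual.mk_apply (f : M →+ AddCircle (1 : ℚ)) (x : M) :
    CharDual.mk A M f x = f x := rfl

variable [Ring A] [Module A M]

instance : Module Aᵐᵒᵖ (CharDual A M) where
  smul a χ := CharDual.mk A M
    ((χ : M →+ AddCircle (1 : ℚ)).comp (DistribSMul.toAddMonoidHom M a.unop))
  one_smul χ := by
    ext x
    exact congrArg χ (one_smul A x)
  mul_smul a b χ := by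
    ext x
    exact congrArg χ (mul_smul b.unop a.unop x)
  smul_zero a := rfl
  smul_add a χ ψ := rfl
  add_smul a b χ := by
    ext x
    exact (congrArg χ (add_smul a.unop b.unop x)).trans (map_add χ _ _)
  zero_smul χ := by
    ext x
    exact (congrArg χ (zero_smul A x)).trans (map_zero χ)

@[simp] theorem CharDual.smul_apply (a : Aᵐᵒᵖ) (χ : CharDual A M) (x : M) :
    (a • χ) x = χ (a.unop • x) := rfl

variable (A M)

/-- The equational criterion for flatness: every relation `∑ aᵢ mᵢ = 0` in `M` follows from
relations in `A`. -/
def EqFlat : Prop :=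
  ∀ (ι : Type) [Fintype ι] (a : ι → A) (m : ι → M), ∑ i, a i • m i = 0 →
    m ∈ AddSubgroup.closure
      {v : ι → M | ∃ (b : ι → A) (x : M), ∑ i, a i * b i = 0 ∧ v = fun i => b i • x}

variable {A M}

/-- The map on `N ⊗[ℤ] M` induced by a biadditive map. -/
noncomputable def tensorLift {N M P : Type*} [AddCommGroup N] [AddCommGroup M] [AddCommGroup P]
    (f : N →+ M →+ P) : N ⊗[ℤ] M →+ P :=
  TensorProduct.liftAddHom f (fun r n m => by simp)

@[simp] theorem tensorLift_tmul {N M P : Type*} [AddCommGroup N] [AddCommGroup M]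
    [AddCommGroup P] (f : N →+ M →+ P) (n : N) (m : M) : tensorLift f (n ⊗ₜ m) = f n m := rfl

/-- The map on `N ⊗_A M` induced by a balanced biadditive map. -/
noncomputable def BalancedTensor.lift {N : Type u} [AddCommGroup N] [Module Aᵐᵒᵖ N]
    {P : Type*} [AddCommGroup P] (f : N →+ M →+ P)
    (hf : ∀ n (a : A) m, f (MulOpposite.op a • n) m = f n (a • m)) :
    BalancedTensor A N M →+ P :=
  QuotientAddGroup.lift (balancedRel A N M)
    (tensorLift f) (by
      rw [balancedRel, AddSubgroup.closure_le]
      rintro _ ⟨n, a, m, rfl⟩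
      simp [AddMonoidHom.mem_ker, hf])

/-- The class of a pure tensor. -/
def BalancedTensor.tmul (A : Type u) [Ring A] {N : Type u} [AddCommGroup N] [Module Aᵐᵒᵖ N]
    {M : Type u} [AddCommGroup M] [Module A M] (n : N) (m : M) : BalancedTensor A N M :=
  QuotientAddGroup.mk (n ⊗ₜ[ℤ] m)

@[simp] theorem BalancedTensor.lift_tmul {N : Type u} [AddCommGroup N] [Module Aᵐᵒᵖ N]
    {P : Type*} [AddCommGroup P] (f : N →+ M →+ P) (hf) (n : N) (m : M) :
    BalancedTensor.lift (A := A) f hf (BalancedTensor.tmul A n m) = f n m := rfl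

@[simp] theorem BalancedTensor.map_tmul {N N' : Type u} [AddCommGroup N] [Module Aᵐᵒᵖ N]
    [AddCommGroup N'] [Module Aᵐᵒᵖ N'] (f : N →ₗ[Aᵐᵒᵖ] N') (n : N) (m : M) :
    BalancedTensor.map A M f (BalancedTensor.tmul A n m) = BalancedTensor.tmul A (f n) m := rfl

theorem BalancedTensor.smul_tmul {N : Type u} [AddCommGroup N] [Module Aᵐᵒᵖ N] (n : N) (a : A)
    (m : M) : BalancedTensor.tmul A (MulOpposite.op a • n) m = BalancedTensor.tmul A n (a • m) := by
  rw [tmul, tmul, ← sub_eq_zero, ← QuotientAddGroup.mk_sub, QuotientAddGroup.eq_zero_iff]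
  exact AddSubgroup.subset_closure ⟨n, a, m, rfl⟩

/-- `tmul` as a biadditive map. -/
def BalancedTensor.tmulHom (A : Type u) [Ring A] (N : Type u) [AddCommGroup N] [Module Aᵐᵒᵖ N]
    (M : Type u) [AddCommGroup M] [Module A M] : N →+ M →+ BalancedTensor A N M :=
  AddMonoidHom.mk' (fun n => AddMonoidHom.mk' (fun m => tmul A n m) fun m m' => by
    simp [tmul, TensorProduct.tmul_add]) fun n n' => by
      ext m
      simp [tmul, TensorProduct.add_tmul]

@[simp] theorem BalancedTensor.tmulHom_apply {N : Type u} [AddCommGroup N] [Module Aᵐᵒᵖ N]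
    (n : N) (m : M) : tmulHom A N M n m = tmul A n m := rfl

theorem BalancedTensor.hom_ext {N : Type u} [AddCommGroup N] [Module Aᵐᵒᵖ N]
    {P : Type*} [AddCommGroup P] {f g : BalancedTensor A N M →+ P}
    (h : ∀ n m, f (tmul A n m) = g (tmul A n m)) : f = g := by
  refine DFunLike.ext _ _ fun x => ?_
  obtain ⟨z, rfl⟩ := QuotientAddGroup.mk_surjective x
  induction z using TensorProduct.induction_on with
  | zero => simp
  | tmul n m => exact h n m
  | add a b ha hb => rw [QuotientAddGroup.mk_add, map_add, map_add, ha, hb]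

/-- A single injection is tested: `A^ι` modulo the kernel of the row `b ↦ ∑ aᵢ bᵢ`, into `A`. The
tensor `∑ eᵢ ⊗ mᵢ` goes to `1 ⊗ ∑ aᵢ mᵢ = 0`, so it vanishes, and its image under `b ⊗ x ↦ (bᵢ x)`
is the class of `m` modulo the trivial solutions. -/
theorem IsFlat.eqFlat (h : IsFlat A M) : EqFlat A M := by
  intro ι _ a m hm
  classical
  let row : (ι → A) →ₗ[Aᵐᵒᵖ] A :=
    { toFun b := ∑ i, a i * b i
      map_add' b b' := by simp [mul_add, Finset.sum_add_distrib]
      map_smul' c b := by simp [Finset.sum_mul, mul_assoc] }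
  set P := AddSubgroup.closure
      {v : ι → M | ∃ (b : ι → A) (x : M), ∑ i, a i * b i = 0 ∧ v = fun i => b i • x}
  let L := LinearMap.ker row
  let f : ((ι → A) ⧸ L) →ₗ[Aᵐᵒᵖ] A := L.liftQ row le_rfl
  have hf : Function.Injective f := LinearMap.ker_eq_bot.1 (L.ker_liftQ_eq_bot row le_rfl le_rfl)
  let g : (ι → A) →+ M →+ (ι → M) ⧸ P :=
    AddMonoidHom.mk' (fun b => AddMonoidHom.mk' (fun x => QuotientAddGroup.mk fun i => b i • x)
      (fun x y => by rw [← QuotientAddGroup.mk_add]; congr 1; ext; simp [smul_add]))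
      (fun b b' => by
        ext x
        simp only [AddMonoidHom.mk'_apply, AddMonoidHom.add_apply]
        rw [← QuotientAddGroup.mk_add]; congr 1; ext; simp [add_smul])
  let g' : ((ι → A) ⧸ L) →+ M →+ (ι → M) ⧸ P := QuotientAddGroup.lift L.toAddSubgroup g (by
    intro b hb
    ext x
    exact (QuotientAddGroup.eq_zero_iff _).2
      (AddSubgroup.subset_closure ⟨b, x, LinearMap.mem_ker.1 hb, rfl⟩))
  have hg' : ∀ b x, g' (L.mkQ b) x = QuotientAddGroup.mk fun i => b i • x := fun b x => rfl
  let Ψ : BalancedTensor A ((ι → A) ⧸ L) M →+ (ι → M) ⧸ P := BalancedTensor.lift g' (by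
    intro n c x
    obtain ⟨b, rfl⟩ := L.mkQ_surjective n
    rw [← map_smul, hg', hg']
    congr 1
    ext i
    simp [mul_smul])
  let t : BalancedTensor A ((ι → A) ⧸ L) M :=
    ∑ i, BalancedTensor.tmul A (L.mkQ (Pi.single i 1)) (m i)
  have ht : t = 0 := by
    apply h _ _ f hf
    rw [map_zero, map_sum]
    have : ∀ i, BalancedTensor.map A M f (BalancedTensor.tmul A (L.mkQ (Pi.single i 1)) (m i)) =
        BalancedTensor.tmulHom A A M 1 (a i • m i) := by
      intro i
      have h1 : f (L.mkQ (Pi.single i 1)) = MulOpposite.op (a i) • (1 : A) := by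
        simp [f, row, Pi.single_apply]
      rw [BalancedTensor.map_tmul, h1, BalancedTensor.smul_tmul, BalancedTensor.tmulHom_apply]
    simp_rw [this]
    rw [← map_sum, hm, map_zero]
  have h2 : Ψ t = QuotientAddGroup.mk m := by
    simp only [t, map_sum, Ψ, BalancedTensor.lift_tmul, hg']
    rw [← QuotientAddGroup.mk_sum]
    congr 1
    ext j
    simp [Finset.sum_apply, Pi.single_apply, ite_smul]
  rw [ht, map_zero] at h2
  exact (QuotientAddGroup.eq_zero_iff _).1 h2.symm

theorem baer_int_addCircle : Module.Baer ℤ (AddCircle (1 : ℚ)) := Module.Baer.of_divisible _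

/-- Baer's criterion. A map from a right ideal `I` to the dual amounts to a character of `I ⊗ M`. By
the equational criterion that character vanishes on the kernel of the multiplication `I ⊗ M → M`, so
it descends to the image, and it extends to `M` because `ℚ/ℤ` is divisible. -/
theorem EqFlat.injective_charDual (h : EqFlat A M) : Module.Injective Aᵐᵒᵖ (CharDual A M) := by
  apply Module.Baer.injective
  intro I g
  let β : I ⊗[ℤ] M →+ M := tensorLift
    (AddMonoidHom.mk' (fun c : I => AddMonoidHom.mk' (fun x : M => c.1.unop • x)
      (fun x y => smul_add _ x y)) (fun c c' => by ext x; simp [add_smul]))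
  let γ : I ⊗[ℤ] M →+ AddCircle (1 : ℚ) := tensorLift
    (AddMonoidHom.mk' (fun c : I => AddMonoidHom.mk' (fun x : M => g c x)
      (fun x y => map_add _ x y)) (fun c c' => by ext x; simp))
  have hker : β.ker ≤ γ.ker := by
    intro t ht
    obtain ⟨n, c, x, rfl⟩ := TensorProduct.exists_sum_tmul_eq t
    rw [AddMonoidHom.mem_ker] at ht ⊢
    simp only [map_sum, β, γ, tensorLift_tmul, AddMonoidHom.mk'_apply] at ht ⊢
    have := h (Fin n) (fun j => (c j).1.unop) x ht
    generalize x = v at this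
    induction this using AddSubgroup.closure_induction with
    | mem v hv =>
      obtain ⟨b, y, hb, rfl⟩ := hv
      have : ∀ j, (g (c j)) (b j • y) = g (MulOpposite.op (b j) • c j) y := by
        intro j
        exact (DFunLike.congr_fun (map_smul g (MulOpposite.op (b j)) (c j)) y).symm
      simp_rw [this]
      rw [← CharDual.sum_apply, ← map_sum]
      have h0 : ∑ j, MulOpposite.op (b j) • c j = 0 := by
        apply Subtype.ext
        apply MulOpposite.unop_injective
        simpa using hb
      rw [h0]
      simp
    | zero => simp
    | add v w _ _ hv hw => simp [Finset.sum_add_distrib, hv, hw]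
    | neg v _ hv => simp [hv]
  obtain ⟨ψ, hψ⟩ := Module.Baer.extension_property_addMonoidHom baer_int_addCircle
    (QuotientAddGroup.kerLift β) (QuotientAddGroup.kerLift_injective β)
    (QuotientAddGroup.lift _ γ hker)
  refine ⟨LinearMap.toSpanSingleton _ _ (CharDual.mk A M ψ), fun c hc => ?_⟩
  ext x
  have := DFunLike.congr_fun hψ (QuotientAddGroup.mk ((⟨c, hc⟩ : I) ⊗ₜ[ℤ] x))
  exact this

/-- Characters of `N ⊗ M` are right-linear maps from `N` to the dual of `M`, and these extend along
`f`. Hence every character of `N ⊗ M` factors through `f ⊗ id`, and characters separate points. -/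
theorem isFlat_of_injective_charDual (h : Module.Injective Aᵐᵒᵖ (CharDual A M)) : IsFlat A M := by
  intro N _ _ N' _ _ f hf
  rw [injective_iff_map_eq_zero]
  intro t ht
  refine CharacterModule.eq_zero_of_character_apply fun χ => ?_
  let χ' : BalancedTensor A N M →+ AddCircle (1 : ℚ) := χ
  let φ : N →ₗ[Aᵐᵒᵖ] CharDual A M :=
    { toFun n := CharDual.mk A M (χ'.comp (BalancedTensor.tmulHom A N M n))
      map_add' n n' := by ext x; simp
      map_smul' a n := by
        ext x
        exact congrArg χ' (BalancedTensor.smul_tmul n a.unop x) }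
  obtain ⟨φ', hφ'⟩ := h.out f hf φ
  let χ'' : BalancedTensor A N' M →+ AddCircle (1 : ℚ) := BalancedTensor.lift
    (AddMonoidHom.mk' (fun n => (φ' n : M →+ AddCircle (1 : ℚ))) (fun a b => map_add φ' a b)) (by
      intro n a m
      exact DFunLike.congr_fun (map_smul φ' (MulOpposite.op a) n) m)
  have : χ''.comp (BalancedTensor.map A M f) = χ' :=
    BalancedTensor.hom_ext fun n m => DFunLike.congr_fun (hφ' n) m
  change χ' t = 0
  rw [← this, AddMonoidHom.comp_apply, ht, map_zero]

theorem isFlat_iff_eqFlat : IsFlat A M ↔ EqFlat A M :=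
  ⟨IsFlat.eqFlat, fun h => isFlat_of_injective_charDual h.injective_charDual⟩

theorem isFlat_iff_injective_charDual : IsFlat A M ↔ Module.Injective Aᵐᵒᵖ (CharDual A M) :=
  ⟨fun h => h.eqFlat.injective_charDual, isFlat_of_injective_charDual⟩

end FlatCriteria
end MooreFlat

namespace MooreFlat

/-! ### Flatness and change of groups -/

section ChangeOfRings

theorem EqFlat.of_semilinearEquiv {A B : Type u} [Ring A] [Ring B] {M' M : Type u}
    [AddCommGroup M'] [AddCommGroup M] [Module A M'] [Module B M] (θ : A ≃+* B) (e : M' ≃+ M)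
    (he : ∀ a x, e (a • x) = θ a • e x) (h : EqFlat B M) : EqFlat A M' := by
  intro ι _ a m hm
  have h1 := h ι (fun i => θ (a i)) (fun i => e (m i)) (by
    simp_rw [← he, ← map_sum, hm, map_zero])
  let E : (ι → M) →+ (ι → M') := AddMonoidHom.mk' (fun v i => e.symm (v i)) (by
    intro v w; ext i; simp)
  have h2 : E (fun i => e (m i)) = m := by ext i; simp [E]
  rw [← h2]
  have h3 := AddSubgroup.mem_map_of_mem E h1
  rw [AddMonoidHom.map_closure] at h3
  refine AddSubgroup.closure_mono ?_ h3
  rintro _ ⟨_, ⟨b, x, hb, rfl⟩, rfl⟩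
  refine ⟨fun i => θ.symm (b i), e.symm x, ?_, ?_⟩
  · apply θ.injective
    simpa using hb
  · ext i
    apply e.injective
    simp [E, he]

theorem IsFlat.of_semilinearEquiv {A B : Type u} [Ring A] [Ring B] {M' M : Type u}
    [AddCommGroup M'] [AddCommGroup M] [Module A M'] [Module B M] (θ : A ≃+* B) (e : M' ≃+ M)
    (he : ∀ a x, e (a • x) = θ a • e x) (h : IsFlat B M) : IsFlat A M' :=
  isFlat_iff_eqFlat.2 (h.eqFlat.of_semilinearEquiv θ e he)

theorem IsFlat.of_linearEquiv {A : Type u} [Ring A] {M' M : Type u}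
    [AddCommGroup M'] [AddCommGroup M] [Module A M'] [Module A M] (e : M' ≃ₗ[A] M)
    (h : IsFlat A M) : IsFlat A M' :=
  h.of_semilinearEquiv (RingEquiv.refl A) e.toAddEquiv (fun a x => map_smul e a x)

variable {k : Type u} [CommRing k] {K L : Type u} [Group K] [Group L]

/-- The left `kK`-linear projection of `kL` onto the coset `K t`, for an injective homomorphism
`φ : K → L`. -/
noncomputable def cosetProj (k : Type u) [CommRing k] (φ : K →* L) (hφ : Function.Injective φ)
    (t : L) : MonoidAlgebra k L →+ MonoidAlgebra k K :=
  AddMonoidHom.mk' (fun β => .ofCoeff (Finsupp.comapDomain (fun h => φ h * t) β.coeff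
    (((mul_left_injective t).comp hφ).injOn))) (by
      intro β γ
      ext h
      simp [Finsupp.comapDomain_apply])

theorem coeff_cosetProj (φ : K →* L) (hφ : Function.Injective φ) (t : L) (β : MonoidAlgebra k L)
    (h : K) : (cosetProj k φ hφ t β).coeff h = β.coeff (φ h * t) := by
  simp [cosetProj, Finsupp.comapDomain_apply]

theorem cosetProj_mul (φ : K →* L) (hφ : Function.Injective φ) (t : L) (a : MonoidAlgebra k K)
    (β : MonoidAlgebra k L) :
    cosetProj k φ hφ t (MonoidAlgebra.mapDomainRingHom k φ a * β) = a * cosetProj k φ hφ t β := by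
  induction a using MonoidAlgebra.induction_linear with
  | zero => simp
  | add x y hx hy => rw [map_add, add_mul, map_add, hx, hy, add_mul]
  | single g r =>
    ext h
    simp [coeff_cosetProj, MonoidAlgebra.coeff_single_mul_apply, mul_assoc]

theorem coeff_map_cosetProj_mul (φ : K →* L) (hφ : Function.Injective φ) (t : L)
    (β : MonoidAlgebra k L) (l : L) [Decidable (l * t⁻¹ ∈ φ.range)] :
    (MonoidAlgebra.mapDomainRingHom k φ (cosetProj k φ hφ t β) * MonoidAlgebra.single t 1).coeff l
      = if l * t⁻¹ ∈ φ.range then β.coeff l else 0 := by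
  rw [MonoidAlgebra.coeff_mul_single_apply, mul_one]
  simp only [MonoidAlgebra.mapDomainRingHom_apply, MonoidAlgebra.coeff_mapDomain]
  split_ifs with h
  · obtain ⟨y, hy⟩ := h
    rw [← hy, Finsupp.mapDomain_apply hφ, coeff_cosetProj, hy]
    simp
  · exact Finsupp.mapDomain_of_notMem_range _ _ h

/-- The left `kK`-module `kL` is free on representatives of the cosets `K t`; finitely many of them
serve all the `b i` at once. -/
theorem exists_coset_decomposition (φ : K →* L) (hφ : Function.Injective φ) {ι : Type}
    [Fintype ι] (b : ι → MonoidAlgebra k L) : ∃ T : Finset L, ∀ i,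
      b i = ∑ t ∈ T, MonoidAlgebra.mapDomainRingHom k φ (cosetProj k φ hφ t (b i)) *
        MonoidAlgebra.single t 1 := by
  classical
  let rep : L → L := fun l => (Quotient.mk (QuotientGroup.rightRel φ.range) l).out
  have hrep : ∀ l, l * (rep l)⁻¹ ∈ φ.range := fun l =>
    QuotientGroup.rightRel_apply.1 (Quotient.mk_out (s := QuotientGroup.rightRel φ.range) l)
  -- Distinct representatives lie in distinct cosets, so a given coefficient receives a contribution
  -- from one summand only.
  have hrep' : ∀ l l', l * (rep l')⁻¹ ∈ φ.range → rep l' = rep l := by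
    intro l l' h
    have h1 : Quotient.mk (QuotientGroup.rightRel φ.range) (rep l') =
        Quotient.mk (QuotientGroup.rightRel φ.range) l :=
      Quotient.sound (QuotientGroup.rightRel_apply.2 h)
    have h2 : Quotient.mk (QuotientGroup.rightRel φ.range) (rep l') =
        Quotient.mk (QuotientGroup.rightRel φ.range) l' := Quotient.out_eq _
    exact congrArg Quotient.out (h2.symm.trans h1)
  refine ⟨(Finset.univ.biUnion fun i => (b i).coeff.support).image rep, fun i => ?_⟩
  ext l
  rw [MonoidAlgebra.coeff_sum, Finsupp.finsetSum_apply]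
  simp_rw [coeff_map_cosetProj_mul]
  by_cases hl : (b i).coeff l = 0
  · simp [hl]
  · rw [Finset.sum_eq_single (rep l), if_pos (hrep l)]
    · intro t ht htl
      obtain ⟨l', -, rfl⟩ := Finset.mem_image.1 ht
      rw [if_neg fun h => htl (hrep' l l' h)]
    · intro h
      exact absurd (Finset.mem_image_of_mem rep (Finset.mem_biUnion.2
        ⟨i, Finset.mem_univ i, Finsupp.mem_support_iff.2 hl⟩)) h

/-- Flatness is inherited by restriction along an injective group homomorphism. -/
theorem IsFlat.restrict (φ : K →* L) (hφ : Function.Injective φ) {M' M : Type u}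
    [AddCommGroup M'] [AddCommGroup M] [Module (MonoidAlgebra k K) M']
    [Module (MonoidAlgebra k L) M] (e : M' ≃+ M)
    (he : ∀ a x, e (a • x) = MonoidAlgebra.mapDomainRingHom k φ a • e x)
    (h : IsFlat (MonoidAlgebra k L) M) : IsFlat (MonoidAlgebra k K) M' := by
  rw [isFlat_iff_eqFlat] at h ⊢
  intro ι _ a m hm
  have h1 := h ι (fun i => MonoidAlgebra.mapDomainRingHom k φ (a i)) (fun i => e (m i)) (by
    simp_rw [← he, ← map_sum, hm, map_zero])
  let E : (ι → M) →+ (ι → M') := AddMonoidHom.mk' (fun v i => e.symm (v i)) (by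
    intro v w; ext i; simp)
  have h2 : E (fun i => e (m i)) = m := by ext i; simp [E]
  rw [← h2]
  have h3 := AddSubgroup.mem_map_of_mem E h1
  rw [AddMonoidHom.map_closure] at h3
  refine (AddSubgroup.closure_le _).2 ?_ h3
  rintro _ ⟨_, ⟨b, x, hb, rfl⟩, rfl⟩
  obtain ⟨T, hT⟩ := exists_coset_decomposition φ hφ b
  -- A trivial solution over `kL` splits along the cosets as `bᵢ x = ∑ₜ bᵢₜ (t x)`. The relation `∑
  -- aᵢ bᵢ = 0` gives `∑ aᵢ bᵢₜ = 0` for each `t`, since the coset projections are left `kK`-linear.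
  have h4 : E (fun i => b i • x) = ∑ t ∈ T, fun i => cosetProj k φ hφ t (b i) •
      e.symm (MonoidAlgebra.single t (1 : k) • x) := by
    ext i
    apply e.injective
    simp only [Finset.sum_apply, map_sum, he, AddEquiv.apply_symm_apply, E,
      AddMonoidHom.mk'_apply]
    conv_lhs => rw [hT i, Finset.sum_smul]
    simp_rw [mul_smul]
  rw [h4]
  refine sum_mem fun t _ => AddSubgroup.subset_closure ⟨_, _, ?_, rfl⟩
  simp_rw [← cosetProj_mul]
  rw [← map_sum, hb, map_zero]

theorem isFlat_res_of_isFlat {M : Type u} [AddCommGroup M] [Module (MonoidAlgebra k L) M]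
    (S : Subgroup L) (h : IsFlat (MonoidAlgebra k L) M) :
    IsFlat (MonoidAlgebra k S) (Res k S M) :=
  h.restrict S.subtype S.subtype_injective (AddEquiv.refl M) fun _ _ => rfl

/-- A module is flat if its restrictions to the finitely generated subgroups are flat. -/
theorem isFlat_of_forall_fg {M : Type u} [AddCommGroup M] [Module (MonoidAlgebra k L) M]
    (h : ∀ F : Subgroup L, F.FG → IsFlat (MonoidAlgebra k F) (Res k F M)) :
    IsFlat (MonoidAlgebra k L) M := by
  classical
  rw [isFlat_iff_eqFlat]
  intro ι _ a m hm
  -- The coefficients of the relation involve finitely many group elements, so the relation lives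
  -- over the subgroup that these generate.
  let s : Finset L := Finset.univ.biUnion fun i => (a i).coeff.support
  let F : Subgroup L := Subgroup.closure s
  have ha : ∀ i, ∃ a' : MonoidAlgebra k F, MonoidAlgebra.mapDomainRingHom k F.subtype a' = a i := by
    intro i
    refine ⟨.ofCoeff (Finsupp.comapDomain F.subtype (a i).coeff F.subtype_injective.injOn), ?_⟩
    apply MonoidAlgebra.coeff_injective
    simp only [MonoidAlgebra.mapDomainRingHom_apply, MonoidAlgebra.coeff_mapDomain]
    refine Finsupp.mapDomain_comapDomain _ F.subtype_injective _ fun l hl => ?_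
    exact ⟨⟨l, Subgroup.subset_closure (Finset.mem_coe.2
      (Finset.mem_biUnion.2 ⟨i, Finset.mem_univ i, hl⟩))⟩, rfl⟩
  choose a' ha' using ha
  have h1 := (h F ⟨s, rfl⟩).eqFlat ι a' m (by
    simp_rw [← ha'] at hm
    exact hm)
  refine AddSubgroup.closure_mono ?_ h1
  rintro _ ⟨b, x, hb, rfl⟩
  refine ⟨fun i => MonoidAlgebra.mapDomainRingHom k F.subtype (b i), x, ?_, rfl⟩
  simp_rw [← ha', ← map_mul, ← map_sum, hb, map_zero]

end ChangeOfRings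

end MooreFlat

namespace MooreFlat

/-! ### Diagonal modules, and group-ring actions described on the elements `c g` -/

section Diag

/-- The functions `J → M` of finite support, for a `G`-set `J` and a `kG`-module `M`, with the
diagonal action of `G`. -/
def Diag (_k _G : Type u) (J : Type*) (M : Type*) [AddCommGroup M] := J →₀ M

variable {k G : Type u}

noncomputable instance (J M : Type*) [AddCommGroup M] : AddCommGroup (Diag k G J M) :=
  inferInstanceAs (AddCommGroup (J →₀ M))

variable (k G) in
/-- The function with value `m` at `j` and `0` elsewhere. -/
noncomputable def Diag.single {J M : Type*} [AddCommGroup M] (j : J) : M →+ Diag k G J M :=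
  Finsupp.singleAddHom (M := M) j

theorem Diag.addHom_ext {J M P : Type*} [AddCommGroup M] [AddCommGroup P]
    {f f' : Diag k G J M →+ P}
    (h : ∀ j m, f (Diag.single k G j m) = f' (Diag.single k G j m)) : f = f' :=
  Finsupp.addHom_ext (f := (f : (J →₀ M) →+ P)) (g := f') h

variable (k G) in
/-- The additive map on `Diag k G J M` with given values on the functions `Diag.single`. -/
noncomputable def Diag.lift {J M P : Type*} [AddCommGroup M] [AddCommGroup P] (f : J → M →+ P) :
    Diag k G J M →+ P :=
  (Finsupp.liftAddHom f : (J →₀ M) →+ P)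

@[simp] theorem Diag.lift_single {J M P : Type*} [AddCommGroup M] [AddCommGroup P]
    (f : J → M →+ P) (j : J) (m : M) : Diag.lift k G f (Diag.single k G j m) = f j m := by
  change (Finsupp.liftAddHom f : (J →₀ M) →+ P) (Finsupp.single j m) = f j m
  simp

end Diag

section GroupRingModules

variable {k : Type u} [CommRing k] {G : Type u} [Group G]

/-- An additive map commuting with the elements `c g` of a group ring, as a linear map. -/
def linearMapOfSingle {V W : Type*} [AddCommGroup V] [AddCommGroup W]
    [Module (MonoidAlgebra k G) V] [Module (MonoidAlgebra k G) W] (f : V →+ W)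
    (hf : ∀ (g : G) (c : k) v, f ((MonoidAlgebra.single g c : MonoidAlgebra k G) • v) =
      (MonoidAlgebra.single g c : MonoidAlgebra k G) • f v) :
    V →ₗ[MonoidAlgebra k G] W :=
  { f with
    map_smul' := fun a v => by
      change f (a • v) = a • f v
      induction a using MonoidAlgebra.induction_linear with
      | zero => simp
      | add x y hx hy => rw [add_smul, map_add, hx, hy, add_smul]
      | single g c => exact hf g c v }

@[simp] theorem linearMapOfSingle_apply {V W : Type*} [AddCommGroup V] [AddCommGroup W]
    [Module (MonoidAlgebra k G) V] [Module (MonoidAlgebra k G) W] (f : V →+ W) (hf) (v : V) :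
    linearMapOfSingle (k := k) (G := G) f hf v = f v := rfl

/-- The right-module version of `linearMapOfSingle`. -/
def linearMapOfOpSingle {V W : Type*} [AddCommGroup V] [AddCommGroup W]
    [Module (MonoidAlgebra k G)ᵐᵒᵖ V] [Module (MonoidAlgebra k G)ᵐᵒᵖ W] (f : V →+ W)
    (hf : ∀ (g : G) (c : k) v, f (MulOpposite.op (MonoidAlgebra.single g c : MonoidAlgebra k G) • v) =
      MulOpposite.op (MonoidAlgebra.single g c : MonoidAlgebra k G) • f v) :
    V →ₗ[(MonoidAlgebra k G)ᵐᵒᵖ] W :=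
  { f with
    map_smul' := fun a v => by
      change f (a • v) = a • f v
      obtain ⟨a, rfl⟩ := MulOpposite.op_surjective a
      induction a using MonoidAlgebra.induction_linear with
      | zero => simp
      | add x y hx hy => rw [MulOpposite.op_add, add_smul, map_add, hx, hy, add_smul]
      | single g c => exact hf g c v }

@[simp] theorem linearMapOfOpSingle_apply {V W : Type*} [AddCommGroup V] [AddCommGroup W]
    [Module (MonoidAlgebra k G)ᵐᵒᵖ V] [Module (MonoidAlgebra k G)ᵐᵒᵖ W] (f : V →+ W) (hf) (v : V) :
    linearMapOfOpSingle (k := k) (G := G) f hf v = f v := rfl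

/-- An additive subgroup stable under the elements `c g` of a group ring, as a submodule. -/
def submoduleOfSingle {V : Type*} [AddCommGroup V] [Module (MonoidAlgebra k G) V]
    (P : AddSubgroup V)
    (hP : ∀ (g : G) (c : k), ∀ v ∈ P, (MonoidAlgebra.single g c : MonoidAlgebra k G) • v ∈ P) :
    Submodule (MonoidAlgebra k G) V :=
  { P with
    smul_mem' := fun a v hv => by
      change a • v ∈ P
      induction a using MonoidAlgebra.induction_linear with
      | zero => rw [zero_smul]; exact P.zero_mem
      | add x y hx hy => rw [add_smul]; exact P.add_mem hx hy
      | single g c => exact hP g c v hv }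

/-- The group-ring action given by a family of additive maps `E g c`, the actions of the
elements `c g`. -/
noncomputable def ringHomOfSingle {V : Type*} [AddCommGroup V]
    (E : G → k → V →+ V) (hone : E 1 1 = AddMonoidHom.id V)
    (hmul : ∀ g c g' c', E (g * g') (c * c') = (E g c).comp (E g' c'))
    (hadd : ∀ g c c', E g (c + c') = E g c + E g c') : MonoidAlgebra k G →+* AddMonoid.End V :=
  MonoidAlgebra.liftNCRingHom
    { toFun c := E 1 c
      map_one' := hone
      map_mul' c c' := by
        have := hmul 1 c 1 c'
        rw [one_mul] at this
        exact this
      map_zero' := by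
        have := hadd 1 0 0
        rw [add_zero] at this
        exact left_eq_add.1 this
      map_add' c c' := hadd 1 c c' }
    { toFun g := E g 1
      map_one' := hone
      map_mul' g g' := by
        have := hmul g 1 g' 1
        rw [one_mul] at this
        exact this }
    (fun c g => by
      have h1 := hmul 1 c g 1
      have h2 := hmul g 1 1 c
      rw [one_mul, mul_one] at h1 h2
      exact h1.symm.trans h2)

theorem ringHomOfSingle_single {V : Type*} [AddCommGroup V]
    (E : G → k → V →+ V) (hone : E 1 1 = AddMonoidHom.id V)
    (hmul : ∀ g c g' c', E (g * g') (c * c') = (E g c).comp (E g' c'))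
    (hadd : ∀ g c c', E g (c + c') = E g c + E g c') (g : G) (c : k) :
    ringHomOfSingle E hone hmul hadd (MonoidAlgebra.single g c) = E g c := by
  have h1 := hmul 1 c g 1
  rw [one_mul, mul_one] at h1
  rw [h1]
  exact MonoidAlgebra.liftNCRingHom_single _ _ _ g c

variable {J : Type*} [MulAction G J] {M : Type*} [AddCommGroup M] [Module (MonoidAlgebra k G) M]

/-- Multiplication by `a`, as an additive map. -/
noncomputable abbrev smulHom (M : Type*) [AddCommGroup M] [Module (MonoidAlgebra k G) M]
    (a : MonoidAlgebra k G) : M →+ M := DistribSMul.toAddMonoidHom M a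

/-- Functoriality of `J →₀ M` in both arguments. -/
noncomputable def finsuppPush {J J' M M' : Type*} [AddCommGroup M] [AddCommGroup M']
    (f : J → J') (α : M →+ M') : (J →₀ M) →+ (J' →₀ M') :=
  (Finsupp.mapDomain.addMonoidHom f).comp (Finsupp.mapRange.addMonoidHom α)

@[simp] theorem finsuppPush_single {J J' M M' : Type*} [AddCommGroup M] [AddCommGroup M']
    (f : J → J') (α : M →+ M') (j : J) (m : M) :
    finsuppPush f α (Finsupp.single j m) = Finsupp.single (f j) (α m) := by
  simp [finsuppPush]

variable (k G J M) in
/-- The action of `kG` on `Diag k G J M`. -/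
noncomputable def Diag.toEnd : MonoidAlgebra k G →+* AddMonoid.End (J →₀ M) :=
  ringHomOfSingle (V := J →₀ M) (fun g c => finsuppPush (g • ·) (smulHom M (.single g c)))
    (by
      refine Finsupp.addHom_ext fun j m => ?_
      simp [← MonoidAlgebra.one_def])
    (fun g c g' c' => by
      refine Finsupp.addHom_ext fun j m => ?_
      simp [mul_smul, ← MonoidAlgebra.single_mul_single])
    (fun g c c' => by
      refine Finsupp.addHom_ext fun j m => ?_
      simp [MonoidAlgebra.single_add, add_smul])

noncomputable instance : Module (MonoidAlgebra k G) (Diag k G J M) :=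
  letI : Module (MonoidAlgebra k G) (J →₀ M) := Module.compHom (J →₀ M) (Diag.toEnd k G J M)
  this

theorem Diag.single_smul (g : G) (c : k) (w : Diag k G J M) :
    (MonoidAlgebra.single g c : MonoidAlgebra k G) • w =
      finsuppPush (g • ·) (smulHom M (.single g c)) w := by
  have h : Diag.toEnd k G J M (MonoidAlgebra.single g c) =
      finsuppPush (g • ·) (smulHom M (.single g c)) := ringHomOfSingle_single ..
  exact DFunLike.congr_fun h w

theorem Diag.single_smul_single (g : G) (c : k) (j : J) (m : M) :
    (MonoidAlgebra.single g c : MonoidAlgebra k G) • Diag.single k G j m =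
      Diag.single k G (g • j) ((MonoidAlgebra.single g c : MonoidAlgebra k G) • m) := by
  rw [Diag.single_smul]
  exact finsuppPush_single _ _ _ _

end GroupRingModules

end MooreFlat

namespace MooreFlat

/-! ### Exactness of the character dual -/

section DualMaps

variable {A : Type u} [Ring A] {K F M : Type u} [AddCommGroup K] [AddCommGroup F] [AddCommGroup M]
  [Module A K] [Module A F] [Module A M]

/-- The map of right modules dual to a map of left modules. -/
def CharDual.map (f : F →ₗ[A] M) : CharDual A M →ₗ[Aᵐᵒᵖ] CharDual A F where
  toFun χ := CharDual.mk A F ((χ : M →+ AddCircle (1 : ℚ)).comp f.toAddMonoidHom)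
  map_add' χ ψ := rfl
  map_smul' a χ := by
    ext x
    exact congrArg χ (map_smul f a.unop x).symm

@[simp] theorem CharDual.map_apply (f : F →ₗ[A] M) (χ : CharDual A M) (x : F) :
    CharDual.map f χ x = χ (f x) := rfl

theorem CharDual.map_injective {f : F →ₗ[A] M} (hf : Function.Surjective f) :
    Function.Injective (CharDual.map f) := by
  intro χ ψ h
  ext y
  obtain ⟨x, rfl⟩ := hf y
  exact DFunLike.congr_fun h x

theorem CharDual.map_surjective {i : K →ₗ[A] F} (hi : Function.Injective i) :
    Function.Surjective (CharDual.map i) := by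
  intro χ
  obtain ⟨ψ, hψ⟩ := baer_int_addCircle.extension_property_addMonoidHom i.toAddMonoidHom hi χ
  exact ⟨CharDual.mk A F ψ, hψ⟩

/-- A character that vanishes on the image of `i` vanishes on the kernel of `f`, hence descends
along the surjection `f`. Together with the two preceding results, the dual of a short exact
sequence is short exact. -/
theorem CharDual.exists_map_eq {i : K →ₗ[A] F} {f : F →ₗ[A] M} (hf : Function.Surjective f)
    (hex : ∀ x, f x = 0 → ∃ y, i y = x) (χ : CharDual A F) (hχ : CharDual.map i χ = 0) :
    ∃ μ, CharDual.map f μ = χ := by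
  have hker : f.toAddMonoidHom.ker ≤ (χ : F →+ AddCircle (1 : ℚ)).ker := by
    intro x hx
    obtain ⟨y, rfl⟩ := hex x hx
    exact DFunLike.congr_fun hχ y
  refine ⟨CharDual.mk A M (f.toAddMonoidHom.liftOfSurjective hf ⟨χ, hker⟩), ?_⟩
  ext x
  exact f.toAddMonoidHom.liftOfRightInverse_comp_apply _ (Function.rightInverse_surjInv hf) ⟨(χ : F →+ AddCircle (1 : ℚ)), hker⟩ x

/-- A retract of an injective module is injective, and flatness is seen on the dual alone. -/
theorem IsFlat.of_charDual_retract (hF : IsFlat A F) (i : CharDual A M →ₗ[Aᵐᵒᵖ] CharDual A F)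
    (p : CharDual A F →ₗ[Aᵐᵒᵖ] CharDual A M) (hp : ∀ χ, p (i χ) = χ) : IsFlat A M := by
  rw [isFlat_iff_injective_charDual] at hF ⊢
  refine ⟨fun X Y _ _ _ _ f hf g => ?_⟩
  obtain ⟨h, hh⟩ := hF.out f hf (i ∘ₗ g)
  exact ⟨p ∘ₗ h, fun x => by simp [hh, hp]⟩

/-- The kernel of a surjection of flat modules is flat. -/
theorem IsFlat.ker_of_surjective (hF : IsFlat A F) (hM : IsFlat A M) {i : K →ₗ[A] F}
    {f : F →ₗ[A] M} (hi : Function.Injective i) (hf : Function.Surjective f)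
    (hex : ∀ x, f x = 0 ↔ ∃ y, i y = x) : IsFlat A K := by
  -- The dual of `M` is injective, so its embedding in the dual of `F` has a retraction `ρ`. Each
  -- character of `K` then has exactly one extension to `F` killed by `ρ`, and uniqueness makes the
  -- choice linear.
  obtain ⟨ρ, hρ⟩ := (isFlat_iff_injective_charDual.1 hM).out (CharDual.map f)
    (CharDual.map_injective hf) LinearMap.id
  have hif : ∀ μ : CharDual A M, CharDual.map i (CharDual.map f μ) = 0 := fun μ => by
    ext y
    simp [(hex (i y)).2 ⟨y, rfl⟩]
  have hex' : ∀ χ : CharDual A K, ∃ ψ, CharDual.map i ψ = χ ∧ ρ ψ = 0 := fun χ => by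
    obtain ⟨ψ, rfl⟩ := CharDual.map_surjective hi χ
    exact ⟨ψ - CharDual.map f (ρ ψ), by simp [hif], by simp [hρ]⟩
  have huniq : ∀ ψ, CharDual.map i ψ = 0 → ρ ψ = 0 → ψ = 0 := fun ψ h1 h2 => by
    obtain ⟨μ, rfl⟩ := CharDual.exists_map_eq hf (fun x => (hex x).1) ψ h1
    rw [hρ, LinearMap.id_apply] at h2
    rw [h2, map_zero]
  choose s hs1 hs2 using hex'
  let s' : CharDual A K →ₗ[Aᵐᵒᵖ] CharDual A F :=
    { toFun := s
      map_add' χ ψ := sub_eq_zero.1 (huniq _ (by simp [hs1]) (by simp [hs2]))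
      map_smul' a χ := sub_eq_zero.1 (huniq _ (by simp [hs1]) (by simp [hs2])) }
  exact hF.of_charDual_retract s' (CharDual.map i) hs1

end DualMaps

/-! ### Finite flat dimension and subgroups of finite index -/

section FiniteIndex

variable {k : Type u} [CommRing k] {G : Type u} [Group G]

theorem op_single_smul_op_single_smul {N : Type*} [AddCommGroup N]
    [Module (MonoidAlgebra k G)ᵐᵒᵖ N] (g g' : G) (c c' : k) (χ : N) :
    MulOpposite.op (MonoidAlgebra.single g c : MonoidAlgebra k G) •
      MulOpposite.op (MonoidAlgebra.single g' c' : MonoidAlgebra k G) • χ =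
    MulOpposite.op (MonoidAlgebra.single (g' * g) (c' * c) : MonoidAlgebra k G) • χ := by
  rw [smul_smul, ← MulOpposite.op_mul, MonoidAlgebra.single_mul_single]

theorem Diag.charDual_ext {J M : Type u} [MulAction G J] [AddCommGroup M]
    [Module (MonoidAlgebra k G) M] {χ ψ : CharDual (MonoidAlgebra k G) (Diag k G J M)}
    (h : ∀ (j : J) (m : M), χ (Diag.single k G j m) = ψ (Diag.single k G j m)) : χ = ψ :=
  Diag.addHom_ext (f := (χ : Diag k G J M →+ AddCircle (1 : ℚ))) (f' := ψ) h

/-- The dual of a flat module is relatively projective with respect to a subgroup of finite index: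
the identity is the trace of an `H`-equivariant endomorphism. -/
theorem IsFlat.exists_trace_eq_id (H : Subgroup G) [H.FiniteIndex] {K : Type u} [AddCommGroup K]
    [Module (MonoidAlgebra k G) K] (hK : IsFlat (MonoidAlgebra k G) K) :
    ∃ r : CharDual (MonoidAlgebra k G) K →+ CharDual (MonoidAlgebra k G) K,
      (∀ h ∈ H, ∀ (c : k) χ, r (MulOpposite.op (MonoidAlgebra.single h c) • χ) =
        MulOpposite.op (MonoidAlgebra.single h c) • r χ) ∧
      ∀ χ, ∑ᶠ q : G ⧸ H, MulOpposite.op (MonoidAlgebra.single q.out⁻¹ (1 : k)) •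
        r (MulOpposite.op (MonoidAlgebra.single q.out (1 : k)) • χ) = χ := by
  classical
  -- Summation `Tr : W → K` is a surjection, so its dual embeds `K*` in `W*`, and injectivity of
  -- `K*` gives a retraction `R`. Extension by zero off the coset `H`, called `δ`, is `H`-linear
  -- with trace `Tr*`; hence `R ∘ δ` has trace `R ∘ Tr* = id`.
  let W := Diag k G (G ⧸ H) K
  let Tr : W →ₗ[MonoidAlgebra k G] K := linearMapOfSingle
    (Diag.lift k G fun _ => AddMonoidHom.id K) (by
      intro g c w
      have : (Diag.lift k G fun _ : G ⧸ H => AddMonoidHom.id K).comp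
          (smulHom W (MonoidAlgebra.single g c)) =
          (smulHom K (MonoidAlgebra.single g c)).comp (Diag.lift k G fun _ => AddMonoidHom.id K) :=
        Diag.addHom_ext fun j m => by simp [W, Diag.single_smul_single]
      exact DFunLike.congr_fun this w)
  have hTr : ∀ q m, Tr (Diag.single k G q m) = m := fun q m => Diag.lift_single _ q m
  have hTrs : Function.Surjective Tr := fun m => ⟨_, hTr ((1 : G) : G ⧸ H) m⟩
  obtain ⟨R, hR⟩ := (isFlat_iff_injective_charDual.1 hK).out (CharDual.map Tr)
    (CharDual.map_injective hTrs) LinearMap.id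
  let δ : CharDual (MonoidAlgebra k G) K →+ CharDual (MonoidAlgebra k G) W :=
    AddMonoidHom.mk' (fun χ => CharDual.mk _ W ((χ : K →+ AddCircle (1 : ℚ)).comp
      (Finsupp.applyAddHom ((1 : G) : G ⧸ H) : (G ⧸ H →₀ K) →+ K))) (fun χ ψ => rfl)
  have hδ : ∀ χ q m, δ χ (Diag.single k G q m) =
      if q = ((1 : G) : G ⧸ H) then χ m else 0 := by
    intro χ q m
    have : δ χ (Diag.single k G q m) = χ ((Finsupp.single q m) ((1 : G) : G ⧸ H)) := rfl
    rw [this, Finsupp.single_apply]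
    split_ifs <;> simp
  refine ⟨R.toAddMonoidHom.comp δ, fun h hh c χ => ?_, fun χ => ?_⟩
  · have : δ (MulOpposite.op (MonoidAlgebra.single h c) • χ) =
        MulOpposite.op (MonoidAlgebra.single h c) • δ χ := by
      apply Diag.charDual_ext
      intro q m
      rw [CharDual.smul_apply, MulOpposite.unop_op, Diag.single_smul_single, hδ, hδ]
      have : h • q = ((1 : G) : G ⧸ H) ↔ q = ((1 : G) : G ⧸ H) := by
        rw [smul_eq_iff_eq_inv_smul, show h⁻¹ • ((1 : G) : G ⧸ H) = ((1 : G) : G ⧸ H) from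
          QuotientGroup.eq.2 (by simpa using hh)]
      simp only [this, CharDual.smul_apply, MulOpposite.unop_op]
    simp only [AddMonoidHom.comp_apply, this]
    exact map_smul R _ _
  · have : Fintype (G ⧸ H) := Fintype.ofFinite _
    rw [finsum_eq_sum_of_fintype]
    have : ∑ q : G ⧸ H, MulOpposite.op (MonoidAlgebra.single q.out⁻¹ (1 : k)) •
        δ (MulOpposite.op (MonoidAlgebra.single q.out (1 : k)) • χ) = CharDual.map Tr χ := by
      apply Diag.charDual_ext
      intro q m
      rw [CharDual.sum_apply, CharDual.map_apply, hTr, Finset.sum_eq_single q]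
      · rw [CharDual.smul_apply, MulOpposite.unop_op, Diag.single_smul_single, hδ, if_pos,
          CharDual.smul_apply, MulOpposite.unop_op, smul_smul, MonoidAlgebra.single_mul_single]
        · simp [← MonoidAlgebra.one_def]
        · rw [inv_smul_eq_iff]
          exact (QuotientGroup.out_eq' q).symm.trans (by simp)
      · intro q' _ hq'
        rw [CharDual.smul_apply, MulOpposite.unop_op, Diag.single_smul_single, hδ, if_neg]
        rw [inv_smul_eq_iff]
        intro h
        apply hq'
        rw [h]
        exact (QuotientGroup.out_eq' q').symm.trans (by simp)
      · simp
    have h2 := congrArg R this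
    rw [hR, LinearMap.id_apply, map_sum] at h2
    conv_rhs => rw [← h2]
    refine Finset.sum_congr rfl fun q _ => ?_
    exact (map_smul R _ _).symm

/-- Restriction to a subgroup of a linear map. -/
noncomputable def Res.map (H : Subgroup G) {V W : Type u} [AddCommGroup V] [AddCommGroup W]
    [Module (MonoidAlgebra k G) V] [Module (MonoidAlgebra k G) W]
    (f : V →ₗ[MonoidAlgebra k G] W) : Res k H V →ₗ[MonoidAlgebra k H] Res k H W where
  toFun := f
  map_add' := map_add f
  map_smul' a x := map_smul f (MonoidAlgebra.mapDomainRingHom k H.subtype a) (show V from x)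

/-- If `0 → K → F → M → 0` is exact with `K` and `F` flat over `kG`, and `M` is flat over a subgroup
of finite index, then `M` is flat over `kG`. -/
theorem isFlat_of_finiteIndex_of_exact (H : Subgroup G) [H.FiniteIndex] {K F M : Type u}
    [AddCommGroup K] [AddCommGroup F] [AddCommGroup M] [Module (MonoidAlgebra k G) K]
    [Module (MonoidAlgebra k G) F] [Module (MonoidAlgebra k G) M]
    {i : K →ₗ[MonoidAlgebra k G] F} {f : F →ₗ[MonoidAlgebra k G] M}
    (hi : Function.Injective i) (hf : Function.Surjective f) (hex : ∀ x, f x = 0 ↔ ∃ y, i y = x)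
    (hK : IsFlat (MonoidAlgebra k G) K) (hF : IsFlat (MonoidAlgebra k G) F)
    (hM : IsFlat (MonoidAlgebra k H) (Res k H M)) : IsFlat (MonoidAlgebra k G) M := by
  obtain ⟨r, hr, hr1⟩ := hK.exists_trace_eq_id H
  -- Over `kH` the dual of `M` is injective, so the dual sequence splits there. The retraction `ρ`
  -- commutes with `H`, not necessarily with `G`.
  obtain ⟨ρ', hρ'⟩ := (isFlat_iff_injective_charDual.1 hM).out (CharDual.map (Res.map H f))
    (CharDual.map_injective hf) LinearMap.id
  let ρ : CharDual (MonoidAlgebra k G) F →+ CharDual (MonoidAlgebra k G) M := ρ'.toAddMonoidHom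
  have hρ : ∀ μ, ρ (CharDual.map f μ) = μ := hρ'
  have hsmul : ∀ {N : Type u} [AddCommGroup N] [Module (MonoidAlgebra k G) N] (h : H) (c : k)
      (χ : CharDual (MonoidAlgebra k G) N),
      MulOpposite.op (MonoidAlgebra.single (h : G) c : MonoidAlgebra k G) • χ =
      (MulOpposite.op (MonoidAlgebra.single h c : MonoidAlgebra k H) •
        (show CharDual (MonoidAlgebra k H) (Res k H N) from χ)) := by
    intro N _ _ h c χ
    ext x
    have : (MonoidAlgebra.single h c : MonoidAlgebra k H) • (show Res k H N from x) =
        (MonoidAlgebra.single (h : G) c : MonoidAlgebra k G) • x := by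
      change MonoidAlgebra.mapDomainRingHom k H.subtype (MonoidAlgebra.single h c) • x = _
      simp
    exact congrArg χ this.symm
  have hρH : ∀ h ∈ H, ∀ (c : k) ψ, ρ (MulOpposite.op (MonoidAlgebra.single h c) • ψ) =
      MulOpposite.op (MonoidAlgebra.single h c) • ρ ψ := by
    intro h hh c ψ
    rw [hsmul ⟨h, hh⟩ c ψ, hsmul ⟨h, hh⟩ c (ρ ψ)]
    exact map_smul ρ' _ _
  have hif : ∀ μ, CharDual.map i (CharDual.map f μ) = 0 := fun μ => by
    ext y
    simp [(hex (i y)).2 ⟨y, rfl⟩]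
  have hex' : ∀ χ, ∃ ψ, CharDual.map i ψ = χ ∧ ρ ψ = 0 := fun χ => by
    obtain ⟨ψ, rfl⟩ := CharDual.map_surjective hi χ
    exact ⟨ψ - CharDual.map f (ρ ψ), by simp [hif], by simp [hρ]⟩
  have huniq : ∀ ψ, CharDual.map i ψ = 0 → ρ ψ = 0 → ψ = 0 := fun ψ h1 h2 => by
    obtain ⟨μ, rfl⟩ := CharDual.exists_map_eq hf (fun x => (hex x).1) ψ h1
    rw [hρ] at h2
    rw [h2, map_zero]
  choose s hs1 hs2 using hex'
  -- Here `s` is the section of `i*` with values in the kernel of `ρ`. The trace of `w = s ∘ r` is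
  -- `G`-linear, and it is still a section of `i*` because the trace of `r` is the identity.
  let w : CharDual (MonoidAlgebra k G) K →+ CharDual (MonoidAlgebra k G) F :=
    (AddMonoidHom.mk' s fun χ ψ =>
      sub_eq_zero.1 (huniq _ (by simp [hs1]) (by simp [hs2]))).comp r
  have hw : ∀ h ∈ H, ∀ (c : k) χ, w (MulOpposite.op (MonoidAlgebra.single h c) • χ) =
      MulOpposite.op (MonoidAlgebra.single h c) • w χ := by
    intro h hh c χ
    refine sub_eq_zero.1 (huniq _ ?_ ?_)
    · simp [w, hs1, hr h hh]
    · simp [w, hs2, hρH h hh]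
  have hiw : ∀ χ, CharDual.map i (w χ) = r χ := fun χ => hs1 _
  have : Fintype (G ⧸ H) := Fintype.ofFinite _
  let v : G → CharDual (MonoidAlgebra k G) K →+ CharDual (MonoidAlgebra k G) F := fun g =>
    AddMonoidHom.mk' (fun χ => MulOpposite.op (MonoidAlgebra.single g⁻¹ (1 : k)) •
      w (MulOpposite.op (MonoidAlgebra.single g (1 : k)) • χ)) (fun χ ψ => by simp)
  have hv : ∀ g χ, v g χ = MulOpposite.op (MonoidAlgebra.single g⁻¹ (1 : k)) •
      w (MulOpposite.op (MonoidAlgebra.single g (1 : k)) • χ) := fun g χ => rfl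
  -- The conjugate `v g` depends only on the coset `g H`; translating the cosets then shows that the
  -- sum over them is `G`-linear.
  have hvH : ∀ g, ∀ h ∈ H, v (g * h) = v g := by
    intro g h hh
    ext1 χ
    have : MulOpposite.op (MonoidAlgebra.single (g * h) (1 : k)) • χ =
        MulOpposite.op (MonoidAlgebra.single h (1 : k)) •
          MulOpposite.op (MonoidAlgebra.single g (1 : k)) • χ := by
      rw [op_single_smul_op_single_smul, one_mul]
    rw [hv, hv, this, hw h hh, op_single_smul_op_single_smul]
    simp
  have hvout : ∀ g : G, v (g : G ⧸ H).out = v g := by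
    intro g
    obtain ⟨h, hh⟩ := QuotientGroup.mk_out_eq_mul H g
    rw [hh, hvH g h h.2]
  have hvsmul : ∀ g x (c : k) χ, v g (MulOpposite.op (MonoidAlgebra.single x c) • χ) =
      MulOpposite.op (MonoidAlgebra.single x c) • v (x * g) χ := by
    intro g x c χ
    have : MulOpposite.op (MonoidAlgebra.single g (1 : k)) •
        MulOpposite.op (MonoidAlgebra.single x c) • χ =
        MulOpposite.op (MonoidAlgebra.single (1 : G) c) •
          MulOpposite.op (MonoidAlgebra.single (x * g) (1 : k)) • χ := by
      simp [op_single_smul_op_single_smul]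
    rw [hv, hv, this, hw 1 H.one_mem, op_single_smul_op_single_smul,
      op_single_smul_op_single_smul]
    simp
  let S : CharDual (MonoidAlgebra k G) K →ₗ[(MonoidAlgebra k G)ᵐᵒᵖ]
      CharDual (MonoidAlgebra k G) F :=
    linearMapOfOpSingle (∑ q : G ⧸ H, v q.out) (by
      intro x c χ
      simp only [AddMonoidHom.finsetSum_apply, hvsmul, ← Finset.smul_sum]
      congr 1
      refine (Fintype.sum_equiv (MulAction.toPerm x) _ _ fun q => ?_)
      rw [← hvout]
      congr 2
      conv_rhs => rw [← QuotientGroup.out_eq' q]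
      rfl)
  have hiS : ∀ χ, CharDual.map i (S χ) = χ := by
    intro χ
    conv_rhs => rw [← hr1 χ, finsum_eq_sum_of_fintype]
    simp only [S, linearMapOfOpSingle_apply, AddMonoidHom.finsetSum_apply, map_sum, hv, map_smul,
      hiw]
  rw [isFlat_iff_injective_charDual] at hF ⊢
  refine ⟨fun X Y _ _ _ _ a ha b => ?_⟩
  obtain ⟨h, hh⟩ := hF.out a ha (CharDual.map f ∘ₗ b)
  -- The map `1 - S ∘ i*` projects the dual of `F` onto the kernel of `i*`, which is the dual of
  -- `M`. So an extension with values in `F*` can be corrected to one with values in `M*`.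
  let h' := h - S ∘ₗ CharDual.map i ∘ₗ h
  have h1 : ∀ y, ∃ μ, CharDual.map f μ = h' y := fun y =>
    CharDual.exists_map_eq hf (fun x => (hex x).1) _ (by simp [h', hiS])
  choose c hc using h1
  have hinj := CharDual.map_injective (A := MonoidAlgebra k G) hf
  refine ⟨{ toFun := c
            map_add' := fun x y => hinj (by simp [hc])
            map_smul' := fun t x => hinj (by simp [hc]) }, fun x => hinj ?_⟩
  refine (hc _).trans ?_
  simp [h', hh, hif]

/-- A module of finite flat dimension over `kG` which is flat over a subgroup of finite index is
flat. -/
theorem FlatDimLE.isFlat_of_finiteIndex (H : Subgroup G) [H.FiniteIndex] (n : ℕ) :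
    ∀ {M : Type u} [AddCommGroup M] [Module (MonoidAlgebra k G) M],
    FlatDimLE (MonoidAlgebra k G) n M → IsFlat (MonoidAlgebra k H) (Res k H M) →
    IsFlat (MonoidAlgebra k G) M := by
  induction n with
  | zero => exact fun h _ => h
  | succ n ih =>
    rintro M _ _ ⟨F, _, _, f, hF, hf, hK⟩ hM
    have hex : ∀ x, f x = 0 ↔ ∃ y, (LinearMap.ker f).subtype y = x := fun x =>
      ⟨fun h => ⟨⟨x, h⟩, rfl⟩, by rintro ⟨y, rfl⟩; exact y.2⟩
    -- The induction hypothesis needs the kernel to be flat over `kH`, where it is the kernel of a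
    -- surjection between flat modules.
    have hKH : IsFlat (MonoidAlgebra k H) (Res k H (LinearMap.ker f)) := by
      exact (isFlat_res_of_isFlat H hF).ker_of_surjective hM
        (i := Res.map H (LinearMap.ker f).subtype) (f := Res.map H f)
        (LinearMap.ker f).injective_subtype hf hex
    exact isFlat_of_finiteIndex_of_exact H (LinearMap.ker f).injective_subtype hf hex
      (ih hK hKH) hF hM

theorem FlatDimLE.of_linearEquiv {A : Type u} [Ring A] (n : ℕ) : ∀ {V W : Type u} [AddCommGroup V]
    [AddCommGroup W] [Module A V] [Module A W] (_ : V ≃ₗ[A] W), FlatDimLE A n V → FlatDimLE A n W := by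
  induction n with
  | zero => exact fun e h => IsFlat.of_linearEquiv e.symm h
  | succ n ih =>
    rintro V W _ _ _ _ e ⟨F, _, _, f, hF, hf, hK⟩
    refine ⟨F, _, _, e.toLinearMap ∘ₗ f, hF, e.surjective.comp hf, ?_⟩
    exact ih (LinearEquiv.ofEq _ _ (LinearMap.ker_comp_of_ker_eq_bot _ e.ker).symm) hK

/-- Flat dimension is bounded along short exact sequences with flat middle term. -/
theorem FlatDimLE.succ_of_exact {A : Type u} [Ring A] {n : ℕ} {K F M : Type u}
    [AddCommGroup K] [AddCommGroup F] [AddCommGroup M] [Module A K] [Module A F] [Module A M]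
    {i : K →ₗ[A] F} {f : F →ₗ[A] M} (hi : Function.Injective i) (hf : Function.Surjective f)
    (hex : ∀ x, f x = 0 ↔ ∃ y, i y = x) (hF : IsFlat A F) (hK : FlatDimLE A n K) :
    FlatDimLE A (n + 1) M := by
  refine ⟨F, _, _, f, hF, hf, FlatDimLE.of_linearEquiv n ((LinearEquiv.ofInjective i hi).trans
    (LinearEquiv.ofEq _ _ ?_)) hK⟩
  ext x
  exact (hex x).symm

end FiniteIndex

end MooreFlat

namespace MooreFlat

/-! ### Direct sums permuted up to signs -/

section Monomial

variable {k : Type u} [CommRing k] {G : Type u} [Group G]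

/-- The restriction of a right `kG`-module to a subgroup. -/
def ResOp (_k : Type u) {G : Type u} [Group G] (_T : Subgroup G) (X : Type u) : Type u := X

instance (T : Subgroup G) (X : Type u) [AddCommGroup X] : AddCommGroup (ResOp k T X) :=
  inferInstanceAs (AddCommGroup X)

noncomputable instance (T : Subgroup G) (X : Type u) [AddCommGroup X]
    [Module (MonoidAlgebra k G)ᵐᵒᵖ X] : Module (MonoidAlgebra k T)ᵐᵒᵖ (ResOp k T X) :=
  Module.compHom X (RingHom.op (MonoidAlgebra.mapDomainRingHom k T.subtype))

theorem ResOp.op_single_smul (T : Subgroup G) (X : Type u) [AddCommGroup X]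
    [Module (MonoidAlgebra k G)ᵐᵒᵖ X] (t : T) (c : k) (x : X) :
    MulOpposite.op (MonoidAlgebra.single t c : MonoidAlgebra k T) • (show ResOp k T X from x) =
      MulOpposite.op (MonoidAlgebra.single (t : G) c : MonoidAlgebra k G) • x := by
  change MulOpposite.op (MonoidAlgebra.mapDomainRingHom k T.subtype (MonoidAlgebra.single t c)) • x
    = _
  simp

/-- The automorphism `t ↦ χ(t) t` of a group ring, for a sign character `χ`. -/
noncomputable def signTwist (k : Type u) [CommRing k] {T : Type u} [Group T] (χ : T →* ℤˣ) :
    MonoidAlgebra k T →+* MonoidAlgebra k T :=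
  (MonoidAlgebra.lift k (MonoidAlgebra k T) T
    { toFun t := MonoidAlgebra.single t (((χ t : ℤˣ) : ℤ) : k)
      map_one' := by simp [MonoidAlgebra.one_def]
      map_mul' s t := by simp [MonoidAlgebra.single_mul_single] }).toRingHom

theorem signTwist_single {T : Type u} [Group T] (χ : T →* ℤˣ) (t : T) (c : k) :
    signTwist k χ (MonoidAlgebra.single t c) = ((χ t : ℤˣ) : ℤ) • MonoidAlgebra.single t c := by
  simp [signTwist, MonoidAlgebra.lift_single, mul_comm]

theorem signTwist_comp_self {T : Type u} [Group T] (χ : T →* ℤˣ) :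
    (signTwist k χ).comp (signTwist k χ) = RingHom.id _ := by
  refine RingHom.ext fun a => ?_
  induction a using MonoidAlgebra.induction_linear with
  | zero => simp
  | add x y hx hy => rw [map_add, hx, hy, map_add]
  | single t c =>
    rw [RingHom.comp_apply, signTwist_single, map_zsmul, signTwist_single, smul_smul,
      Int.units_coe_mul_self, one_smul, RingHom.id_apply]

/-- The twist of a module by a sign character. -/
def Twist (_k : Type u) {T : Type u} [Group T] (_χ : T →* ℤˣ) (M : Type u) : Type u := M

instance {T : Type u} [Group T] (χ : T →* ℤˣ) (M : Type u) [AddCommGroup M] :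
    AddCommGroup (Twist k χ M) :=
  inferInstanceAs (AddCommGroup M)

noncomputable instance {T : Type u} [Group T] (χ : T →* ℤˣ) (M : Type u) [AddCommGroup M]
    [Module (MonoidAlgebra k T) M] : Module (MonoidAlgebra k T) (Twist k χ M) :=
  Module.compHom M (signTwist k χ)

theorem IsFlat.twist {T : Type u} [Group T] (χ : T →* ℤˣ) {M : Type u} [AddCommGroup M]
    [Module (MonoidAlgebra k T) M] (h : IsFlat (MonoidAlgebra k T) M) :
    IsFlat (MonoidAlgebra k T) (Twist k χ M) :=
  h.of_semilinearEquiv (RingEquiv.ofRingHom (signTwist k χ) (signTwist k χ)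
    (signTwist_comp_self χ) (signTwist_comp_self χ)) (AddEquiv.refl M) fun _ _ => rfl

/-- Extension of `T`-semi-invariant pairings with a module which is flat over the subgroup `T`. -/
theorem IsFlat.exists_extension {T : Subgroup G} (χ : T →* ℤˣ) {M X Y : Type u} [AddCommGroup M]
    [AddCommGroup X] [AddCommGroup Y] [Module (MonoidAlgebra k G) M]
    [Module (MonoidAlgebra k G)ᵐᵒᵖ X] [Module (MonoidAlgebra k G)ᵐᵒᵖ Y]
    (h : IsFlat (MonoidAlgebra k T) (Res k T M)) (f : X →ₗ[(MonoidAlgebra k G)ᵐᵒᵖ] Y)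
    (hf : Function.Injective f) (φ : X →+ M →+ AddCircle (1 : ℚ))
    (hφ : ∀ (t : T) (c : k) x m,
      φ (MulOpposite.op (MonoidAlgebra.single (t : G) c : MonoidAlgebra k G) • x) m =
        φ x (((χ t : ℤˣ) : ℤ) • (MonoidAlgebra.single (t : G) c : MonoidAlgebra k G) • m)) :
    ∃ φ' : Y →+ M →+ AddCircle (1 : ℚ), (∀ x, φ' (f x) = φ x) ∧ ∀ (t : T) (c : k) y m,
      φ' (MulOpposite.op (MonoidAlgebra.single (t : G) c : MonoidAlgebra k G) • y) m =
        φ' y (((χ t : ℤˣ) : ℤ) • (MonoidAlgebra.single (t : G) c : MonoidAlgebra k G) • m) := by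
  have hsm : ∀ (t : T) (c : k) (m : M),
      (MonoidAlgebra.single t c : MonoidAlgebra k T) • (show Twist k χ (Res k T M) from m) =
        ((χ t : ℤˣ) : ℤ) • (MonoidAlgebra.single (t : G) c : MonoidAlgebra k G) • m := by
    intro t c m
    change MonoidAlgebra.mapDomainRingHom k T.subtype (signTwist k χ (MonoidAlgebra.single t c)) • m
      = _
    rw [signTwist_single, map_zsmul, smul_assoc]
    simp
  let fT : ResOp k T X →ₗ[(MonoidAlgebra k T)ᵐᵒᵖ] ResOp k T Y :=
    linearMapOfOpSingle (f.toAddMonoidHom : X →+ Y) (by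
      intro t c x
      exact (congrArg f (ResOp.op_single_smul T X t c x)).trans ((map_smul f _ _).trans
        (ResOp.op_single_smul T Y t c (f (show X from x))).symm))
  -- A semi-invariant pairing is the same as a `kT`-linear map into the dual of the twisted module;
  -- the extension exists because that dual is injective.
  let φT : ResOp k T X →ₗ[(MonoidAlgebra k T)ᵐᵒᵖ]
      CharDual (MonoidAlgebra k T) (Twist k χ (Res k T M)) :=
    linearMapOfOpSingle (φ : X →+ M →+ AddCircle (1 : ℚ)) (by
      intro t c x
      refine (congrArg φ (ResOp.op_single_smul T X t c x)).trans ?_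
      refine DFunLike.ext (F := M →+ AddCircle (1 : ℚ)) _ _ fun m => ?_
      exact (hφ t c x m).trans (congrArg (φ x) (hsm t c m).symm))
  obtain ⟨ψ, hψ⟩ := (isFlat_iff_injective_charDual.1 (h.twist χ)).out fT hf φT
  refine ⟨ψ.toAddMonoidHom, hψ, fun t c y m => ?_⟩
  have h1 := map_smul ψ (MulOpposite.op (MonoidAlgebra.single t c)) (show ResOp k T Y from y)
  have h2 := congrArg ψ (ResOp.op_single_smul T Y t c y)
  exact (DFunLike.congr_fun (h2.symm.trans h1) m).trans (congrArg (ψ y) (hsm t c m))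

/-- A module `W = ⨁ M`, indexed by a `G`-set `J` and permuted by `G` up to signs, is flat if `M` is
flat over the stabilizers of the elements of `J`. -/
theorem isFlat_of_monomial {J : Type u} [MulAction G J] {M W : Type u} [AddCommGroup M]
    [AddCommGroup W] [Module (MonoidAlgebra k G) M] [Module (MonoidAlgebra k G) W]
    (Θ : (J →₀ M) ≃+ W) (ε : G → J → ℤˣ) (hε : ∀ (g g' : G) (j : J), ε (g * g') j = ε g (g' • j) * ε g' j)
    (hΘ : ∀ (g : G) (c : k) (j : J) (m : M),
      (MonoidAlgebra.single g c : MonoidAlgebra k G) • Θ (Finsupp.single j m) =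
        Θ (Finsupp.single (g • j) (((ε g j : ℤˣ) : ℤ) •
          (MonoidAlgebra.single g c : MonoidAlgebra k G) • m)))
    (hM : ∀ j : J, IsFlat (MonoidAlgebra k (MulAction.stabilizer G j))
      (Res k (MulAction.stabilizer G j) M)) : IsFlat (MonoidAlgebra k G) W := by
  rw [isFlat_iff_injective_charDual]
  refine ⟨fun X Y _ _ _ _ f hf φ => ?_⟩
  have hε1 : ∀ j, ε 1 j = 1 := fun j => by
    have := hε 1 1 j
    rw [one_mul, one_smul] at this
    exact left_eq_mul.1 this
  let χ : ∀ j, MulAction.stabilizer G j →* ℤˣ := fun j =>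
    { toFun t := ε t j
      map_one' := hε1 j
      map_mul' s t := by
        have : (t : G) • j = j := t.2
        rw [Subgroup.coe_mul, hε, this] }
  -- A map into the dual of `W` is a family of pairings between `X` and `M`, one for each `j`, and
  -- is determined by those at orbit representatives. The pairing at `j` is semi-invariant under the
  -- stabilizer of `j`, with character `χ j`.
  let φ₀ : J → X →+ M →+ AddCircle (1 : ℚ) := fun j => AddMonoidHom.mk' (fun x =>
    ((φ x : W →+ AddCircle (1 : ℚ)).comp Θ.toAddMonoidHom).comp (Finsupp.singleAddHom j))
    (fun x y => by
      ext m
      exact DFunLike.congr_fun (map_add φ x y) (Θ (Finsupp.single j m)))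
  have hφ₀ : ∀ j x m, φ₀ j x m = φ x (Θ (Finsupp.single j m)) := fun j x m => rfl
  have hφ : ∀ (g : G) (c : k) x w, φ (MulOpposite.op (MonoidAlgebra.single g c) • x) w =
      φ x ((MonoidAlgebra.single g c : MonoidAlgebra k G) • w) := fun g c x w =>
    DFunLike.congr_fun (map_smul φ (MulOpposite.op (MonoidAlgebra.single g c)) x) w
  have hext : ∀ j, ∃ φ' : Y →+ M →+ AddCircle (1 : ℚ), (∀ x, φ' (f x) = φ₀ j x) ∧
      ∀ (t : MulAction.stabilizer G j) (c : k) y m,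
      φ' (MulOpposite.op (MonoidAlgebra.single (t : G) c : MonoidAlgebra k G) • y) m =
        φ' y (((ε t j : ℤˣ) : ℤ) • (MonoidAlgebra.single (t : G) c : MonoidAlgebra k G) • m) := by
    intro j
    refine (hM j).exists_extension (χ j) f hf (φ₀ j) fun t c x m => ?_
    have : (t : G) • j = j := t.2
    rw [hφ₀, hφ₀, hφ, hΘ, this]
    rfl
  choose φ' hφ'1 hφ'2 using hext
  let o : J → J := fun j => (Quotient.mk (MulAction.orbitRel G J) j).out
  have ho : ∀ j, ∃ g : G, g • o j = j := fun j =>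
    (MulAction.orbitRel_apply.1 (Quotient.exact
      (Quotient.out_eq (Quotient.mk (MulAction.orbitRel G J) j)).symm))
  have ho' : ∀ (g : G) j, o (g • j) = o j := fun g j =>
    congrArg Quotient.out (Quotient.sound (MulAction.orbitRel_apply.2 ⟨g, rfl⟩))
  choose γ hγ using ho
  have hγ' : ∀ j, (γ j)⁻¹ • j = o j := fun j => by
    rw [inv_smul_eq_iff, hγ]
  -- The pairing at `j` is the extended pairing at the representative `o j`, transported by `γ j`
  -- and corrected by the sign with which `(γ j)⁻¹` acts.
  let B : Y →+ (J →₀ M) →+ AddCircle (1 : ℚ) := AddMonoidHom.mk' (fun y =>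
    Finsupp.liftAddHom fun j =>
      (φ' (o j) (MulOpposite.op (MonoidAlgebra.single (γ j) (1 : k)) • y)).comp
        (((ε (γ j)⁻¹ j : ℤˣ) : ℤ) • smulHom M (MonoidAlgebra.single (γ j)⁻¹ (1 : k)))) (by
      intro y y'
      refine Finsupp.addHom_ext fun j m => ?_
      simp)
  have hB : ∀ y j m, B y (Finsupp.single j m) =
      φ' (o j) (MulOpposite.op (MonoidAlgebra.single (γ j) (1 : k)) • y)
        (((ε (γ j)⁻¹ j : ℤˣ) : ℤ) •
          (MonoidAlgebra.single (γ j)⁻¹ 1 : MonoidAlgebra k G) • m) := by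
    intro y j m
    simp [B]
  have hBf : ∀ x j m, B (f x) (Finsupp.single j m) = φ x (Θ (Finsupp.single j m)) := by
    intro x j m
    rw [hB, ← map_smul, hφ'1, hφ₀, ← hγ' j, ← hΘ, hφ, smul_smul, MonoidAlgebra.single_mul_single]
    simp [← MonoidAlgebra.one_def]
  have hBg : ∀ (g : G) (c : k) y j m,
      B (MulOpposite.op (MonoidAlgebra.single g c : MonoidAlgebra k G) • y) (Finsupp.single j m) =
      B y (Finsupp.single (g • j) (((ε g j : ℤˣ) : ℤ) •
          (MonoidAlgebra.single g c : MonoidAlgebra k G) • m)) := by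
    intro g c y j m
    -- Both `γ (g • j)` and `g * γ j` carry the representative to `g • j`. They differ by an element
    -- of its stabilizer, which semi-invariance absorbs.
    have ht : ((γ (g • j))⁻¹ * (g * γ j)) • o j = o j := by
      rw [mul_smul, mul_smul, hγ, hγ', ho']
    have h1 := hφ'2 (o j) ⟨_, ht⟩ c
      (MulOpposite.op (MonoidAlgebra.single (γ (g • j)) (1 : k)) • y)
      (((ε (γ j)⁻¹ j : ℤˣ) : ℤ) • (MonoidAlgebra.single (γ j)⁻¹ 1 : MonoidAlgebra k G) • m)
    have h2 : ε ((γ (g • j))⁻¹ * (g * γ j)) (o j) * ε (γ j)⁻¹ j =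
        ε (γ (g • j))⁻¹ (g • j) * ε g j := by
      rw [← hγ' j, ← hε, ← hε]
      congr 1
      group
    rw [hB, hB, ho', op_single_smul_op_single_smul]
    rw [op_single_smul_op_single_smul] at h1
    simp only [mul_inv_cancel_left, one_mul, mul_one] at h1 ⊢
    rw [h1]
    congr 1
    rw [smul_comm _ (((ε (γ j)⁻¹ j : ℤˣ) : ℤ)), smul_comm _ (((ε g j : ℤˣ) : ℤ)),
      smul_smul, smul_smul, smul_smul, smul_smul, MonoidAlgebra.single_mul_single,
      MonoidAlgebra.single_mul_single, ← Units.val_mul, ← Units.val_mul, h2]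
    simp [mul_assoc]
  have hBf' : ∀ x v, B (f x) v = φ x (Θ v) := fun x v => by
    have : B (f x) = (φ x : W →+ AddCircle (1 : ℚ)).comp Θ.toAddMonoidHom :=
      Finsupp.addHom_ext fun j m => hBf x j m
    exact DFunLike.congr_fun this v
  have hBg' : ∀ (g : G) (c : k) y v,
      B (MulOpposite.op (MonoidAlgebra.single g c : MonoidAlgebra k G) • y) v =
      B y (Θ.symm ((MonoidAlgebra.single g c : MonoidAlgebra k G) • Θ v)) := by
    intro g c y v
    have : B (MulOpposite.op (MonoidAlgebra.single g c : MonoidAlgebra k G) • y) =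
        (B y).comp (Θ.symm.toAddMonoidHom.comp
          ((smulHom W (MonoidAlgebra.single g c)).comp Θ.toAddMonoidHom)) := by
      refine Finsupp.addHom_ext fun j m => ?_
      rw [hBg]
      simp [hΘ]
    exact DFunLike.congr_fun this v
  refine ⟨linearMapOfOpSingle (AddMonoidHom.mk'
    (fun y => CharDual.mk _ W ((B y).comp Θ.symm.toAddMonoidHom))
    (fun y y' => by ext w; simp)) ?_, fun x => ?_⟩
  · intro g c y
    ext w
    have := hBg' g c y (Θ.symm w)
    rw [Θ.apply_symm_apply] at this
    exact this
  · ext w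
    have := hBf' x (Θ.symm w)
    rw [Θ.apply_symm_apply] at this
    exact this

end Monomial

end MooreFlat

namespace MooreFlat

/-! ### Cubical chains, subdivision and its homotopy -/

section Cubes

/-- The unit interval. -/
abbrev 𝕀 : Type := unitInterval

/-- The singular `n`-cubes of a set `X`, not necessarily continuous, in curried form. -/
def Cube : ℕ → Type u → Type u
  | 0, X => X
  | n + 1, X => Cube n (𝕀 → X)

namespace Cube

/-- A point, as a cube of dimension `0`. -/
def point {X : Type u} (x : X) : Cube 0 X := x

/-- The image of a cube under a map. -/
def map : ∀ (n : ℕ) {X Y : Type u}, (X → Y) → Cube n X → Cube n Y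
  | 0, _, _, f => f
  | n + 1, _, _, f => map n (fun γ t => f (γ t))

theorem map_map (n : ℕ) : ∀ {X Y Z : Type u} (g : Y → Z) (f : X → Y) (s : Cube n X),
    map n g (map n f s) = map n (fun x => g (f x)) s := by
  induction n with
  | zero => intros; rfl
  | succ n ih => intro X Y Z g f s; exact ih _ _ _

theorem map_id (n : ℕ) : ∀ {X : Type u} (s : Cube n X), map n (fun x => x) s = s := by
  induction n with
  | zero => intros; rfl
  | succ n ih => intro X s; exact ih _

/-- Degenerate cubes: those which do not depend on one of the coordinates. -/
def IsDeg : ∀ (n : ℕ) {X : Type u}, Cube n X → Prop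
  | 0, _, _ => False
  | n + 1, X, s => IsDeg n (X := 𝕀 → X) s ∨ ∃ τ : Cube n X, s = map n (fun x _ => x) τ

theorem IsDeg.map (n : ℕ) : ∀ {X Y : Type u} (f : X → Y) {s : Cube n X}, IsDeg n s →
    IsDeg n (map n f s) := by
  induction n with
  | zero => exact fun _ _ h => h
  | succ n ih =>
    rintro X Y f s (h | ⟨τ, rfl⟩)
    · exact Or.inl (ih _ h)
    · refine Or.inr ⟨Cube.map n f τ, ?_⟩
      exact (map_map n (fun (γ : 𝕀 → X) t => f (γ t)) (fun x _ => x) τ).trans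
        (map_map n (fun y (_ : 𝕀) => y) f τ).symm

theorem isDeg_succ_of_const (n : ℕ) {X : Type u} (τ : Cube n X) :
    IsDeg (n + 1) (X := X) (map n (fun x (_ : 𝕀) => x) τ) := Or.inr ⟨τ, rfl⟩

/-- A cube in uncurried form. -/
def toFun : ∀ (n : ℕ) {X : Type u}, Cube n X → (Fin n → 𝕀) → X
  | 0, _, s => fun _ => s
  | n + 1, X, s => fun y => toFun n (X := 𝕀 → X) s (Fin.tail y) (y 0)

theorem toFun_map (n : ℕ) : ∀ {X Y : Type u} (f : X → Y) (s : Cube n X) (y : Fin n → 𝕀),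
    toFun n (map n f s) y = f (toFun n s y) := by
  induction n with
  | zero => intros; rfl
  | succ n ih =>
    intro X Y f s y
    exact congrFun (ih (fun γ t => f (γ t)) s (Fin.tail y)) (y 0)

end Cube

/-- Cubical chains with coefficients in `M`. -/
abbrev CubeChain (n : ℕ) (X : Type u) (M : Type v) [AddCommGroup M] : Type max u v := Cube n X →₀ M

namespace CubeChain

variable {M : Type v} {N : Type w} [AddCommGroup M] [AddCommGroup N]

/-- Functoriality of cubical chains. -/
noncomputable def push (n : ℕ) {X Y : Type u} (f : X → Y) (α : M →+ N) :
    CubeChain n X M →+ CubeChain n Y N :=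
  finsuppPush (Cube.map n f) α

@[simp] theorem push_single (n : ℕ) {X Y : Type u} (f : X → Y) (α : M →+ N) (s : Cube n X) (m : M) :
    push n f α (Finsupp.single s m) = Finsupp.single (Cube.map n f s) (α m) :=
  finsuppPush_single _ _ _ _

/-- Functoriality of cubical chains for fixed coefficients. -/
noncomputable abbrev push₁ (n : ℕ) {X Y : Type u} (f : X → Y) :
    CubeChain n X M →+ CubeChain n Y M := push n f (AddMonoidHom.id M)

theorem push_push (n : ℕ) {P : Type*} [AddCommGroup P] {X Y Z : Type u} (g : Y → Z) (β : N →+ P)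
    (f : X → Y) (α : M →+ N) (c : CubeChain n X M) :
    push n g β (push n f α c) = push n (fun x => g (f x)) (β.comp α) c := by
  have : (push n g β).comp (push n f α) = push n (fun x => g (f x)) (β.comp α) := by
    refine Finsupp.addHom_ext fun s m => ?_
    simp [Cube.map_map]
  exact DFunLike.congr_fun this c

theorem push_id (n : ℕ) {X : Type u} (c : CubeChain n X M) :
    push₁ n (fun x : X => x) c = c := by
  have : push₁ (M := M) n (fun x : X => x) = AddMonoidHom.id _ := by
    refine Finsupp.addHom_ext fun s m => ?_
    simp [Cube.map_id]
  exact DFunLike.congr_fun this c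

/-- The end point maps on paths. -/
abbrev ev (t : 𝕀) {X : Type u} (γ : 𝕀 → X) : X := γ t

/-- The constant path. -/
abbrev cst {X : Type u} (x : X) : 𝕀 → X := fun _ => x

/-- Currying, which identifies the cubes of `X` with the cubes of the space of paths. -/
noncomputable def cu {n : ℕ} {X : Type u} : CubeChain (n + 1) X M ≃+ CubeChain n (𝕀 → X) M :=
  AddEquiv.refl _

theorem cu_push (n : ℕ) {X Y : Type u} (f : X → Y) (α : M →+ N) (c : CubeChain (n + 1) X M) :
    cu (push (n + 1) f α c) = push n (fun γ t => f (γ t)) α (cu c) := rfl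

theorem cu_symm_push (n : ℕ) {X Y : Type u} (f : X → Y) (α : M →+ N) (c : CubeChain n (𝕀 → X) M) :
    cu.symm (push n (fun γ t => f (γ t)) α c) = push (n + 1) f α (cu.symm c) := rfl

theorem cu_single (n : ℕ) {X : Type u} (s : Cube (n + 1) X) (m : M) :
    cu (Finsupp.single s m) = Finsupp.single (show Cube n (𝕀 → X) from s) m := rfl

/-- The difference of the two end point maps. -/
noncomputable def ends (n : ℕ) {X : Type u} : CubeChain n (𝕀 → X) M →+ CubeChain n X M :=
  push₁ n (ev 1) - push₁ n (ev 0)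

theorem ends_apply (n : ℕ) {X : Type u} (c : CubeChain n (𝕀 → X) M) :
    ends n c = push₁ n (ev 1) c - push₁ n (ev 0) c := rfl

theorem ends_push (n : ℕ) {X Y : Type u} (f : X → Y) (α : M →+ N) (c : CubeChain n (𝕀 → X) M) :
    ends n (push n (fun γ t => f (γ t)) α c) = push n f α (ends n c) := by
  simp only [ends_apply, map_sub, push_push]
  rfl

theorem ends_cst (n : ℕ) {X : Type u} (c : CubeChain n X M) : ends n (push₁ n cst c) = 0 := by
  simp only [ends_apply, push_push]
  exact sub_self _

variable (M) in
/-- The boundary operator. -/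
noncomputable def d : ∀ (n : ℕ) (X : Type u), CubeChain (n + 1) X M →+ CubeChain n X M
  | 0, _ => (ends 0).comp cu.toAddMonoidHom
  | n + 1, _ => (ends (n + 1)).comp cu.toAddMonoidHom -
      cu.symm.toAddMonoidHom.comp ((d n _).comp cu.toAddMonoidHom)

theorem d_zero_apply (X : Type u) (c : CubeChain 1 X M) : d M 0 X c = ends 0 (cu c) := rfl

/-- The Leibniz rule for an interval times a cube: the path coordinate contributes its two end
points, and the remaining coordinates contribute their boundary with the opposite sign. -/
theorem d_succ_apply (n : ℕ) (X : Type u) (c : CubeChain (n + 2) X M) :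
    d M (n + 1) X c = ends (n + 1) (cu c) - cu.symm (d M n (𝕀 → X) (cu c)) := rfl

theorem d_push (n : ℕ) : ∀ {X Y : Type u} (f : X → Y) (α : M →+ N) (c : CubeChain (n + 1) X M),
    d N n Y (push (n + 1) f α c) = push n f α (d M n X c) := by
  induction n with
  | zero =>
    intro X Y f α c
    rw [d_zero_apply, d_zero_apply, cu_push, ends_push]
  | succ n ih =>
    intro X Y f α c
    rw [d_succ_apply, d_succ_apply, map_sub, cu_push, ends_push, ih, cu_symm_push]

theorem d_ends (n : ℕ) {X : Type u} (c : CubeChain (n + 1) (𝕀 → X) M) :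
    d M n X (ends (n + 1) c) = ends n (d M n (𝕀 → X) c) := by
  rw [ends_apply, ends_apply, map_sub, d_push, d_push]

/-- By naturality the boundary commutes with the end point maps. The two mixed terms therefore
cancel, and what remains is `d ∘ d` on the path space. -/
theorem d_d (n : ℕ) : ∀ {X : Type u} (c : CubeChain (n + 2) X M), d M n X (d M (n + 1) X c) = 0 := by
  induction n with
  | zero =>
    intro X c
    rw [d_succ_apply, map_sub, d_ends, d_zero_apply X, AddEquiv.apply_symm_apply, sub_self]
  | succ n ih =>
    intro X c
    rw [d_succ_apply (n + 1) X c, map_sub, d_ends, d_succ_apply n X (cu.symm _),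
      AddEquiv.apply_symm_apply, ih, map_zero, sub_zero, sub_self]

/-- The first half of the interval. -/
noncomputable def lo (t : 𝕀) : 𝕀 := ⟨t / 2, by constructor <;> linarith [t.2.1, t.2.2]⟩

/-- The second half of the interval. -/
noncomputable def hi (t : 𝕀) : 𝕀 := ⟨(t + 1) / 2, by constructor <;> linarith [t.2.1, t.2.2]⟩

/-- The parametrization of the interval by a square used to compare a path with its halves. -/
noncomputable def sq (a b : 𝕀) : 𝕀 := ⟨a + b * (1 - a) / 2, by
  have ha := a.2
  have hb := b.2
  constructor
  · have := mul_nonneg hb.1 (sub_nonneg.2 ha.2)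
    linarith [ha.1]
  · have := mul_le_mul_of_nonneg_right hb.2 (sub_nonneg.2 ha.2)
    linarith [ha.2]⟩

/-- The four sides of the square are the path, its second half, its first half and a constant. Up to
a degenerate edge its boundary thus compares a path with the sum of its halves. -/
theorem sq_zero_right (a : 𝕀) : sq a 0 = a := by ext; simp [sq]

theorem sq_one_right (a : 𝕀) : sq a 1 = hi a := by ext; simp [sq, hi]; ring

theorem sq_zero_left (b : 𝕀) : sq 0 b = lo b := by ext; simp [sq, lo]

theorem sq_one_left (b : 𝕀) : sq 1 b = 1 := by ext; simp [sq]

/-- Subdivision of the first coordinate. -/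
noncomputable def halve (n : ℕ) {X : Type u} : CubeChain n (𝕀 → X) M →+ CubeChain n (𝕀 → X) M :=
  push₁ n (fun γ t => γ (lo t)) + push₁ n (fun γ t => γ (hi t))

theorem halve_apply (n : ℕ) {X : Type u} (c : CubeChain n (𝕀 → X) M) :
    halve n c = push₁ n (fun γ t => γ (lo t)) c + push₁ n (fun γ t => γ (hi t)) c := rfl

theorem halve_push (n : ℕ) {X Y : Type u} (f : X → Y) (α : M →+ N) (c : CubeChain n (𝕀 → X) M) :
    halve n (push n (fun γ t => f (γ t)) α c) = push n (fun γ t => f (γ t)) α (halve n c) := by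
  simp only [halve_apply, map_add, push_push]
  rfl

theorem d_halve (n : ℕ) {X : Type u} (c : CubeChain (n + 1) (𝕀 → X) M) :
    d M n (𝕀 → X) (halve (n + 1) c) = halve n (d M n (𝕀 → X) c) := by
  rw [halve_apply, halve_apply, map_add, d_push, d_push]

/-- The two halves meet at the midpoint, where their end point terms cancel. -/
theorem ends_halve (n : ℕ) {X : Type u} (c : CubeChain n (𝕀 → X) M) :
    ends n (halve n c) = ends n c := by
  simp only [ends_apply, halve_apply, map_add, push_push]
  have h1 : (fun γ : 𝕀 → X => ev 1 fun t => γ (lo t)) = fun γ => ev 0 fun t => γ (hi t) := by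
    funext γ
    exact congrArg γ (by ext; simp [lo, hi])
  have h2 : (fun γ : 𝕀 → X => ev 1 fun t => γ (hi t)) = ev 1 := by
    funext γ
    exact congrArg γ (by ext; simp [hi])
  have h3 : (fun γ : 𝕀 → X => ev 0 fun t => γ (lo t)) = ev 0 := by
    funext γ
    exact congrArg γ (by ext; simp [lo])
  rw [h1, h2, h3, AddMonoidHom.comp_id]
  abel

variable (M) in
/-- Subdivision of cubes. -/
noncomputable def sd : ∀ (n : ℕ) (X : Type u), CubeChain n X M →+ CubeChain n X M
  | 0, _ => AddMonoidHom.id _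
  | n + 1, X => cu.symm.toAddMonoidHom.comp
      ((halve n).comp ((sd n (𝕀 → X)).comp cu.toAddMonoidHom))

theorem sd_zero_apply {X : Type u} (c : CubeChain 0 X M) : sd M 0 X c = c := rfl

theorem sd_succ_apply (n : ℕ) {X : Type u} (c : CubeChain (n + 1) X M) :
    sd M (n + 1) X c = cu.symm (halve n (sd M n (𝕀 → X) (cu c))) := rfl

theorem sd_push (n : ℕ) : ∀ {X Y : Type u} (f : X → Y) (α : M →+ N) (c : CubeChain n X M),
    sd N n Y (push n f α c) = push n f α (sd M n X c) := by
  induction n with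
  | zero => intros; rfl
  | succ n ih =>
    intro X Y f α c
    rw [sd_succ_apply, sd_succ_apply, cu_push, ih, halve_push, cu_symm_push]

theorem sd_ends (n : ℕ) {X : Type u} (c : CubeChain n (𝕀 → X) M) :
    sd M n X (ends n c) = ends n (sd M n (𝕀 → X) c) := by
  rw [ends_apply, ends_apply, map_sub, sd_push, sd_push]

theorem d_sd (n : ℕ) : ∀ {X : Type u} (c : CubeChain (n + 1) X M),
    d M n X (sd M (n + 1) X c) = sd M n X (d M n X c) := by
  induction n with
  | zero =>
    intro X c
    rw [d_zero_apply, sd_succ_apply, AddEquiv.apply_symm_apply, ends_halve]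
    rfl
  | succ n ih =>
    intro X c
    rw [sd_succ_apply (n + 1) c, d_succ_apply n X (cu.symm _), AddEquiv.apply_symm_apply,
      ends_halve, d_halve, ih, d_succ_apply n X c, map_sub, sd_ends,
      sd_succ_apply n (cu.symm _), AddEquiv.apply_symm_apply]

/-- The homotopy between a path and its two halves. -/
noncomputable abbrev fill {X : Type u} (γ : 𝕀 → X) : 𝕀 → 𝕀 → X := fun a b => γ (sq a b)

theorem fill_push (n : ℕ) {X Y : Type u} (f : X → Y) (α : M →+ N) (c : CubeChain n (𝕀 → X) M) :
    push₁ n fill (push n (fun γ t => f (γ t)) α c) =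
      push n (fun γ a b => f (γ a b)) α (push₁ n fill c) := by
  simp only [push_push]
  rfl

variable (M) in
/-- The chain homotopy between subdivision and the identity (modulo degenerate cubes). -/
noncomputable def sdHomotopy : ∀ (n : ℕ) (X : Type u), CubeChain n X M →+ CubeChain (n + 1) X M
  | 0, _ => 0
  | n + 1, X => cu.symm.toAddMonoidHom.comp
      (cu.symm.toAddMonoidHom.comp ((push₁ n fill).comp ((sd M n (𝕀 → X)).comp cu.toAddMonoidHom)) -
        ((sdHomotopy n (𝕀 → X)).comp cu.toAddMonoidHom))

theorem sdHomotopy_zero_apply {X : Type u} (c : CubeChain 0 X M) : sdHomotopy M 0 X c = 0 := rfl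

theorem sdHomotopy_succ_apply (n : ℕ) {X : Type u} (c : CubeChain (n + 1) X M) :
    sdHomotopy M (n + 1) X c = cu.symm (cu.symm (push₁ n fill (sd M n (𝕀 → X) (cu c))) -
      sdHomotopy M n (𝕀 → X) (cu c)) := rfl

theorem sdHomotopy_push (n : ℕ) : ∀ {X Y : Type u} (f : X → Y) (α : M →+ N) (c : CubeChain n X M),
    sdHomotopy N n Y (push n f α c) = push (n + 1) f α (sdHomotopy M n X c) := by
  induction n with
  | zero =>
    intro X Y f α c
    rw [sdHomotopy_zero_apply, sdHomotopy_zero_apply, map_zero]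
  | succ n ih =>
    intro X Y f α c
    rw [sdHomotopy_succ_apply, sdHomotopy_succ_apply, cu_push, ih, sd_push, fill_push,
      cu_symm_push n (fun (γ : 𝕀 → X) t => f (γ t)), ← map_sub, cu_symm_push]

theorem sdHomotopy_ends (n : ℕ) {X : Type u} (c : CubeChain n (𝕀 → X) M) :
    sdHomotopy M n X (ends n c) = ends (n + 1) (sdHomotopy M n (𝕀 → X) c) := by
  rw [ends_apply, ends_apply, map_sub, sdHomotopy_push, sdHomotopy_push]

/-- The boundary of the fill-in squares. -/
theorem ends_fill (n : ℕ) {X : Type u} (c : CubeChain n (𝕀 → X) M) :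
    ends (n + 1) (cu.symm (push₁ n fill c)) - cu.symm (ends n (push₁ n fill c)) =
      cu.symm (halve n c - c - push₁ n cst (push₁ n (ev 1) c)) := by
  have h1 : ends (n + 1) (cu.symm (push₁ n fill c)) =
      cu.symm (push₁ n (fun γ t => γ (hi t)) c - c) := by
    apply cu.injective
    rw [ends_apply, map_sub, cu_push, cu_push, AddEquiv.apply_symm_apply, AddEquiv.apply_symm_apply]
    simp only [push_push, ev, fill, sq_one_right, sq_zero_right, AddMonoidHom.comp_id]
    rw [push_id]
  have h2 : ends n (push₁ n fill c) =
      push₁ n cst (push₁ n (ev 1) c) - push₁ n (fun γ t => γ (lo t)) c := by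
    rw [ends_apply, push_push, push_push, push_push, AddMonoidHom.comp_id]
    have e1 : (fun γ : 𝕀 → X => ev 1 (fill γ)) = fun γ => cst (ev 1 γ) := by
      funext γ b
      exact congrArg γ (sq_one_left b)
    have e0 : (fun γ : 𝕀 → X => ev 0 (fill γ)) = fun γ t => γ (lo t) := by
      funext γ b
      exact congrArg γ (sq_zero_left b)
    rw [e1, e0]
  rw [h1, h2, ← map_sub, halve_apply]
  congr 1
  abel

end CubeChain
end Cubes
end MooreFlat

namespace MooreFlat

namespace CubeChain

/-! ### Degenerate cubes and prisms -/

section Degenerate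

variable {M : Type v} {N : Type w} [AddCommGroup M] [AddCommGroup N]

/-- Subdivision is homotopic to the identity modulo degenerate cubes: the base case. -/
theorem d_sdHomotopy_zero {X : Type u} (c : CubeChain 1 X M) :
    d M 1 X (sdHomotopy M 1 X c) - (sd M 1 X c - c) =
      - cu.symm (push₁ 0 cst (push₁ 0 (ev 1) (cu c))) := by
  rw [sdHomotopy_succ_apply, d_succ_apply, AddEquiv.apply_symm_apply, sdHomotopy_zero_apply,
    sub_zero, d_zero_apply, AddEquiv.apply_symm_apply, sd_zero_apply, ends_fill, sd_succ_apply,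
    sd_zero_apply]
  rw [map_sub, map_sub, AddEquiv.symm_apply_apply]
  abel

/-- Subdivision is homotopic to the identity modulo degenerate cubes: the inductive step. -/
theorem d_sdHomotopy_succ (n : ℕ) {X : Type u} (c : CubeChain (n + 2) X M) :
    d M (n + 2) X (sdHomotopy M (n + 2) X c) + sdHomotopy M (n + 1) X (d M (n + 1) X c) -
        (sd M (n + 2) X c - c) =
      cu.symm (d M (n + 1) (𝕀 → X) (sdHomotopy M (n + 1) (𝕀 → X) (cu c)) +
        sdHomotopy M n (𝕀 → X) (d M n (𝕀 → X) (cu c)) - (sd M (n + 1) (𝕀 → X) (cu c) - cu c)) -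
      cu.symm (push₁ (n + 1) cst (push₁ (n + 1) (ev 1) (sd M (n + 1) (𝕀 → X) (cu c)))) := by
  have hf := ends_fill (n + 1) (sd M (n + 1) (𝕀 → X) (cu c))
  have h1 : d M (n + 2) X (sdHomotopy M (n + 2) X c) =
      ends (n + 2) (cu.symm (push₁ (n + 1) fill (sd M (n + 1) (𝕀 → X) (cu c)))) -
        ends (n + 2) (sdHomotopy M (n + 1) (𝕀 → X) (cu c)) -
      cu.symm (ends (n + 1) (push₁ (n + 1) fill (sd M (n + 1) (𝕀 → X) (cu c))) -
        cu.symm (push₁ n fill (sd M n (𝕀 → X) (d M n (𝕀 → X) (cu c)))) -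
        d M (n + 1) (𝕀 → X) (sdHomotopy M (n + 1) (𝕀 → X) (cu c))) := by
    rw [sdHomotopy_succ_apply, d_succ_apply, AddEquiv.apply_symm_apply, map_sub, map_sub,
      d_succ_apply n, AddEquiv.apply_symm_apply, d_push, d_sd]
  have h2 : sdHomotopy M (n + 1) X (d M (n + 1) X c) =
      ends (n + 2) (sdHomotopy M (n + 1) (𝕀 → X) (cu c)) -
      cu.symm (cu.symm (push₁ n fill (sd M n (𝕀 → X) (d M n (𝕀 → X) (cu c)))) -
        sdHomotopy M n (𝕀 → X) (d M n (𝕀 → X) (cu c))) := by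
    rw [d_succ_apply, map_sub, sdHomotopy_ends, sdHomotopy_succ_apply n (cu.symm _),
      AddEquiv.apply_symm_apply]
  have h4 := sd_succ_apply (n + 1) c
  have hf' : ends (n + 2) (cu.symm (push₁ (n + 1) fill (sd M (n + 1) (𝕀 → X) (cu c)))) =
    cu.symm (ends (n + 1) (push₁ (n + 1) fill (sd M (n + 1) (𝕀 → X) (cu c)))) + _ :=
    sub_eq_iff_eq_add'.1 hf
  rw [h1, h2, h4, hf']
  simp only [map_sub, map_add, AddEquiv.symm_apply_apply]
  abel

variable (M) in
/-- The subgroup of degenerate chains. -/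
noncomputable def Deg (n : ℕ) (X : Type u) : AddSubgroup (CubeChain n X M) :=
  AddSubgroup.closure {c | ∃ (s : Cube n X) (m : M), s.IsDeg n ∧ c = Finsupp.single s m}

theorem single_mem_deg {n : ℕ} {X : Type u} {s : Cube n X} (hs : s.IsDeg n) (m : M) :
    Finsupp.single s m ∈ Deg M n X := AddSubgroup.subset_closure ⟨s, m, hs, rfl⟩

theorem deg_zero (X : Type u) : Deg M 0 X = ⊥ := by
  rw [Deg, AddSubgroup.closure_eq_bot_iff]
  rintro c ⟨s, m, hs, -⟩
  exact hs.elim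

/-- Membership is decided cube by cube; this is what lets a projection onto some of the cubes
descend to the quotient by degenerate chains. -/
theorem mem_deg_iff {n : ℕ} {X : Type u} {c : CubeChain n X M} :
    c ∈ Deg M n X ↔ ∀ s, c s ≠ 0 → s.IsDeg n := by
  constructor
  · intro hc s
    contrapose!
    intro hs
    induction hc using AddSubgroup.closure_induction with
    | mem x hx =>
      obtain ⟨s', m, hs', rfl⟩ := hx
      exact Finsupp.single_eq_of_ne (by rintro rfl; exact hs hs')
    | zero => rfl
    | add x y _ _ hx hy => rw [Finsupp.add_apply, hx, hy, add_zero]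
    | neg x _ hx => rw [Finsupp.neg_apply, hx, neg_zero]
  · intro h
    rw [← Finsupp.sum_single c]
    exact AddSubgroup.sum_mem _ fun s hs => single_mem_deg (h s (Finsupp.mem_support_iff.1 hs)) _

theorem cu_symm_mem_deg {n : ℕ} {X : Type u} {c : CubeChain n (𝕀 → X) M}
    (hc : c ∈ Deg M n (𝕀 → X)) : cu.symm c ∈ Deg M (n + 1) X :=
  mem_deg_iff.2 fun s hs => Or.inl (mem_deg_iff.1 hc s hs)

theorem push_mem_deg {n : ℕ} {X Y : Type u} (f : X → Y) (α : M →+ N) {c : CubeChain n X M}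
    (hc : c ∈ Deg M n X) : push n f α c ∈ Deg N n Y := by
  refine (AddSubgroup.closure_le ((Deg N n Y).comap (push n f α))).2 ?_ hc
  rintro _ ⟨s, m, hs, rfl⟩
  rw [SetLike.mem_coe, AddSubgroup.mem_comap, push_single]
  exact single_mem_deg (hs.map n f) _

theorem cu_symm_push_cst_mem_deg {n : ℕ} {X : Type u} (c : CubeChain n X M) :
    cu.symm (push₁ n cst c) ∈ Deg M (n + 1) X := by
  induction c using Finsupp.induction_linear with
  | zero => rw [map_zero, map_zero]; exact zero_mem _
  | add c c' hc hc' => rw [map_add, map_add]; exact add_mem hc hc'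
  | single s m =>
    rw [push_single]
    exact single_mem_deg (Cube.isDeg_succ_of_const n s) m

/-- A degenerate cube is degenerate as a cube of paths or constant along the path coordinate. Every
operator is shown to preserve degenerate chains by treating these two kinds of generators. -/
theorem deg_succ_le {n : ℕ} {X : Type u} {K : AddSubgroup (CubeChain (n + 1) X M)}
    (h1 : ∀ c ∈ Deg M n (𝕀 → X), cu.symm c ∈ K) (h2 : ∀ c, cu.symm (push₁ n cst c) ∈ K) :
    Deg M (n + 1) X ≤ K := by
  refine (AddSubgroup.closure_le _).2 ?_
  rintro _ ⟨s, m, hs | ⟨τ, rfl⟩, rfl⟩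
  · exact h1 _ (single_mem_deg hs m)
  · have := h2 (Finsupp.single τ m)
    rwa [push_single] at this

theorem ends_mem_deg {n : ℕ} {X : Type u} {c : CubeChain n (𝕀 → X) M}
    (hc : c ∈ Deg M n (𝕀 → X)) : ends n c ∈ Deg M n X := by
  rw [ends_apply]
  exact sub_mem (push_mem_deg _ _ hc) (push_mem_deg _ _ hc)

theorem halve_mem_deg {n : ℕ} {X : Type u} {c : CubeChain n (𝕀 → X) M}
    (hc : c ∈ Deg M n (𝕀 → X)) : halve n c ∈ Deg M n (𝕀 → X) := by
  rw [halve_apply]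
  exact add_mem (push_mem_deg _ _ hc) (push_mem_deg _ _ hc)

theorem halve_cst (n : ℕ) {X : Type u} (c : CubeChain n X M) :
    halve n (push₁ n cst c) = push₁ n cst c + push₁ n cst c := by
  simp only [halve_apply, push_push, AddMonoidHom.comp_id]

theorem d_mem_deg (n : ℕ) : ∀ {X : Type u} {c : CubeChain (n + 1) X M},
    c ∈ Deg M (n + 1) X → d M n X c ∈ Deg M n X := by
  induction n with
  | zero =>
    intro X c hc
    refine deg_succ_le (K := (Deg M 0 X).comap (d M 0 X)) ?_ ?_ hc
    · intro c hc
      exact ends_mem_deg hc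
    · intro c
      rw [AddSubgroup.mem_comap, d_zero_apply, AddEquiv.apply_symm_apply, ends_cst]
      exact zero_mem _
  | succ n ih =>
    intro X c hc
    refine deg_succ_le (K := (Deg M (n + 1) X).comap (d M (n + 1) X)) ?_ ?_ hc
    · intro c hc
      rw [AddSubgroup.mem_comap, d_succ_apply, AddEquiv.apply_symm_apply]
      exact sub_mem (ends_mem_deg hc) (cu_symm_mem_deg (ih hc))
    · intro c
      rw [AddSubgroup.mem_comap, d_succ_apply, AddEquiv.apply_symm_apply, ends_cst, d_push, zero_sub]
      exact neg_mem (cu_symm_push_cst_mem_deg _)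

theorem sd_mem_deg (n : ℕ) : ∀ {X : Type u} {c : CubeChain n X M},
    c ∈ Deg M n X → sd M n X c ∈ Deg M n X := by
  induction n with
  | zero => exact fun h => h
  | succ n ih =>
    intro X c hc
    refine deg_succ_le (K := (Deg M (n + 1) X).comap (sd M (n + 1) X)) ?_ ?_ hc
    · intro c hc
      exact cu_symm_mem_deg (halve_mem_deg (ih hc))
    · intro c
      rw [AddSubgroup.mem_comap, sd_succ_apply, AddEquiv.apply_symm_apply, sd_push, halve_cst,
        map_add]
      exact add_mem (cu_symm_push_cst_mem_deg _) (cu_symm_push_cst_mem_deg _)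

theorem sdHomotopy_mem_deg (n : ℕ) : ∀ {X : Type u} {c : CubeChain n X M},
    c ∈ Deg M n X → sdHomotopy M n X c ∈ Deg M (n + 1) X := by
  induction n with
  | zero => exact fun _ => zero_mem _
  | succ n ih =>
    intro X c hc
    refine deg_succ_le (K := (Deg M (n + 2) X).comap (sdHomotopy M (n + 1) X)) ?_ ?_ hc
    · intro c hc
      exact cu_symm_mem_deg (sub_mem (cu_symm_mem_deg (push_mem_deg _ _ (sd_mem_deg n hc))) (ih hc))
    · intro c
      rw [AddSubgroup.mem_comap, sdHomotopy_succ_apply, AddEquiv.apply_symm_apply, sd_push,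
        sdHomotopy_push, map_sub]
      refine sub_mem (cu_symm_mem_deg ?_) (cu_symm_push_cst_mem_deg _)
      have : push₁ n fill (push₁ n cst (sd M n X c)) =
          push₁ n cst (push₁ n (cst (X := X)) (sd M n X c)) := by
        simp only [push_push]
      rw [this]
      exact cu_symm_push_cst_mem_deg _

/-- Subdivision is homotopic to the identity modulo degenerate cubes. -/
theorem d_sdHomotopy_mem_deg (n : ℕ) : ∀ {X : Type u} (c : CubeChain (n + 1) X M),
    d M (n + 1) X (sdHomotopy M (n + 1) X c) + sdHomotopy M n X (d M n X c) -
      (sd M (n + 1) X c - c) ∈ Deg M (n + 1) X := by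
  induction n with
  | zero =>
    intro X c
    rw [sdHomotopy_zero_apply, add_zero, d_sdHomotopy_zero]
    exact neg_mem (cu_symm_push_cst_mem_deg _)
  | succ n ih =>
    intro X c
    rw [d_sdHomotopy_succ]
    exact sub_mem (cu_symm_mem_deg (ih _)) (cu_symm_push_cst_mem_deg _)

/-- The prism operator of a family of paths. -/
noncomputable def prism (n : ℕ) {X Y : Type u} (h : X → 𝕀 → Y) :
    CubeChain n X M →+ CubeChain (n + 1) Y M :=
  cu.symm.toAddMonoidHom.comp (push₁ n h)

theorem prism_apply (n : ℕ) {X Y : Type u} (h : X → 𝕀 → Y) (c : CubeChain n X M) :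
    prism n h c = cu.symm (push₁ n h c) := rfl

theorem prism_mem_deg {n : ℕ} {X Y : Type u} (h : X → 𝕀 → Y) {c : CubeChain n X M}
    (hc : c ∈ Deg M n X) : prism n h c ∈ Deg M (n + 1) Y :=
  cu_symm_mem_deg (push_mem_deg _ _ hc)

theorem ends_push_path (n : ℕ) {X Y : Type u} (h : X → 𝕀 → Y) (c : CubeChain n X M) :
    ends n (push₁ n h c) = push₁ n (fun x => h x 1) c - push₁ n (fun x => h x 0) c := by
  simp only [ends_apply, push_push]
  rfl

theorem d_prism_zero {X Y : Type u} (h : X → 𝕀 → Y) (c : CubeChain 0 X M) :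
    d M 0 Y (prism 0 h c) = push₁ 0 (fun x => h x 1) c - push₁ 0 (fun x => h x 0) c := by
  rw [d_zero_apply, prism_apply, AddEquiv.apply_symm_apply, ends_push_path]

theorem d_prism_succ (n : ℕ) {X Y : Type u} (h : X → 𝕀 → Y) (c : CubeChain (n + 1) X M) :
    d M (n + 1) Y (prism (n + 1) h c) = push₁ (n + 1) (fun x => h x 1) c -
      push₁ (n + 1) (fun x => h x 0) c - prism n h (d M n X c) := by
  rw [d_succ_apply, prism_apply, AddEquiv.apply_symm_apply, ends_push_path, d_push, prism_apply]

end Degenerate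

end CubeChain
end MooreFlat

namespace MooreFlat

/-! ### Normalised augmented chains -/

open CubeChain

/-- Normalised cubical chains, augmented: the coefficients are placed in degree `0`, and the chains
of `n`-cubes in degree `n + 1`. -/
def Ch (X : Type u) (M : Type u) [AddCommGroup M] : ℕ → Type u
  | 0 => M
  | n + 1 => CubeChain n X M ⧸ Deg M n X

namespace Ch

noncomputable instance (X : Type u) (M : Type u) [AddCommGroup M] :
    ∀ n : ℕ, AddCommGroup (Ch X M n)
  | 0 => inferInstanceAs (AddCommGroup M)
  | n + 1 => inferInstanceAs (AddCommGroup (CubeChain n X M ⧸ Deg M n X))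

variable {X Y Z : Type u} {M N P : Type u} [AddCommGroup M] [AddCommGroup N] [AddCommGroup P]

/-- The class of a chain of cubes. -/
noncomputable def mk (n : ℕ) : CubeChain n X M →+ Ch X M (n + 1) :=
  QuotientAddGroup.mk' (Deg M n X)

theorem mk_surjective (n : ℕ) : Function.Surjective (mk (X := X) (M := M) n) :=
  QuotientAddGroup.mk'_surjective _

theorem mk_eq_zero_iff {n : ℕ} {c : CubeChain n X M} : mk n c = 0 ↔ c ∈ Deg M n X :=
  QuotientAddGroup.eq_zero_iff c

theorem mk_eq_mk_iff {n : ℕ} {c c' : CubeChain n X M} : mk n c = mk n c' ↔ c - c' ∈ Deg M n X := by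
  rw [← mk_eq_zero_iff, map_sub, sub_eq_zero]

variable (X M) in
/-- The augmentation. -/
noncomputable def aug : CubeChain 0 X M →+ M := Finsupp.liftAddHom fun _ => AddMonoidHom.id M

@[simp] theorem aug_single (x : Cube 0 X) (m : M) : aug X M (Finsupp.single x m) = m := by
  simp [aug]

theorem aug_push (f : X → Y) (α : M →+ N) (c : CubeChain 0 X M) :
    aug Y N (push 0 f α c) = α (aug X M c) := by
  have : (aug Y N).comp (push 0 f α) = α.comp (aug X M) := by
    refine Finsupp.addHom_ext fun s m => ?_
    simp
  exact DFunLike.congr_fun this c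

/-- The boundary operator. -/
noncomputable def d : ∀ n : ℕ, Ch X M (n + 1) →+ Ch X M n
  | 0 => QuotientAddGroup.lift (Deg M 0 X) (aug X M) (by rw [deg_zero]; exact bot_le)
  | n + 1 => QuotientAddGroup.map _ _ (CubeChain.d M n X) fun _ hc => d_mem_deg n hc

theorem d_zero_mk (c : CubeChain 0 X M) : d 0 (mk 0 c) = aug X M c := rfl

theorem d_succ_mk (n : ℕ) (c : CubeChain (n + 1) X M) :
    d (n + 1) (mk (n + 1) c) = mk n (CubeChain.d M n X c) := rfl

theorem d_d (n : ℕ) (c : Ch X M (n + 2)) : d n (d (n + 1) c) = 0 := by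
  obtain ⟨c, rfl⟩ := mk_surjective _ c
  cases n with
  | zero =>
    rw [d_succ_mk, d_zero_mk, CubeChain.d_zero_apply, ends_apply, map_sub, aug_push, aug_push,
      sub_self]
    rfl
  | succ n => rw [d_succ_mk, d_succ_mk, CubeChain.d_d, map_zero]

/-- Functoriality of chains. -/
noncomputable def push (f : X → Y) (α : M →+ N) : ∀ n : ℕ, Ch X M n →+ Ch Y N n
  | 0 => α
  | n + 1 => QuotientAddGroup.map _ _ (CubeChain.push n f α) fun _ hc => push_mem_deg f α hc

/-- Functoriality of chains for fixed coefficients. -/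
noncomputable abbrev push₁ (f : X → Y) (n : ℕ) : Ch X M n →+ Ch Y M n :=
  push f (AddMonoidHom.id M) n

theorem push_mk (f : X → Y) (α : M →+ N) (n : ℕ) (c : CubeChain n X M) :
    push f α (n + 1) (mk n c) = mk n (CubeChain.push n f α c) := rfl

theorem push_push (g : Y → Z) (β : N →+ P) (f : X → Y) (α : M →+ N) (n : ℕ) (c : Ch X M n) :
    push g β n (push f α n c) = push (fun x => g (f x)) (β.comp α) n c := by
  cases n with
  | zero => rfl
  | succ n =>
    obtain ⟨c, rfl⟩ := mk_surjective _ c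
    rw [push_mk, push_mk, push_mk, CubeChain.push_push]

theorem push_id (n : ℕ) (c : Ch X M n) : push₁ (fun x : X => x) n c = c := by
  cases n with
  | zero => rfl
  | succ n =>
    obtain ⟨c, rfl⟩ := mk_surjective _ c
    rw [push_mk, CubeChain.push_id]

theorem push_add (f : X → Y) (α β : M →+ N) (n : ℕ) (c : Ch X M n) :
    push f (α + β) n c = push f α n c + push f β n c := by
  cases n with
  | zero => rfl
  | succ n =>
    obtain ⟨c, rfl⟩ := mk_surjective _ c
    rw [push_mk, push_mk, push_mk, ← map_add]
    congr 1
    have : CubeChain.push n f (α + β) = CubeChain.push n f α + CubeChain.push n f β := by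
      refine Finsupp.addHom_ext fun s m => ?_
      simp
    exact DFunLike.congr_fun this c

theorem d_push (f : X → Y) (α : M →+ N) (n : ℕ) (c : Ch X M (n + 1)) :
    d n (push f α (n + 1) c) = push f α n (d n c) := by
  obtain ⟨c, rfl⟩ := mk_surjective _ c
  cases n with
  | zero => exact aug_push f α c
  | succ n => rw [push_mk, d_succ_mk, d_succ_mk, CubeChain.d_push, push_mk]

/-- Subdivision. -/
noncomputable def sd : ∀ n : ℕ, Ch X M n →+ Ch X M n
  | 0 => AddMonoidHom.id _
  | n + 1 => QuotientAddGroup.map _ _ (CubeChain.sd M n X) fun _ hc => sd_mem_deg n hc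

theorem sd_mk (n : ℕ) (c : CubeChain n X M) : sd (n + 1) (mk n c) = mk n (CubeChain.sd M n X c) :=
  rfl

theorem d_sd (n : ℕ) (c : Ch X M (n + 1)) : d n (sd (n + 1) c) = sd n (d n c) := by
  obtain ⟨c, rfl⟩ := mk_surjective _ c
  cases n with
  | zero => rfl
  | succ n => rw [sd_mk, d_succ_mk, d_succ_mk, CubeChain.d_sd, sd_mk]

/-- The homotopy between subdivision and the identity. -/
noncomputable def sdHomotopy : ∀ n : ℕ, Ch X M n →+ Ch X M (n + 1)
  | 0 => 0
  | n + 1 => QuotientAddGroup.map _ _ (CubeChain.sdHomotopy M n X) fun _ hc => sdHomotopy_mem_deg n hc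

theorem sdHomotopy_mk (n : ℕ) (c : CubeChain n X M) :
    sdHomotopy (n + 1) (mk n c) = mk (n + 1) (CubeChain.sdHomotopy M n X c) := rfl

theorem d_sdHomotopy (n : ℕ) (c : Ch X M (n + 1)) :
    d (n + 1) (sdHomotopy (n + 1) c) + sdHomotopy n (d n c) = sd (n + 1) c - c := by
  obtain ⟨c, rfl⟩ := mk_surjective _ c
  cases n with
  | zero =>
    rw [sdHomotopy_mk, sdHomotopy_zero_apply, map_zero, map_zero]
    exact (add_zero _).trans (sub_self _).symm
  | succ n =>
    rw [sdHomotopy_mk, d_succ_mk, d_succ_mk, sdHomotopy_mk, sd_mk, ← map_add, ← map_sub, mk_eq_mk_iff]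
    exact d_sdHomotopy_mem_deg n c

/-- The prism operator of a family of paths. -/
noncomputable def prism (h : X → 𝕀 → Y) : ∀ n : ℕ, Ch X M n →+ Ch Y M (n + 1)
  | 0 => 0
  | n + 1 => QuotientAddGroup.map _ _ (CubeChain.prism n h) fun _ hc => prism_mem_deg h hc

theorem prism_mk (h : X → 𝕀 → Y) (n : ℕ) (c : CubeChain n X M) :
    prism h (n + 1) (mk n c) = mk (n + 1) (CubeChain.prism n h c) := rfl

theorem d_prism (h : X → 𝕀 → Y) (n : ℕ) (c : Ch X M (n + 1)) :
    d (n + 1) (prism h (n + 1) c) + prism h n (d n c) =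
      push₁ (fun x => h x 1) (n + 1) c - push₁ (fun x => h x 0) (n + 1) c := by
  obtain ⟨c, rfl⟩ := mk_surjective _ c
  cases n with
  | zero =>
    rw [prism_mk, d_succ_mk, push_mk, push_mk, d_prism_zero, map_sub]
    exact add_zero _
  | succ n =>
    rw [prism_mk, d_succ_mk, push_mk, push_mk, d_prism_succ, map_sub, map_sub, d_succ_mk, prism_mk,
      sub_add_cancel]

/-- A constant map makes every cube of positive dimension degenerate. This is the gain from
normalising: a contraction shows at once that higher cycles bound. -/
theorem push_cst_succ (x : Y) (α : M →+ N) (n : ℕ) (c : Ch X M (n + 2)) :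
    push (fun _ => x) α (n + 2) c = 0 := by
  obtain ⟨c, rfl⟩ := mk_surjective _ c
  rw [push_mk, mk_eq_zero_iff]
  exact cu_symm_push_cst_mem_deg (CubeChain.push n (fun _ => x) α (cu c)) |> fun h => by
    convert h using 1
    rw [CubeChain.push_push]
    rfl

theorem push_cst_one (x : Y) (α : M →+ N) (c : Ch X M 1) :
    push (fun _ => x) α 1 c = mk 0 (Finsupp.single (Cube.point x) (α (d 0 c))) := by
  obtain ⟨c, rfl⟩ := mk_surjective _ c
  rw [push_mk, d_zero_mk]
  congr 1
  induction c using Finsupp.induction_linear with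
  | zero => rw [map_zero, map_zero, map_zero, Finsupp.single_zero]
  | add c c' h h' => rw [map_add, h, h', map_add, map_add, Finsupp.single_add]
  | single s m =>
    rw [CubeChain.push_single, aug_single]
    rfl

end Ch
end MooreFlat

namespace MooreFlat

open CubeChain

/-! ### Faces and pieces of a cube as reparametrizations -/

section Reparam

variable {M : Type v} [AddCommGroup M]

theorem continuous_tail (n : ℕ) :
    Continuous fun y : Fin (n + 1) → 𝕀 => (Fin.tail y : Fin n → 𝕀) :=
  continuous_pi fun i => continuous_apply (A := fun _ : Fin (n + 1) => 𝕀) i.succ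

theorem Cube.map_congr (n : ℕ) : ∀ {X : Type u} {Y : Type u} (f g : X → Y) (s : Cube n X),
    (∀ y, f (s.toFun n y) = g (s.toFun n y)) → s.map n f = s.map n g := by
  induction n with
  | zero => exact fun f g s h => h Fin.elim0
  | succ n ih =>
    intro X Y f g s h
    refine ih _ _ _ fun y => funext fun t => ?_
    have := h (Fin.cons t y)
    exact this

/-- The chains consisting of reparametrizations `s ∘ φ` of the cube `s`, where `φ` satisfies `P`. -/
noncomputable def Reparam (M : Type v) [AddCommGroup M] {n m : ℕ}
    (P : ((Fin m → 𝕀) → Fin n → 𝕀) → Prop) {X : Type u} (s : Cube n X) :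
    AddSubgroup (CubeChain m X M) :=
  AddSubgroup.closure {c | ∃ (t : Cube m X) (μ : M) (φ : (Fin m → 𝕀) → Fin n → 𝕀), P φ ∧
    (∀ y, t.toFun m y = s.toFun n (φ y)) ∧ c = Finsupp.single t μ}

theorem single_mem_reparam {n m : ℕ} {P : ((Fin m → 𝕀) → Fin n → 𝕀) → Prop} {X : Type u}
    {s : Cube n X} {t : Cube m X} (φ : (Fin m → 𝕀) → Fin n → 𝕀) (hφ : P φ)
    (h : ∀ y, t.toFun m y = s.toFun n (φ y)) (μ : M) : Finsupp.single t μ ∈ Reparam M P s :=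
  AddSubgroup.subset_closure ⟨t, μ, φ, hφ, h, rfl⟩

theorem map_reparam_le {n m : ℕ} {P : ((Fin m → 𝕀) → Fin n → 𝕀) → Prop} {X : Type u}
    {s : Cube n X} {A : Type*} [AddCommGroup A] (f : CubeChain m X M →+ A) (K : AddSubgroup A)
    (h : ∀ (t : Cube m X) (μ : M) (φ : (Fin m → 𝕀) → Fin n → 𝕀), P φ →
      (∀ y, t.toFun m y = s.toFun n (φ y)) → f (Finsupp.single t μ) ∈ K) {c : CubeChain m X M}
    (hc : c ∈ Reparam M P s) : f c ∈ K := by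
  refine (AddSubgroup.closure_le (K.comap f)).2 ?_ hc
  rintro _ ⟨t, μ, φ, hφ, ht, rfl⟩
  exact h t μ φ hφ ht

theorem cu_symm_mem_reparam {n m : ℕ} {X : Type u} {s : Cube n (𝕀 → X)}
    {c : CubeChain m (𝕀 → X) M} (hc : c ∈ Reparam M Continuous s) :
    cu.symm c ∈ Reparam M Continuous (show Cube (n + 1) X from s) := by
  refine map_reparam_le cu.symm.toAddMonoidHom _ ?_ hc
  intro t μ φ hφ ht
  refine single_mem_reparam (t := (show Cube (m + 1) X from t))
    (fun y => Fin.cons (y 0) (φ (Fin.tail y))) ?_ (fun y => ?_) μ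
  · have : Continuous fun y : Fin (m + 1) → 𝕀 => φ (Fin.tail y) :=
      hφ.comp (continuous_tail m)
    exact Continuous.finCons (continuous_apply 0) this
  · change Cube.toFun m t (Fin.tail y) (y 0) = Cube.toFun n s _ _
    rw [ht, Fin.tail_cons, Fin.cons_zero]

theorem push_ev_single_mem_reparam {n : ℕ} {X : Type u} (s : Cube (n + 1) X) (t : 𝕀) (μ : M) :
    push₁ n (ev t) (cu (Finsupp.single s μ)) ∈ Reparam M Continuous s := by
  rw [cu_single, push_single]
  refine single_mem_reparam (fun y => Fin.cons t y) (Continuous.finCons continuous_const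
    continuous_id) (fun y => ?_) _
  rw [Cube.toFun_map]
  rfl

/-- Faces of `s` are composites of `s` with continuous maps of cubes, so the boundary operator
respects continuity and does not enlarge the image. -/
theorem d_single_mem_reparam (n : ℕ) : ∀ {X : Type u} (s : Cube (n + 1) X) (μ : M),
    d M n X (Finsupp.single s μ) ∈ Reparam M Continuous s := by
  induction n with
  | zero =>
    intro X s μ
    rw [d_zero_apply, ends_apply]
    exact sub_mem (push_ev_single_mem_reparam s 1 μ) (push_ev_single_mem_reparam s 0 μ)
  | succ n ih =>
    intro X s μ
    rw [d_succ_apply, ends_apply]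
    refine sub_mem (sub_mem (push_ev_single_mem_reparam s 1 μ) (push_ev_single_mem_reparam s 0 μ)) ?_
    exact cu_symm_mem_reparam (ih (show Cube (n + 1) (𝕀 → X) from s) μ)

/-- The maps which shrink distances by the factor `2`. -/
def Halving {n m : ℕ} (φ : (Fin m → 𝕀) → Fin n → 𝕀) : Prop :=
  ∀ y z, dist (φ y) (φ z) ≤ dist y z / 2

theorem Halving.continuous {n m : ℕ} {φ : (Fin m → 𝕀) → Fin n → 𝕀} (h : Halving φ) :
    Continuous φ :=
  (LipschitzWith.of_dist_le_mul (K := 1) fun y z => (h y z).trans (by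
    have := dist_nonneg (x := y) (y := z)
    rw [NNReal.coe_one]; linarith)).continuous

theorem Halving.cons {n m : ℕ} {φ : (Fin m → 𝕀) → Fin n → 𝕀} (h : Halving φ) {r : 𝕀 → 𝕀}
    (hr : ∀ a b, dist (r a) (r b) ≤ dist a b / 2) :
    Halving fun y : Fin (m + 1) → 𝕀 => (Fin.cons (r (y 0)) (φ (Fin.tail y)) : Fin (n + 1) → 𝕀) := by
  intro y z
  refine (dist_pi_le_iff (div_nonneg dist_nonneg zero_le_two)).2 fun i => ?_
  refine Fin.cases ?_ (fun i => ?_) i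
  · simp only [Fin.cons_zero]
    exact (hr _ _).trans (div_le_div_of_nonneg_right (dist_le_pi_dist y z 0) zero_le_two)
  · simp only [Fin.cons_succ]
    refine (dist_le_pi_dist _ _ i).trans ((h _ _).trans (div_le_div_of_nonneg_right ?_ zero_le_two))
    exact (dist_pi_le_iff dist_nonneg).2 fun j => dist_le_pi_dist y z j.succ

theorem dist_lo (a b : 𝕀) : dist (lo a) (lo b) ≤ dist a b / 2 := by
  simp only [Subtype.dist_eq, lo, Real.dist_eq]
  rw [← sub_div, abs_div, abs_of_pos (zero_lt_two' ℝ)]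

theorem dist_hi (a b : 𝕀) : dist (hi a) (hi b) ≤ dist a b / 2 := by
  simp only [Subtype.dist_eq, hi, Real.dist_eq]
  rw [← sub_div, abs_div, abs_of_pos (zero_lt_two' ℝ), add_sub_add_right_eq_sub]

/-- Each piece precomposes `s` with coordinatewise choices of `lo` and `hi`, which halve the sup
distance. This contraction is what iterated subdivision needs. -/
theorem sd_single_mem_reparam (n : ℕ) : ∀ {X : Type u} (s : Cube n X) (μ : M),
    sd M n X (Finsupp.single s μ) ∈ Reparam M Halving s := by
  induction n with
  | zero =>
    intro X s μ
    exact single_mem_reparam id (fun y z => by rw [Subsingleton.elim y z]; simp) (fun y => rfl) μ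
  | succ n ih =>
    intro X s μ
    refine map_reparam_le (cu.symm.toAddMonoidHom.comp (halve n)) _ ?_
      (ih (show Cube n (𝕀 → X) from s) μ)
    intro t μ φ hφ ht
    rw [AddMonoidHom.comp_apply, halve_apply, map_add]
    have key : ∀ r : 𝕀 → 𝕀, (∀ a b, dist (r a) (r b) ≤ dist a b / 2) →
        cu.symm (push₁ n (fun (γ : 𝕀 → X) a => γ (r a)) (Finsupp.single t μ)) ∈
          Reparam M Halving s := by
      intro r hr
      rw [push_single]
      refine single_mem_reparam
        (t := (show Cube (n + 1) X from Cube.map n (fun (γ : 𝕀 → X) a => γ (r a)) t))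
        (fun y => Fin.cons (r (y 0)) (φ (Fin.tail y))) (hφ.cons hr) (fun y => ?_) _
      change Cube.toFun n (Cube.map n (fun (γ : 𝕀 → X) a => γ (r a)) t) (Fin.tail y) (y 0) =
        Cube.toFun n (X := 𝕀 → X) s _ _
      rw [Cube.toFun_map, ht, Fin.tail_cons, Fin.cons_zero]
    exact add_mem (key lo dist_lo) (key hi dist_hi)

theorem continuous_sq : Continuous fun p : 𝕀 × 𝕀 => sq p.1 p.2 := by
  refine Continuous.subtype_mk ?_ _
  fun_prop

theorem sdHomotopy_single_mem_reparam (n : ℕ) : ∀ {X : Type u} (s : Cube n X) (μ : M),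
    sdHomotopy M n X (Finsupp.single s μ) ∈ Reparam M Continuous s := by
  induction n with
  | zero => intro X s μ; exact zero_mem _
  | succ n ih =>
    intro X s μ
    rw [sdHomotopy_succ_apply, map_sub]
    refine sub_mem ?_ (cu_symm_mem_reparam (ih (show Cube n (𝕀 → X) from s) μ))
    refine map_reparam_le (cu.symm.toAddMonoidHom.comp (cu.symm.toAddMonoidHom.comp (push₁ n fill)))
      _ ?_ (sd_single_mem_reparam n (show Cube n (𝕀 → X) from s) μ)
    intro t μ φ hφ ht
    rw [AddMonoidHom.comp_apply, AddMonoidHom.comp_apply, push_single]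
    refine single_mem_reparam (t := (show Cube (n + 2) X from Cube.map n fill t))
      (fun y => Fin.cons (sq (y 1) (y 0)) (φ (Fin.tail (Fin.tail y)))) ?_ (fun y => ?_) _
    · have h1 : Continuous fun y : Fin (n + 2) → 𝕀 => φ (Fin.tail (Fin.tail y)) :=
        hφ.continuous.comp ((continuous_tail n).comp (continuous_tail (n + 1)))
      have h2 : Continuous fun y : Fin (n + 2) → 𝕀 => sq (y 1) (y 0) :=
        continuous_sq.comp (Continuous.prodMk
          (continuous_apply (A := fun _ : Fin (n + 2) => 𝕀) 1)
          (continuous_apply (A := fun _ : Fin (n + 2) => 𝕀) 0))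
      exact Continuous.finCons h2 h1
    · change Cube.toFun n (Cube.map n fill t) (Fin.tail (Fin.tail y)) (y 1) (y 0) =
        Cube.toFun n (X := 𝕀 → X) s _ _
      rw [Cube.toFun_map, ht, Fin.tail_cons, Fin.cons_zero]

end Reparam

/-! ### Chains of continuous cubes in a subset -/

section Supported

variable {X Y : Type u} [TopologicalSpace X] [TopologicalSpace Y]

/-- The continuous cubes in a subset. -/
structure Cube.IsIn (A : Set X) {n : ℕ} (s : Cube n X) : Prop where
  continuous : Continuous (s.toFun n)
  mem : ∀ y, s.toFun n y ∈ A

theorem Cube.IsIn.mono {A B : Set X} (hAB : A ⊆ B) {n : ℕ} {s : Cube n X} (h : s.IsIn A) :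
    s.IsIn B := ⟨h.1, fun y => hAB (h.2 y)⟩

theorem Cube.IsIn.map {A : Set X} {B : Set Y} {f : X → Y} (hf : ContinuousOn f A)
    (hAB : Set.MapsTo f A B) {n : ℕ} {s : Cube n X} (h : s.IsIn A) : (s.map n f).IsIn B := by
  have : Cube.toFun n (s.map n f) = fun y => f (s.toFun n y) := funext fun y => s.toFun_map n f y
  constructor
  · rw [this]
    exact hf.comp_continuous h.1 h.2
  · intro y
    rw [this]
    exact hAB (h.2 y)

theorem Cube.IsIn.reparam {A : Set X} {n m : ℕ} {s : Cube n X} (h : s.IsIn A) {t : Cube m X}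
    {φ : (Fin m → 𝕀) → Fin n → 𝕀} (hφ : Continuous φ) (ht : ∀ y, t.toFun m y = s.toFun n (φ y)) :
    t.IsIn A :=
  ⟨by rw [funext ht]; exact h.1.comp hφ, fun y => by rw [ht]; exact h.2 _⟩

theorem Cube.IsIn.prism {A : Set X} {B : Set Y} {f : X → 𝕀 → Y}
    (hf : ContinuousOn (fun p : X × 𝕀 => f p.1 p.2) (A ×ˢ Set.univ))
    (hAB : ∀ x ∈ A, ∀ t, f x t ∈ B) {n : ℕ} {s : Cube n X} (h : s.IsIn A) :
    Cube.IsIn B (n := n + 1) (show Cube (n + 1) Y from s.map n f) := by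
  have : Cube.toFun (n + 1) (show Cube (n + 1) Y from s.map n f) =
      fun y => f (s.toFun n (Fin.tail y)) (y 0) :=
    funext fun y => congrFun (s.toFun_map n f (Fin.tail y)) (y 0)
  constructor
  · rw [this]
    refine hf.comp_continuous (f := fun y : Fin (n + 1) → 𝕀 => (s.toFun n (Fin.tail y), y 0)) ?_
      fun y => ⟨h.2 _, trivial⟩
    exact (h.1.comp (continuous_tail n)).prodMk
      (continuous_apply (A := fun _ : Fin (n + 1) => 𝕀) 0)
  · intro y
    rw [this]
    exact hAB _ (h.2 _) _

variable {M N : Type u} [AddCommGroup M] [AddCommGroup N]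

namespace Ch

/-- The chains of continuous cubes in a subset. -/
noncomputable def sub (M : Type u) [AddCommGroup M] (A : Set X) : ∀ n : ℕ, AddSubgroup (Ch X M n)
  -- Degree `0` holds the coefficients, which belong to every subset, even the empty one. Conditions
  -- relative to a subset are therefore void in degree `0`, and relative homology is not affected by
  -- the augmentation.
  | 0 => ⊤
  | n + 1 => AddSubgroup.closure {c | ∃ (s : Cube n X) (m : M), s.IsIn A ∧
      c = mk n (Finsupp.single s m)}

variable {A B : Set X}

theorem mem_sub_zero (c : Ch X M 0) : c ∈ sub M A 0 := AddSubgroup.mem_top c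

theorem mk_single_mem_sub {n : ℕ} {s : Cube n X} (hs : s.IsIn A) (m : M) :
    mk n (Finsupp.single s m) ∈ sub M A (n + 1) := AddSubgroup.subset_closure ⟨s, m, hs, rfl⟩

theorem map_sub_mem {n : ℕ} {K : Type*} [AddCommGroup K] (f : Ch X M (n + 1) →+ K)
    (L : AddSubgroup K) (h : ∀ (s : Cube n X) (m : M), s.IsIn A → f (mk n (Finsupp.single s m)) ∈ L)
    {c : Ch X M (n + 1)} (hc : c ∈ sub M A (n + 1)) : f c ∈ L := by
  refine (AddSubgroup.closure_le (L.comap f)).2 ?_ hc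
  rintro _ ⟨s, m, hs, rfl⟩
  exact h s m hs

theorem sub_mono (hAB : A ⊆ B) {n : ℕ} {c : Ch X M n} (hc : c ∈ sub M A n) : c ∈ sub M B n := by
  cases n with
  | zero => exact mem_sub_zero c
  | succ n => exact map_sub_mem (AddMonoidHom.id _) _ (fun s m hs => mk_single_mem_sub (hs.mono hAB) m) hc

theorem push_mem_sub {B : Set Y} {f : X → Y} (hf : ContinuousOn f A) (hAB : Set.MapsTo f A B)
    (α : M →+ N) {n : ℕ} {c : Ch X M n} (hc : c ∈ sub M A n) : push f α n c ∈ sub N B n := by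
  cases n with
  | zero => exact mem_sub_zero _
  | succ n =>
    refine map_sub_mem _ _ (fun s m hs => ?_) hc
    rw [push_mk, CubeChain.push_single]
    exact mk_single_mem_sub (hs.map hf hAB) _

theorem prism_mem_sub {B : Set Y} {f : X → 𝕀 → Y}
    (hf : ContinuousOn (fun p : X × 𝕀 => f p.1 p.2) (A ×ˢ Set.univ))
    (hAB : ∀ x ∈ A, ∀ t, f x t ∈ B) {n : ℕ} {c : Ch X M n} (hc : c ∈ sub M A n) :
    prism f n c ∈ sub M B (n + 1) := by
  cases n with
  | zero => exact zero_mem _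
  | succ n =>
    refine map_sub_mem _ _ (fun s m hs => ?_) hc
    rw [prism_mk, CubeChain.prism_apply, CubeChain.push_single]
    exact mk_single_mem_sub (hs.prism hf hAB) _

theorem mk_mem_sub_of_reparam {n m : ℕ} {s : Cube n X} (hs : s.IsIn A)
    {P : ((Fin m → 𝕀) → Fin n → 𝕀) → Prop} (hP : ∀ φ, P φ → Continuous φ) {c : CubeChain m X M}
    (hc : c ∈ Reparam M P s) : mk m c ∈ sub M A (m + 1) :=
  map_reparam_le (mk m) _
    (fun _ _ φ hφ ht => mk_single_mem_sub (hs.reparam (hP φ hφ) ht) _) hc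

theorem d_mem_sub {n : ℕ} {c : Ch X M (n + 1)} (hc : c ∈ sub M A (n + 1)) : d n c ∈ sub M A n := by
  cases n with
  | zero => exact mem_sub_zero _
  | succ n =>
    refine map_sub_mem _ _ (fun s m hs => ?_) hc
    exact mk_mem_sub_of_reparam hs (fun _ h => h) (d_single_mem_reparam n s m)

theorem sd_mem_sub {n : ℕ} {c : Ch X M n} (hc : c ∈ sub M A n) : sd n c ∈ sub M A n := by
  cases n with
  | zero => exact mem_sub_zero _
  | succ n =>
    refine map_sub_mem _ _ (fun s m hs => ?_) hc
    exact mk_mem_sub_of_reparam hs (fun _ h => Halving.continuous h) (sd_single_mem_reparam n s m)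

theorem sdHomotopy_mem_sub {n : ℕ} {c : Ch X M n} (hc : c ∈ sub M A n) :
    sdHomotopy n c ∈ sub M A (n + 1) := by
  cases n with
  | zero => exact zero_mem _
  | succ n =>
    refine map_sub_mem _ _ (fun s m hs => ?_) hc
    exact mk_mem_sub_of_reparam hs (fun _ h => h) (sdHomotopy_single_mem_reparam n s m)

theorem push_congr_sub {Y : Type u} {f g : X → Y} (hfg : Set.EqOn f g A) (α : M →+ N) {n : ℕ} {c : Ch X M n}
    (hc : c ∈ sub M A n) : push f α n c = push g α n c := by
  cases n with
  | zero => rfl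
  | succ n =>
    have := map_sub_mem (push f α (n + 1) - push g α (n + 1)) ⊥ (fun s m hs => ?_) hc
    · exact sub_eq_zero.1 this
    · rw [AddMonoidHom.sub_apply, push_mk, push_mk, CubeChain.push_single, CubeChain.push_single,
        AddSubgroup.mem_bot, sub_eq_zero]
      congr 2
      exact Cube.map_congr n f g s fun y => hfg (hs.2 y)

end Ch
end Supported
end MooreFlat

namespace MooreFlat

open CubeChain

/-! ### Intersections and small chains -/

namespace Ch

variable {X Y : Type u} [TopologicalSpace X] [TopologicalSpace Y]
variable {M N : Type u} [AddCommGroup M] [AddCommGroup N] {A B : Set X}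

open Classical in
/-- The projection onto the chains of continuous cubes in a subset, which omits the other cubes. -/
noncomputable def restr (M : Type u) [AddCommGroup M] (A : Set X) : ∀ n : ℕ, Ch X M n →+ Ch X M n
  | 0 => AddMonoidHom.id _
  | n + 1 => QuotientAddGroup.map _ _
      (Finsupp.filterAddHom fun s : Cube n X => s.IsIn A) fun c hc => by
        refine mem_deg_iff.2 fun s hs => mem_deg_iff.1 hc s fun h0 => hs ?_
        change Finsupp.filter _ c s = 0
        rw [Finsupp.filter_apply, h0, ite_self]

theorem restr_mk_single {n : ℕ} (s : Cube n X) (m : M) [Decidable (s.IsIn A)] :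
    restr M A (n + 1) (mk n (Finsupp.single s m)) =
      if s.IsIn A then mk n (Finsupp.single s m) else 0 := by
  classical
  change mk n (Finsupp.filter _ (Finsupp.single s m)) = _
  split_ifs with h
  · rw [Finsupp.filter_single_of_pos _ h]
  · rw [Finsupp.filter_single_of_neg _ h, map_zero]

theorem restr_eq_self {n : ℕ} {c : Ch X M n} (hc : c ∈ sub M A n) : restr M A n c = c := by
  classical
  cases n with
  | zero => rfl
  | succ n =>
    have := map_sub_mem (restr M A (n + 1) - AddMonoidHom.id _) ⊥ (fun s m hs => ?_) hc
    · exact sub_eq_zero.1 this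
    · rw [AddMonoidHom.sub_apply, restr_mk_single, if_pos hs]
      exact sub_self _

theorem restr_mem_sub_inter {n : ℕ} {c : Ch X M n} (hc : c ∈ sub M B n) :
    restr M A n c ∈ sub M (A ∩ B) n := by
  classical
  cases n with
  | zero => exact mem_sub_zero _
  | succ n =>
    refine map_sub_mem _ _ (fun s m hs => ?_) hc
    rw [restr_mk_single]
    split_ifs with h
    · exact mk_single_mem_sub (A := A ∩ B) (Cube.IsIn.mk hs.1 fun y => ⟨h.2 y, hs.2 y⟩) m
    · exact zero_mem _

/-- The two memberships may be witnessed by different expressions of `c`. The projection `restr`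
reconciles them: it fixes chains in `A`, and it sends chains in `B` to chains in `A ∩ B`. -/
theorem mem_sub_inter {n : ℕ} {c : Ch X M n} (hA : c ∈ sub M A n) (hB : c ∈ sub M B n) :
    c ∈ sub M (A ∩ B) n := by
  rw [← restr_eq_self hA]
  exact restr_mem_sub_inter hB

theorem sub_empty {n : ℕ} {c : Ch X M (n + 1)} (hc : c ∈ sub M (∅ : Set X) (n + 1)) : c = 0 :=
  map_sub_mem (AddMonoidHom.id _) ⊥ (fun _ _ hs => (hs.2 fun _ => 0).elim) hc

/-- Iterated subdivision. -/
noncomputable def sdIter {X : Type u} (n : ℕ) : ℕ → (Ch X M n →+ Ch X M n)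
  | 0 => AddMonoidHom.id _
  | k + 1 => (sd n).comp (sdIter n k)

theorem sdIter_succ {X : Type u} (n k : ℕ) (c : Ch X M n) : sdIter n (k + 1) c = sd n (sdIter n k c) := rfl

theorem sdIter_mem_sub {n : ℕ} (k : ℕ) {c : Ch X M n} (hc : c ∈ sub M A n) :
    sdIter n k c ∈ sub M A n := by
  induction k with
  | zero => exact hc
  | succ k ih => exact sd_mem_sub ih

theorem d_sdIter {X : Type u} (n k : ℕ) (c : Ch X M (n + 1)) :
    d n (sdIter (n + 1) k c) = sdIter n k (d n c) := by
  induction k with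
  | zero => rfl
  | succ k ih => rw [sdIter_succ, d_sd, ih, sdIter_succ]

/-- The homotopy between iterated subdivision and the identity. -/
noncomputable def sdIterHomotopy {X : Type u} (n : ℕ) : ℕ → (Ch X M n →+ Ch X M (n + 1))
  | 0 => 0
  | k + 1 => sdIterHomotopy n k + (sdHomotopy n).comp (sdIter n k)

theorem sdIterHomotopy_succ {X : Type u} (n k : ℕ) (c : Ch X M n) :
    sdIterHomotopy n (k + 1) c = sdIterHomotopy n k c + sdHomotopy n (sdIter n k c) := rfl

theorem sdIterHomotopy_mem_sub {n : ℕ} (k : ℕ) {c : Ch X M n} (hc : c ∈ sub M A n) :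
    sdIterHomotopy n k c ∈ sub M A (n + 1) := by
  induction k with
  | zero => exact zero_mem _
  | succ k ih => exact add_mem ih (sdHomotopy_mem_sub (sdIter_mem_sub k hc))

theorem d_sdIterHomotopy {X : Type u} (n k : ℕ) (c : Ch X M (n + 1)) :
    d (n + 1) (sdIterHomotopy (n + 1) k c) + sdIterHomotopy n k (d n c) =
      sdIter (n + 1) k c - c := by
  induction k with
  | zero =>
    change d (n + 1) 0 + 0 = c - c
    rw [map_zero, sub_self, add_zero]
  | succ k ih =>
    rw [sdIterHomotopy_succ, sdIterHomotopy_succ, map_add, sdIter_succ, ← d_sdIter,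
      ← sub_add_sub_cancel _ (sdIter (n + 1) k c), ← ih, ← d_sdHomotopy]
    abel

theorem sdIter_mk_single {X : Type u} {n : ℕ} (k : ℕ) (s : Cube n X) (m : M) :
    sdIter (n + 1) k (mk n (Finsupp.single s m)) ∈ (Reparam M
      (fun φ : (Fin n → 𝕀) → Fin n → 𝕀 => ∀ y z, dist (φ y) (φ z) ≤ dist y z / 2 ^ k) s).map
        (mk n) := by
  induction k with
  | zero =>
    exact ⟨_, single_mem_reparam id (fun y z => by simp) (fun y => rfl) m, rfl⟩
  | succ k ih =>
    obtain ⟨c, hc, hc'⟩ := ih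
    rw [sdIter_succ, ← hc', sd_mk]
    refine ⟨_, ?_, rfl⟩
    refine map_reparam_le (CubeChain.sd M n X) _ (fun t μ φ hφ ht => ?_) hc
    refine map_reparam_le (AddMonoidHom.id _) _ (fun t' μ' ψ hψ ht' => ?_)
      (sd_single_mem_reparam n t μ)
    refine single_mem_reparam (φ ∘ ψ) (fun y z => (hφ _ _).trans ?_) (fun y => ?_) _
    · rw [pow_succ', ← div_div]
      exact div_le_div_of_nonneg_right (hψ y z) (by positivity)
    · rw [ht', ht, Function.comp_apply]

theorem exists_sdIter_mem {W O₁ O₂ : Set X} (h₁ : IsOpen O₁) (h₂ : IsOpen O₂) (hW : W ⊆ O₁ ∪ O₂)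
    {n : ℕ} {c : Ch X M n} (hc : c ∈ sub M W n) :
    ∃ k, sdIter n k c ∈ sub M (W ∩ O₁) n ⊔ sub M (W ∩ O₂) n := by
  -- Smallness survives further subdivision, so the summands of a chain can be given a common
  -- exponent.
  have mono : ∀ {n} {c : Ch X M n} {k : ℕ} (l : ℕ),
      sdIter n k c ∈ sub M (W ∩ O₁) n ⊔ sub M (W ∩ O₂) n →
      sdIter n (k + l) c ∈ sub M (W ∩ O₁) n ⊔ sub M (W ∩ O₂) n := by
    intro n c k l h
    induction l with
    | zero => exact h
    | succ l ih =>
      obtain ⟨a, ha, b, hb, hab⟩ := AddSubgroup.mem_sup.1 ih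
      rw [← add_assoc, sdIter_succ, ← hab, map_add]
      exact AddSubgroup.mem_sup.2 ⟨_, sd_mem_sub ha, _, sd_mem_sub hb, rfl⟩
  cases n with
  | zero => exact ⟨0, AddSubgroup.mem_sup_left (mem_sub_zero _)⟩
  | succ n =>
    refine AddSubgroup.closure_induction (p := fun c _ => ∃ k, sdIter (n + 1) k c ∈
      sub M (W ∩ O₁) (n + 1) ⊔ sub M (W ∩ O₂) (n + 1)) ?_ ⟨0, zero_mem _⟩ ?_ ?_ hc
    · rintro _ ⟨s, m, hs, rfl⟩
      -- A Lebesgue number for the preimages of `O₁` and `O₂` in the cube. The cube has diameter at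
      -- most `1` in the sup metric, so once `(1/2)^k < δ` every piece of the `k`-th subdivision
      -- lies in one of them.
      obtain ⟨δ, hδ, H⟩ := lebesgue_number_lemma_of_metric (s := (Set.univ : Set (Fin n → 𝕀)))
        (c := fun b : Bool => s.toFun n ⁻¹' (if b then O₁ else O₂)) isCompact_univ
        (by
          rintro (_ | _)
          · exact h₂.preimage hs.1
          · exact h₁.preimage hs.1)
        (fun y _ => by
          rcases hW (hs.2 y) with h | h
          · exact Set.mem_iUnion.2 ⟨true, h⟩
          · exact Set.mem_iUnion.2 ⟨false, h⟩)
      obtain ⟨k, hk⟩ := exists_pow_lt_of_lt_one hδ (show (1 / 2 : ℝ) < 1 by norm_num)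
      refine ⟨k, ?_⟩
      obtain ⟨c, hc, hc'⟩ := sdIter_mk_single k s m
      rw [← hc']
      refine map_reparam_le (mk n) _ (fun t μ φ hφ ht => ?_) hc
      have hφc : Continuous φ := by
        refine (LipschitzWith.of_dist_le_mul (K := 1) fun y z => (hφ y z).trans ?_).continuous
        rw [NNReal.coe_one, one_mul]
        exact div_le_self dist_nonneg (one_le_pow₀ one_le_two)
      have hd : ∀ y, φ y ∈ Metric.ball (φ 0) δ := by
        intro y
        refine Metric.mem_ball.2 (lt_of_le_of_lt (hφ y 0) (lt_of_le_of_lt ?_ hk))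
        rw [one_div, inv_pow, ← one_div]
        refine div_le_div_of_nonneg_right ?_ (by positivity)
        refine (dist_pi_le_iff zero_le_one).2 fun i => ?_
        rw [Subtype.dist_eq]
        exact (Real.dist_le_of_mem_Icc_01 (y i).2 (0 : 𝕀).2)
      obtain ⟨b, hb⟩ := H (φ 0) trivial
      have ht' := hs.reparam hφc ht
      rcases b with _ | _
      · refine AddSubgroup.mem_sup_right (mk_single_mem_sub (A := W ∩ O₂) (Cube.IsIn.mk ht'.1 fun y => ⟨ht'.2 y, ?_⟩) μ)
        rw [ht]
        exact hb (hd y)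
      · refine AddSubgroup.mem_sup_left (mk_single_mem_sub (A := W ∩ O₁) (Cube.IsIn.mk ht'.1 fun y => ⟨ht'.2 y, ?_⟩) μ)
        rw [ht]
        exact hb (hd y)
    · rintro x y - - ⟨k, hk⟩ ⟨l, hl⟩
      refine ⟨k + l, ?_⟩
      rw [map_add]
      exact add_mem (mono l hk) (by rw [add_comm k l]; exact mono k hl)
    · rintro x - ⟨k, hk⟩
      refine ⟨k, ?_⟩
      rw [map_neg]
      exact neg_mem hk

end Ch
end MooreFlat

namespace MooreFlat

open Ch

/-! ### Relative homology and excision -/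

section Relative

variable {X Y : Type u} [TopologicalSpace X] [TopologicalSpace Y]

/-- The vanishing, for all coefficients, of the relative homology of `(B, A)` in degree `i + 1`
(of the complex `Ch`). -/
def RelExact (B A : Set X) (i : ℕ) : Prop :=
  ∀ (M : Type u) [AddCommGroup M] (c : Ch X M (i + 1)), c ∈ sub M B (i + 1) → d i c ∈ sub M A i →
    ∃ b ∈ sub M B (i + 2), c - d (i + 1) b ∈ sub M A (i + 1)

/-- The inclusion of pairs `(B, A) → (B', A')` induces isomorphisms in relative homology. -/
structure QuasiIso (B A B' A' : Set X) : Prop where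
  subset : B ⊆ B'
  subset' : A ⊆ A'
  surj : ∀ (i : ℕ) (M : Type u) [AddCommGroup M] (c : Ch X M (i + 1)), c ∈ sub M B' (i + 1) →
    d i c ∈ sub M A' i → ∃ c₀ ∈ sub M B (i + 1), d i c₀ ∈ sub M A i ∧ ∃ b ∈ sub M B' (i + 2),
      c - c₀ - d (i + 1) b ∈ sub M A' (i + 1)
  inj : ∀ (i : ℕ) (M : Type u) [AddCommGroup M] (c : Ch X M (i + 1)), c ∈ sub M B (i + 1) →
    d i c ∈ sub M A i → ∀ b ∈ sub M B' (i + 2), c - d (i + 1) b ∈ sub M A' (i + 1) →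
      ∃ b' ∈ sub M B (i + 2), c - d (i + 1) b' ∈ sub M A (i + 1)

/-- The prism of the deformation is a homotopy from the identity to a map into `A`, and it preserves
chains in `A`. It moves a relative cycle into `A` up to a boundary. -/
theorem RelExact.of_deformation {B A : Set X} (h : X → 𝕀 → X)
    (hc : ContinuousOn (fun p : X × 𝕀 => h p.1 p.2) (B ×ˢ Set.univ)) (h0 : ∀ x ∈ B, h x 0 = x)
    (h1 : ∀ x ∈ B, h x 1 ∈ A) (hB : ∀ x ∈ B, ∀ t, h x t ∈ B) (hA : ∀ x ∈ A, ∀ t, h x t ∈ A)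
    (hAB : A ⊆ B) (i : ℕ) : RelExact B A i := by
  intro M _ c hcB hdc
  have hcA : ContinuousOn (fun p : X × 𝕀 => h p.1 p.2) (A ×ˢ Set.univ) :=
    hc.mono (Set.prod_mono hAB le_rfl)
  have key := d_prism h i c
  have e0 : push₁ (fun x => h x 0) (i + 1) c = c := by
    rw [push_congr_sub (g := fun x => x) (fun x hx => h0 x hx) _ hcB, push_id]
  refine ⟨-prism h (i + 1) c, neg_mem (prism_mem_sub hc hB hcB), ?_⟩
  have : c - d (i + 1) (-prism h (i + 1) c) = push₁ (fun x => h x 1) (i + 1) c - prism h i (d i c) := by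
    rw [map_neg, sub_neg_eq_add, eq_sub_iff_add_eq, add_assoc, key, e0, add_sub_cancel]
  rw [this]
  refine sub_mem (push_mem_sub ?_ (fun x hx => h1 x hx) _ hcB) (prism_mem_sub hcA hA hdc)
  exact hc.comp (f := fun x => (x, (1 : 𝕀))) (by fun_prop) fun x hx => ⟨hx, trivial⟩

theorem RelExact.refl (A : Set X) (i : ℕ) : RelExact A A i := fun _ _ c hc _ =>
  ⟨0, zero_mem _, by rwa [map_zero, sub_zero]⟩

/-- This and the next result are the parts of the long exact sequence of a triple that are needed:
enlarging either member of a pair by something relatively acyclic does not change the homology. -/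
theorem QuasiIso.of_relExact_right {B A A' : Set X} (hA : A ⊆ A') (hB : A' ⊆ B)
    (h : ∀ i, RelExact A' A i) : QuasiIso B A B A' where
  subset := le_rfl
  subset' := hA
  surj := by
    intro i M _ c hc hdc
    cases i with
    | zero => exact ⟨c, hc, mem_sub_zero _, 0, zero_mem _, by simp⟩
    | succ i =>
      obtain ⟨b, hb, hba⟩ := h i M (d (i + 1) c) hdc (by rw [d_d]; exact zero_mem _)
      refine ⟨c - b, sub_mem hc (sub_mono hB hb), by rwa [map_sub], 0, zero_mem _, ?_⟩
      rwa [sub_sub_cancel, map_zero, sub_zero]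
  inj := by
    intro i M _ c hc hdc b hb hcb
    obtain ⟨b', hb', hba⟩ := h i M (c - d (i + 1) b) hcb (by rwa [map_sub, d_d, sub_zero])
    exact ⟨b + b', add_mem hb (sub_mono hB hb'), by rwa [map_add, ← sub_sub]⟩

theorem QuasiIso.of_relExact_left {B A B' : Set X} (hA : A ⊆ B) (hB : B ⊆ B')
    (h : ∀ i, RelExact B' B i) : QuasiIso B A B' A where
  subset := hB
  subset' := le_rfl
  surj := by
    intro i M _ c hc hdc
    obtain ⟨b, hb, hba⟩ := h i M c hc (sub_mono hA hdc)
    refine ⟨c - d (i + 1) b, hba, by rwa [map_sub, d_d, sub_zero], b, hb, ?_⟩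
    rw [sub_sub_cancel, sub_self]
    exact zero_mem _
  inj := by
    intro i M _ c hc hdc b hb hcb
    have hdb : d (i + 1) b ∈ sub M B (i + 1) := by
      rw [← sub_sub_cancel c (d (i + 1) b)]
      exact sub_mem hc (sub_mono hA hcb)
    obtain ⟨x, hx, hbx⟩ := h (i + 1) M b hb hdb
    exact ⟨_, hbx, by rwa [map_sub, d_d, sub_zero]⟩

/-- Subdivision replaces a chain by a sum of a chain in `O₁`, negligible modulo `W ∩ O₁`, and a
chain in `O₂`; the homotopy with the identity accounts for the change. Cycles are treated so for
surjectivity, and bounding chains for injectivity. -/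
theorem QuasiIso.excision {W O₁ O₂ : Set X} (h₁ : IsOpen O₁) (h₂ : IsOpen O₂) (hW : W ⊆ O₁ ∪ O₂) :
    QuasiIso (W ∩ O₂) ((W ∩ O₁) ∩ (W ∩ O₂)) W (W ∩ O₁) where
  subset := Set.inter_subset_left
  subset' := Set.inter_subset_left
  surj := by
    intro i M _ c hc hdc
    obtain ⟨k, hk⟩ := exists_sdIter_mem h₁ h₂ hW hc
    obtain ⟨a, ha, b, hb, hab⟩ := AddSubgroup.mem_sup.1 hk
    have hdb : d i b = sdIter i k (d i c) - d i a := by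
      rw [← d_sdIter, ← hab, map_add, add_sub_cancel_left]
    refine ⟨b, hb, mem_sub_inter ?_ (d_mem_sub hb), -sdIterHomotopy (i + 1) k c,
      neg_mem (sdIterHomotopy_mem_sub k hc), ?_⟩
    · rw [hdb]
      exact sub_mem (sdIter_mem_sub k hdc) (d_mem_sub ha)
    · have h := d_sdIterHomotopy i k c
      rw [← hab] at h
      have : c - b - d (i + 1) (-sdIterHomotopy (i + 1) k c) = a - sdIterHomotopy i k (d i c) := by
        rw [map_neg, eq_sub_of_add_eq h]
        abel
      rw [this]
      exact sub_mem ha (sdIterHomotopy_mem_sub k hdc)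
  inj := by
    intro i M _ c hc hdc b hb hcb
    obtain ⟨k, hk⟩ := exists_sdIter_mem h₁ h₂ hW hb
    obtain ⟨a, ha, b', hb', hab⟩ := AddSubgroup.mem_sup.1 hk
    have h := d_sdIterHomotopy i k c
    have e : sdIter (i + 1) k c - d (i + 1) b' =
        d (i + 1) a + sdIter (i + 1) k (c - d (i + 1) b) := by
      rw [map_sub, ← d_sdIter, ← hab, map_add]
      abel
    refine ⟨b' - sdIterHomotopy (i + 1) k c, sub_mem hb' (sdIterHomotopy_mem_sub k hc), ?_⟩
    have : c - d (i + 1) (b' - sdIterHomotopy (i + 1) k c) =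
        (sdIter (i + 1) k c - d (i + 1) b') - sdIterHomotopy i k (d i c) := by
      rw [map_sub, eq_sub_of_add_eq h]
      abel
    rw [this]
    refine sub_mem (mem_sub_inter ?_ ?_) (sdIterHomotopy_mem_sub k hdc)
    · rw [e]
      exact add_mem (d_mem_sub ha) (sdIter_mem_sub k hcb)
    · exact sub_mem (sdIter_mem_sub k hc) (d_mem_sub hb')

/-! ### Integral chains -/

/-- The homomorphism from the integers given by an element. -/
def coef {M : Type u} [AddCommGroup M] (m : M) : ULift.{u} ℤ →+ M where
  toFun z := z.down • m
  map_zero' := zero_smul ℤ m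
  map_add' a b := add_smul a.down b.down m

theorem coef_add {M : Type u} [AddCommGroup M] (m m' : M) : coef (m + m') = coef m + coef m' := by
  ext z
  exact smul_add _ _ _

theorem comp_coef {M N : Type u} [AddCommGroup M] [AddCommGroup N] (α : M →+ N) (m : M) :
    α.comp (coef m) = coef (α m) := by
  ext z
  exact map_zsmul α _ _

/-- The change of coefficients of an integral chain. -/
noncomputable def tens {X : Type u} {n : ℕ} (c : Ch X (ULift.{u} ℤ) n) (M : Type u)
    [AddCommGroup M] : M →+ Ch X M n where
  toFun m := push (fun x => x) (coef m) n c
  map_zero' := by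
    have : coef (0 : M) = 0 := by ext z; exact smul_zero _
    have h := push_add (fun x : X => x) (coef (0 : M)) (coef 0) n c
    rw [← coef_add, add_zero] at h
    exact left_eq_add.1 h
  map_add' m m' := by rw [coef_add, push_add]

variable {M N : Type u} [AddCommGroup M] [AddCommGroup N]

theorem tens_apply {X : Type u} {n : ℕ} (c : Ch X (ULift.{u} ℤ) n) (m : M) :
    tens c M m = push (fun x => x) (coef m) n c := rfl

theorem tens_sub {X : Type u} {n : ℕ} (c c' : Ch X (ULift.{u} ℤ) n) :
    tens (c - c') M = tens c M - tens c' M := by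
  ext m
  exact map_sub (push (fun x : X => x) (coef m) n) c c'

theorem d_tens {X : Type u} {n : ℕ} (c : Ch X (ULift.{u} ℤ) (n + 1)) (m : M) :
    d n (tens c M m) = tens (d n c) M m := d_push _ _ _ _

theorem push_tens {X Y : Type u} (f : X → Y) (α : M →+ N) {n : ℕ} (c : Ch X (ULift.{u} ℤ) n) (m : M) :
    push f α n (tens c M m) = tens (push₁ f n c) N (α m) := by
  rw [tens_apply, tens_apply, push_push, push_push, comp_coef]
  rfl

theorem tens_mem_sub {A : Set X} {n : ℕ} {c : Ch X (ULift.{u} ℤ) n} (hc : c ∈ sub _ A n) (m : M) :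
    tens c M m ∈ sub M A n :=
  push_mem_sub continuousOn_id (fun _ h => h) _ hc

/-- The chains `∑ j, u j ⊗ w j` for a family `u` of integral chains. -/
noncomputable def comb {X : Type u} {J : Type u} {n : ℕ} (u : J → Ch X (ULift.{u} ℤ) n) (M : Type u)
    [AddCommGroup M] : (J →₀ M) →+ Ch X M n :=
  Finsupp.liftAddHom fun j => tens (u j) M

@[simp] theorem comb_single {X : Type u} {J : Type u} {n : ℕ} (u : J → Ch X (ULift.{u} ℤ) n) (j : J)
    (m : M) : comb u M (Finsupp.single j m) = tens (u j) M m := by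
  simp [comb]

theorem comb_mem {J : Type u} {A : Set X} {n : ℕ} {u : J → Ch X (ULift.{u} ℤ) n}
    (hu : ∀ j, u j ∈ sub _ A n) (w : J →₀ M) : comb u M w ∈ sub M A n := by
  induction w using Finsupp.induction_linear with
  | zero => rw [map_zero]; exact zero_mem _
  | add v w hv hw => rw [map_add]; exact add_mem hv hw
  | single j m => rw [comb_single]; exact tens_mem_sub (hu j) m

theorem d_comb {X : Type u} {J : Type u} {n : ℕ} (u : J → Ch X (ULift.{u} ℤ) (n + 1)) (w : J →₀ M) :
    d n (comb u M w) = comb (fun j => d n (u j)) M w := by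
  induction w using Finsupp.induction_linear with
  | zero => simp only [map_zero]
  | add v w hv hw => simp only [map_add, hv, hw]
  | single j m => rw [comb_single, comb_single, d_tens]

theorem push_comb {X Y : Type u} {J : Type u} (f : X → Y) {n : ℕ} (u : J → Ch X (ULift.{u} ℤ) n)
    (w : J →₀ M) : push₁ f n (comb u M w) = comb (fun j => push₁ f n (u j)) M w := by
  induction w using Finsupp.induction_linear with
  | zero => simp only [map_zero]
  | add v w hv hw => simp only [map_add, hv, hw]
  | single j m => rw [comb_single, comb_single, push_tens]; rfl

theorem comb_sub {X : Type u} {J : Type u} {n : ℕ} (u v : J → Ch X (ULift.{u} ℤ) n) (w : J →₀ M) :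
    comb (fun j => u j - v j) M w = comb u M w - comb v M w := by
  induction w using Finsupp.induction_linear with
  | zero => simp only [map_zero, sub_zero]
  | add v w hv hw => simp only [map_add, hv, hw]; abel
  | single j m => simp only [comb_single, tens_sub, AddMonoidHom.sub_apply]

/-! ### Pairs with homology in a single degree -/

/-- The homology of the pair `(B, A)` is concentrated in degree `p + 1` (of the complex `Ch`), where
it is free on the classes of the integral chains `u j`, for all coefficients. -/
structure CellPair {J : Type u} (p : ℕ) (u : J → Ch X (ULift.{u} ℤ) (p + 1)) (B A : Set X) : Prop where
  mem : ∀ j, u j ∈ sub _ B (p + 1)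
  d_mem : ∀ j, d p (u j) ∈ sub _ A p
  exact : ∀ i, i ≠ p → RelExact B A i
  gen : ∀ (M : Type u) [AddCommGroup M] (c : Ch X M (p + 1)), c ∈ sub M B (p + 1) →
    d p c ∈ sub M A p → ∃ w : J →₀ M, ∃ b ∈ sub M B (p + 2),
      c - comb u M w - d (p + 1) b ∈ sub M A (p + 1)
  inj : ∀ (M : Type u) [AddCommGroup M] (w : J →₀ M), ∀ b ∈ sub M B (p + 2),
    comb u M w - d (p + 1) b ∈ sub M A (p + 1) → w = 0

variable {J : Type u} {p : ℕ} {u : J → Ch X (ULift.{u} ℤ) (p + 1)} {B A B' A' : Set X}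

theorem CellPair.comb_mem (h : CellPair p u B A) (w : J →₀ M) : comb u M w ∈ sub M B (p + 1) :=
  MooreFlat.comb_mem h.mem w

theorem CellPair.d_comb_mem (h : CellPair p u B A) (w : J →₀ M) :
    d p (comb u M w) ∈ sub M A p := by
  rw [d_comb]
  exact MooreFlat.comb_mem h.d_mem w

theorem CellPair.of_quasiIso (h : CellPair p u B A) (q : QuasiIso B A B' A') : CellPair p u B' A' where
  mem j := sub_mono q.subset (h.mem j)
  d_mem j := sub_mono q.subset' (h.d_mem j)
  exact := by
    intro i hi M _ c hc hdc
    obtain ⟨c₀, hc₀, hdc₀, b, hb, hcb⟩ := q.surj i M c hc hdc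
    obtain ⟨b₀, hb₀, ha⟩ := h.exact i hi M c₀ hc₀ hdc₀
    refine ⟨b + b₀, add_mem hb (sub_mono q.subset hb₀), ?_⟩
    have : c - d (i + 1) (b + b₀) = (c - c₀ - d (i + 1) b) + (c₀ - d (i + 1) b₀) := by
      rw [map_add]; abel
    rw [this]
    exact add_mem hcb (sub_mono q.subset' ha)
  gen := by
    intro M _ c hc hdc
    obtain ⟨c₀, hc₀, hdc₀, b, hb, hcb⟩ := q.surj p M c hc hdc
    obtain ⟨w, b₀, hb₀, ha⟩ := h.gen M c₀ hc₀ hdc₀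
    refine ⟨w, b + b₀, add_mem hb (sub_mono q.subset hb₀), ?_⟩
    have : c - comb u M w - d (p + 1) (b + b₀) =
        (c - c₀ - d (p + 1) b) + (c₀ - comb u M w - d (p + 1) b₀) := by
      rw [map_add]; abel
    rw [this]
    exact add_mem hcb (sub_mono q.subset' ha)
  inj := by
    intro M _ w b hb hw
    obtain ⟨b', hb', hw'⟩ := q.inj p M _ (h.comb_mem w) (h.d_comb_mem w) b hb hw
    exact h.inj M w b' hb' hw'

/-- Passing back to the smaller pair, the generators may be prescribed: any relative cycles
homologous to the given ones in the larger pair will do. As the homologies are integral, `comb`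
carries them to all coefficients. -/
theorem CellPair.of_quasiIso_of_homologous {u' : J → Ch X (ULift.{u} ℤ) (p + 1)}
    (h : CellPair p u' B' A') (q : QuasiIso B A B' A') (hu : ∀ j, u j ∈ sub _ B (p + 1))
    (hdu : ∀ j, d p (u j) ∈ sub _ A p)
    (huu : ∀ j, ∃ b ∈ sub _ B' (p + 2), u' j - u j - d (p + 1) b ∈ sub _ A' (p + 1)) :
    CellPair p u B A := by
  choose b hb ha using huu
  have key : ∀ {M : Type u} [AddCommGroup M] (w : J →₀ M),
      comb u' M w - comb u M w - d (p + 1) (comb b M w) ∈ sub M A' (p + 1) := by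
    intro M _ w
    rw [d_comb, ← comb_sub, ← comb_sub]
    exact MooreFlat.comb_mem ha w
  refine ⟨hu, hdu, ?_, ?_, ?_⟩
  · intro i hi M _ c hc hdc
    obtain ⟨b, hb, hcb⟩ := h.exact i hi M c (sub_mono q.subset hc) (sub_mono q.subset' hdc)
    exact q.inj i M c hc hdc b hb hcb
  · intro M _ c hc hdc
    obtain ⟨w, b₁, hb₁, hcb⟩ := h.gen M c (sub_mono q.subset hc) (sub_mono q.subset' hdc)
    refine ⟨w, q.inj p M (c - comb u M w) (sub_mem hc (MooreFlat.comb_mem hu w)) ?_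
      (b₁ + comb b M w) (add_mem hb₁ (MooreFlat.comb_mem hb w)) ?_⟩
    · rw [map_sub, d_comb]
      exact sub_mem hdc (MooreFlat.comb_mem hdu w)
    · have : c - comb u M w - d (p + 1) (b₁ + comb b M w) = (c - comb u' M w - d (p + 1) b₁) +
          (comb u' M w - comb u M w - d (p + 1) (comb b M w)) := by
        rw [map_add]; abel
      rw [this]
      exact add_mem hcb (key w)
  · intro M _ w b₁ hb₁ hw
    refine h.inj M w (b₁ + comb b M w) (add_mem (sub_mono q.subset hb₁) (MooreFlat.comb_mem hb w)) ?_
    have : comb u' M w - d (p + 1) (b₁ + comb b M w) = (comb u M w - d (p + 1) b₁) +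
        (comb u' M w - comb u M w - d (p + 1) (comb b M w)) := by
      rw [map_add]; abel
    rw [this]
    exact add_mem (sub_mono q.subset' hw) (key w)

theorem CellPair.exists_of_quasiIso {u' : J → Ch X (ULift.{u} ℤ) (p + 1)}
    (h : CellPair p u' B' A') (q : QuasiIso B A B' A') :
    ∃ u : J → Ch X (ULift.{u} ℤ) (p + 1), CellPair p u B A := by
  choose u hu hdu huu using fun j => q.surj p _ (u' j) (h.mem j) (h.d_mem j)
  exact ⟨u, h.of_quasiIso_of_homologous q hu hdu huu⟩

/-- The boundary map of the triple `(T, B, A)` is an isomorphism, because `(T, A)` is acyclic. The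
new generators are chains in `T` whose boundaries are the old ones modulo `A`. -/
theorem CellPair.shift {T : Set X} (h : CellPair p u B A) (hAB : A ⊆ B) (hBT : B ⊆ T)
    (hT : ∀ i, RelExact T A i) : ∃ u' : J → Ch X (ULift.{u} ℤ) (p + 2), CellPair (p + 1) u' T B := by
  choose u' hu' ha using fun j => hT p _ (u j) (sub_mono hBT (h.mem j)) (h.d_mem j)
  have key : ∀ {M : Type u} [AddCommGroup M] (w : J →₀ M),
      comb u M w - d (p + 1) (comb u' M w) ∈ sub M A (p + 1) := by
    intro M _ w
    rw [d_comb, ← comb_sub]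
    exact MooreFlat.comb_mem ha w
  refine ⟨u', hu', fun j => ?_, ?_, ?_, ?_⟩
  · rw [← sub_sub_cancel (u j) (d (p + 1) (u' j))]
    exact sub_mem (h.mem j) (sub_mono hAB (ha j))
  · intro i hi M _ c hc hdc
    cases i with
    | zero =>
      obtain ⟨b, hb, hcb⟩ := hT 0 M c hc (mem_sub_zero _)
      exact ⟨b, hb, sub_mono hAB hcb⟩
    | succ i =>
      obtain ⟨b, hb, hcb⟩ := h.exact i (by omega) M _ hdc (by rw [d_d]; exact zero_mem _)
      obtain ⟨x, hx, hcx⟩ := hT (i + 1) M (c - b) (sub_mem hc (sub_mono hBT hb)) (by rwa [map_sub])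
      refine ⟨x, hx, ?_⟩
      rw [← sub_add_cancel (c - d (i + 1 + 1) x) b, sub_right_comm]
      exact add_mem (sub_mono hAB hcx) hb
  · intro M _ c hc hdc
    obtain ⟨w, b, hb, hcb⟩ := h.gen M _ hdc (by rw [d_d]; exact zero_mem _)
    have hk := key (M := M) w
    obtain ⟨x, hx, hcx⟩ := hT (p + 1) M (c - comb u' M w - b)
      (sub_mem (sub_mem hc (MooreFlat.comb_mem hu' w)) (sub_mono hBT hb)) (by
        have : d (p + 1) (c - comb u' M w - b) = (d (p + 1) c - comb u M w - d (p + 1) b) +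
            (comb u M w - d (p + 1) (comb u' M w)) := by
          rw [map_sub, map_sub]; abel
        rw [this]
        exact add_mem hcb hk)
    refine ⟨w, x, hx, ?_⟩
    rw [← sub_add_cancel (c - comb u' M w - d (p + 1 + 1) x) b, sub_right_comm]
    exact add_mem (sub_mono hAB hcx) hb
  · intro M _ w b hb hw
    refine h.inj M w _ hw ?_
    rw [map_sub, d_d, sub_zero]
    exact key w

/-- Transport of `CellPair` along a homeomorphism of pairs. -/
theorem CellPair.map {B₂ A₂ : Set Y} (h : CellPair p u B A) (f : X → Y) (g : Y → X)
    (hAB : A ⊆ B) (hAB₂ : A₂ ⊆ B₂)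
    (hf : ContinuousOn f B) (hg : ContinuousOn g B₂) (hfB : Set.MapsTo f B B₂)
    (hfA : Set.MapsTo f A A₂) (hgB : Set.MapsTo g B₂ B) (hgA : Set.MapsTo g A₂ A)
    (hgf : ∀ x ∈ B, g (f x) = x) (hfg : ∀ y ∈ B₂, f (g y) = y) :
    CellPair p (fun j => push₁ f (p + 1) (u j)) B₂ A₂ := by
  have hf' := hf.mono hAB
  have hg' := hg.mono hAB₂
  have e1 : ∀ {M : Type u} [AddCommGroup M] {n : ℕ} {c : Ch Y M n}, c ∈ sub M B₂ n →
      push₁ f n (push₁ g n c) = c := by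
    intro M _ n c hc
    rw [push_push, push_congr_sub (g := fun y => y) (fun y hy => hfg y hy) _ hc]
    exact push_id n c
  have e2 : ∀ {M : Type u} [AddCommGroup M] {n : ℕ} {c : Ch X M n}, c ∈ sub M B n →
      push₁ g n (push₁ f n c) = c := by
    intro M _ n c hc
    rw [push_push, push_congr_sub (g := fun y => y) (fun y hy => hgf y hy) _ hc]
    exact push_id n c
  refine ⟨fun j => push_mem_sub hf hfB _ (h.mem j), fun j => ?_, ?_, ?_, ?_⟩
  · rw [d_push]
    exact push_mem_sub hf' hfA _ (h.d_mem j)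
  · intro i hi M _ c hc hdc
    obtain ⟨b, hb, hcb⟩ := h.exact i hi M (push₁ g _ c) (push_mem_sub hg hgB _ hc)
      (by rw [d_push]; exact push_mem_sub hg' hgA _ hdc)
    refine ⟨push₁ f _ b, push_mem_sub hf hfB _ hb, ?_⟩
    rw [d_push, ← e1 hc, ← map_sub]
    exact push_mem_sub hf' hfA _ hcb
  · intro M _ c hc hdc
    obtain ⟨w, b, hb, hcb⟩ := h.gen M (push₁ g _ c) (push_mem_sub hg hgB _ hc)
      (by rw [d_push]; exact push_mem_sub hg' hgA _ hdc)
    refine ⟨w, push₁ f _ b, push_mem_sub hf hfB _ hb, ?_⟩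
    rw [d_push, ← push_comb, ← e1 hc, ← map_sub, ← map_sub]
    exact push_mem_sub hf' hfA _ hcb
  · intro M _ w b hb hw
    refine h.inj M w (push₁ g _ b) (push_mem_sub hg hgB _ hb) ?_
    rw [← push_comb] at hw
    rw [d_push, ← e2 (h.comb_mem w), ← map_sub]
    exact push_mem_sub hg' hgA _ hw

end Relative
end MooreFlat

namespace MooreFlat

open Ch

/-! ### The homology of Euclidean space relative to the complement of the origin -/

section Euclidean

/-- On a one-point space the constant map is the identity, so cubes of positive dimension are
degenerate and only multiples of the point survive. The point is a cycle relative to the empty set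
since the coefficients count as lying there. -/
theorem cellPair_of_subsingleton {X : Type u} [TopologicalSpace X] [Subsingleton X] (x : X) :
    CellPair 0 (fun _ : PUnit.{u + 1} =>
      Ch.mk 0 (Finsupp.single (Cube.point x) (ULift.up.{u} (1 : ℤ)))) Set.univ ∅ := by
  have hid : ∀ {M : Type u} [AddCommGroup M] (n : ℕ) (c : Ch X M n),
      push₁ (fun _ : X => x) n c = c := by
    intro M _ n c
    have : (fun _ : X => x) = fun y => y := funext fun y => Subsingleton.elim _ _
    rw [this, push_id]
  have hcomb : ∀ {M : Type u} [AddCommGroup M] (w : PUnit.{u + 1} →₀ M), comb (fun _ : PUnit.{u + 1} =>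
      Ch.mk 0 (Finsupp.single (Cube.point x) (ULift.up.{u} (1 : ℤ)))) M w =
      Ch.mk 0 (Finsupp.single (Cube.point x) (w PUnit.unit)) := by
    intro M _ w
    have hw : w = Finsupp.single PUnit.unit (w PUnit.unit) := by
      ext
      simp
    rw [hw, comb_single, tens_apply, push_mk, CubeChain.push_single, Finsupp.single_eq_same]
    congr 2
    exact one_smul ℤ _
  refine ⟨fun _ => mk_single_mem_sub (Cube.IsIn.mk ?_ fun y => Set.mem_univ _) _, fun _ => mem_sub_zero _, ?_, ?_, ?_⟩
  · exact continuous_of_const fun _ _ => Subsingleton.elim _ _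
  · intro i hi M _ c hc hdc
    obtain ⟨i, rfl⟩ := Nat.exists_eq_succ_of_ne_zero hi
    refine ⟨0, zero_mem _, ?_⟩
    rw [map_zero, sub_zero, ← hid _ c, push_cst_succ]
    exact zero_mem _
  · intro M _ c hc hdc
    obtain ⟨m, hm⟩ : ∃ m : M, c = Ch.mk 0 (Finsupp.single (Cube.point x) m) :=
      ⟨d 0 c, (hid 1 c).symm.trans (push_cst_one x _ c)⟩
    refine ⟨Finsupp.single PUnit.unit m, 0, zero_mem _, ?_⟩
    rw [map_zero, sub_zero, hcomb, Finsupp.single_eq_same, hm, sub_self]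
    exact zero_mem _
  · intro M _ w b hb hw
    have h := sub_eq_zero.1 (sub_empty hw)
    have h' := congrArg (d 0) h
    rw [d_d, hcomb, d_zero_mk, aug_single] at h'
    ext
    exact h'

/-- The Euclidean space, lifted to a universe. -/
abbrev Euc (p : ℕ) : Type u := ULift.{u} (Fin p → ℝ)

/-- The point of `Euc (p + 1)` with given first and other coordinates. -/
def Euc.cons {p : ℕ} (t : ℝ) (x : Fin p → ℝ) : Euc.{u} (p + 1) := ⟨Fin.cons t x⟩

theorem Euc.continuous_cons {p : ℕ} {Z : Type*} [TopologicalSpace Z] {f : Z → ℝ} {g : Z → Fin p → ℝ}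
    (hf : Continuous f) (hg : Continuous g) : Continuous fun z => Euc.cons.{u} (f z) (g z) :=
  continuous_uliftUp.comp (hf.finCons hg)

/-- The coordinates other than the first. -/
def Euc.tail {p : ℕ} (y : Euc.{u} (p + 1)) : Fin p → ℝ := Fin.tail y.down

theorem Euc.continuous_tail {p : ℕ} : Continuous (Euc.tail.{u} (p := p)) :=
  continuous_pi fun i => (continuous_apply (A := fun _ : Fin (p + 1) => ℝ) i.succ).comp
    continuous_uliftDown

/-- The first coordinate. -/
def Euc.head {p : ℕ} (y : Euc.{u} (p + 1)) : ℝ := y.down 0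

theorem Euc.continuous_head {p : ℕ} : Continuous (Euc.head.{u} (p := p)) :=
  (continuous_apply (A := fun _ : Fin (p + 1) => ℝ) 0).comp continuous_uliftDown

theorem Euc.cons_head_tail {p : ℕ} (y : Euc.{u} (p + 1)) : Euc.cons y.head y.tail = y :=
  ULift.ext _ _ (Fin.cons_self_tail y.down)

@[simp] theorem Euc.head_cons {p : ℕ} (t : ℝ) (x : Fin p → ℝ) : (Euc.cons.{u} t x).head = t := rfl

@[simp] theorem Euc.tail_cons {p : ℕ} (t : ℝ) (x : Fin p → ℝ) : (Euc.cons.{u} t x).tail = x := rfl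

theorem Euc.eq_zero_iff {p : ℕ} (y : Euc.{u} (p + 1)) : y = 0 ↔ y.tail = 0 ∧ y.head = 0 := by
  constructor
  · rintro rfl
    exact ⟨rfl, rfl⟩
  · rintro ⟨h1, h2⟩
    rw [← y.cons_head_tail, h1, h2]
    refine ULift.ext _ _ (funext fun i => ?_)
    refine Fin.cases rfl (fun i => rfl) i

/-- Induction on `p`. In `ℝ^(p+1)`, removing one of the two closed half axes gives `A` and `B`, with
`A ∪ B` the complement of the origin and `A ∩ B` that of the axis. Sliding along the axis deforms
`(B, A ∩ B)` onto the hyperplane `head = -1` and its punctured version, a copy of the pair for `p`.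
Excision passes to `(A ∪ B, A)`; as the whole space slides into `A`, `CellPair.shift` raises the
degree. -/
theorem exists_cellPair_euc (p : ℕ) :
    ∃ u : PUnit.{u + 1} → Ch (Euc.{u} p) (ULift.{u} ℤ) (p + 1), CellPair p u Set.univ {0}ᶜ := by
  induction p with
  | zero =>
    rw [show ({0}ᶜ : Set (Euc.{u} 0)) = ∅ by
      ext x
      simpa using Subsingleton.elim x 0]
    exact ⟨_, cellPair_of_subsingleton 0⟩
  | succ p ih =>
    obtain ⟨u, hu⟩ := ih
    set A : Set (Euc.{u} (p + 1)) := {y | y.tail ≠ 0 ∨ 0 < y.head} with hA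
    set B : Set (Euc.{u} (p + 1)) := {y | y.tail ≠ 0 ∨ y.head < 0} with hB
    set L : Set (Euc.{u} (p + 1)) := {y | y.head = -1} with hL
    set L' : Set (Euc.{u} (p + 1)) := {y | y.head = -1 ∧ y.tail ≠ 0} with hL'
    have hAo : IsOpen A := (isOpen_ne.preimage Euc.continuous_tail).union
      (isOpen_Ioi.preimage Euc.continuous_head)
    have hBo : IsOpen B := (isOpen_ne.preimage Euc.continuous_tail).union
      (isOpen_Iio.preimage Euc.continuous_head)
    have hAB : A ∪ B = {0}ᶜ := by
      ext y
      simp only [hA, hB, Set.mem_union, Set.mem_ofPred_eq, Set.mem_compl_iff, Set.mem_singleton_iff,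
        Euc.eq_zero_iff, not_and_or]
      rw [← ne_eq y.head 0, ne_iff_lt_or_gt (a := y.head)]
      tauto
    have h1 := hu.map (B₂ := L) (A₂ := L') (fun x => Euc.cons (-1) x.down) (fun y => ⟨y.tail⟩)
      (Set.subset_univ _) (fun y hy => hy.1)
      (Euc.continuous_cons continuous_const continuous_uliftDown).continuousOn
      (continuous_uliftUp.comp Euc.continuous_tail).continuousOn (fun x _ => rfl)
      (fun x hx => ⟨rfl, fun h => hx (ULift.ext _ _ h)⟩) (fun y _ => trivial)
      (fun y hy h => hy.2 (congrArg ULift.down h)) (fun x _ => rfl)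
      (fun y hy => by
        rw [← Euc.cons_head_tail y, show y.head = -1 from hy]
        rfl)
    let k : Euc.{u} (p + 1) → 𝕀 → Euc.{u} (p + 1) := fun y s =>
      Euc.cons ((1 - s) * y.head - s) y.tail
    have hk : Continuous fun q : Euc.{u} (p + 1) × 𝕀 => k q.1 q.2 := by
      refine Euc.continuous_cons ?_ (Euc.continuous_tail.comp continuous_fst)
      have := (Euc.continuous_head (p := p)).comp (continuous_fst (Y := 𝕀))
      have h2 : Continuous fun q : Euc.{u} (p + 1) × 𝕀 => (q.2 : ℝ) := by fun_prop
      exact ((continuous_const.sub h2).mul this).sub h2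
    have hk0 : ∀ y, k y 0 = y := fun y => by
      simp only [k, Set.Icc.coe_zero, sub_zero, one_mul, Euc.cons_head_tail]
    have hk1 : ∀ y, (k y 1).head = -1 := fun y => by simp [k]
    have hkneg : ∀ y s, y.head < 0 → (k y s).head < 0 := by
      intro y s hy
      simp only [k, Euc.head_cons]
      rcases eq_or_lt_of_le s.2.1 with h | h
      · rw [← h]; linarith
      · nlinarith [s.2.2]
    have hkL : ∀ y ∈ L, ∀ s, (k y s).head = -1 := by
      intro y hy s
      simp only [k, Euc.head_cons, show y.head = -1 from hy]
      ring
    have hBt : ∀ y ∈ B, ∀ s, k y s ∈ B := by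
      rintro y (hy | hy) s
      · exact Or.inl hy
      · exact Or.inr (hkneg y s hy)
    have hABt : A ∩ B = {y | y.tail ≠ 0} := by
      ext y
      constructor
      · rintro ⟨h | h, h' | h'⟩
        · exact h
        · exact h
        · exact h'
        · exact absurd h (not_lt.2 h'.le)
      · exact fun h => ⟨Or.inl h, Or.inl h⟩
    have hLB : L ⊆ B := fun y hy => Or.inr (by rw [show y.head = -1 from hy]; norm_num)
    have e1 : ∀ i, RelExact B L i := RelExact.of_deformation k hk.continuousOn (fun y _ => hk0 y)
      (fun y _ => hk1 y) hBt hkL hLB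
    have e2 : ∀ i, RelExact (A ∩ B) L' i := by
      rw [hABt]
      exact RelExact.of_deformation k hk.continuousOn (fun y _ => hk0 y)
        (fun y hy => ⟨hk1 y, hy⟩) (fun y hy s => hy) (fun y hy s => ⟨hkL y hy.1 s, hy.2⟩)
        fun y hy => hy.2
    have h2 := h1.of_quasiIso (QuasiIso.of_relExact_left (fun y hy => hy.1) hLB e1)
    have h3 := h2.of_quasiIso (QuasiIso.of_relExact_right
      (by rw [hABt]; exact fun y hy => hy.2) Set.inter_subset_right e2)
    have q := QuasiIso.excision (W := A ∪ B) hAo hBo le_rfl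
    rw [Set.inter_eq_right.2 Set.subset_union_left, Set.inter_eq_right.2 Set.subset_union_right] at q
    have h4 := h3.of_quasiIso q
    -- Adding `|head| + 1` makes the head positive at time `1`; the head never decreases, so `A` is
    -- preserved along the way.
    let l : Euc.{u} (p + 1) → 𝕀 → Euc.{u} (p + 1) := fun y s =>
      Euc.cons (y.head + s * (|y.head| + 1)) y.tail
    have hl : Continuous fun q : Euc.{u} (p + 1) × 𝕀 => l q.1 q.2 := by
      refine Euc.continuous_cons ?_ (Euc.continuous_tail.comp continuous_fst)
      have := (Euc.continuous_head (p := p)).comp (continuous_fst (Y := 𝕀))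
      have h2 : Continuous fun q : Euc.{u} (p + 1) × 𝕀 => (q.2 : ℝ) := by fun_prop
      exact this.add (h2.mul (this.abs.add continuous_const))
    have e3 : ∀ i, RelExact Set.univ A i := by
      refine RelExact.of_deformation l hl.continuousOn (fun y _ => ?_) (fun y _ => Or.inr ?_)
        (fun _ _ _ => trivial) (fun y hy s => ?_) (Set.subset_univ _)
      · simp only [l, Set.Icc.coe_zero, zero_mul, add_zero, Euc.cons_head_tail]
      · simp only [l, Set.Icc.coe_one, one_mul, Euc.head_cons]
        linarith [neg_abs_le y.head]
      · rcases hy with hy | hy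
        · exact Or.inl hy
        · refine Or.inr ?_
          simp only [l, Euc.head_cons]
          have : 0 ≤ (s : ℝ) * (|y.head| + 1) := mul_nonneg s.2.1 (by positivity)
          linarith
    rw [← hAB]
    exact h4.shift Set.subset_union_left (Set.subset_univ _) e3

theorem exists_cellPair_ball (p : ℕ) :
    ∃ u : PUnit.{u + 1} → Ch (Euc.{u} p) (ULift.{u} ℤ) (p + 1),
      CellPair p u (ULift.down ⁻¹' Metric.ball 0 1) ({0}ᶜ ∩ ULift.down ⁻¹' Metric.ball 0 1) := by
  obtain ⟨u, hu⟩ := exists_cellPair_euc.{u} p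
  have q := QuasiIso.excision (W := (Set.univ : Set (Euc.{u} p))) (O₁ := {0}ᶜ)
    (O₂ := ULift.down ⁻¹' Metric.ball 0 1) isOpen_compl_singleton
    (Metric.isOpen_ball.preimage continuous_uliftDown) (fun x _ => by
      by_cases hx : x = 0
      · right
        rw [hx]
        exact Metric.mem_ball_self one_pos
      · exact Or.inl hx)
  rw [Set.univ_inter, Set.univ_inter] at q
  exact hu.exists_of_quasiIso q

end Euclidean

/-! ### Disjoint unions of pairs -/

section Disjoint

variable {X : Type u} [TopologicalSpace X] {J : Type u}

/-- A cube in a disjoint union of relatively open subsets lies in one of them. -/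
theorem Cube.IsIn.exists_of_iUnion {V O : J → Set X} (hO : ∀ j, IsOpen (O j))
    (hV : ∀ j, (⋃ i, V i) ∩ O j = V j) (hd : Pairwise fun i j => Disjoint (V i) (V j)) {n : ℕ}
    {s : Cube n X} (hs : s.IsIn (⋃ j, V j)) : ∃ j, s.IsIn (V j) := by
  obtain ⟨j, hj⟩ := Set.mem_iUnion.1 (hs.2 fun _ => 0)
  refine ⟨j, hs.1, ?_⟩
  have hpre : ∀ i, s.toFun n ⁻¹' V i = s.toFun n ⁻¹' O i := by
    intro i
    rw [← hV i]
    ext y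
    exact ⟨fun h => h.2, fun h => ⟨hs.2 y, h⟩⟩
  have hopen : ∀ i, IsOpen (s.toFun n ⁻¹' V i) := fun i => by
    rw [hpre]
    exact (hO i).preimage hs.1
  have hclosed : IsClosed (s.toFun n ⁻¹' V j) := by
    rw [← isOpen_compl_iff]
    have : (s.toFun n ⁻¹' V j)ᶜ = ⋃ i : {i // i ≠ j}, s.toFun n ⁻¹' V i := by
      ext y
      simp only [Set.mem_compl_iff, Set.mem_preimage, Set.mem_iUnion]
      constructor
      · intro h
        obtain ⟨i, hi⟩ := Set.mem_iUnion.1 (hs.2 y)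
        exact ⟨⟨i, by rintro rfl; exact h hi⟩, hi⟩
      · rintro ⟨⟨i, hi⟩, hy⟩ h
        exact (hd hi).le_bot ⟨hy, h⟩
    rw [this]
    exact isOpen_iUnion fun i => hopen i
  have := IsClopen.eq_univ ⟨hclosed, hopen j⟩ ⟨fun _ => 0, hj⟩
  intro y
  have hy : y ∈ s.toFun n ⁻¹' V j := by rw [this]; trivial
  exact hy

variable {M : Type u} [AddCommGroup M] {V O : J → Set X}

/-- Each cube lies in one of the pieces, so a chain meets finitely many. Allowing every larger `F'`
makes the property additive in the chain. -/
theorem exists_eq_sum_restr (hO : ∀ j, IsOpen (O j))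
    (hV : ∀ j, (⋃ i, V i) ∩ O j = V j) (hd : Pairwise fun i j => Disjoint (V i) (V j)) {n : ℕ}
    {c : Ch X M (n + 1)} (hc : c ∈ sub M (⋃ j, V j) (n + 1)) :
    ∃ F : Finset J, ∀ F' : Finset J, F ⊆ F' → ∑ j ∈ F', restr M (V j) (n + 1) c = c := by
  classical
  refine AddSubgroup.closure_induction (p := fun c _ => ∃ F : Finset J, ∀ F' : Finset J, F ⊆ F' →
    ∑ j ∈ F', restr M (V j) (n + 1) c = c) ?_ ⟨∅, fun F' _ => ?_⟩ ?_ ?_ hc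
  · rintro _ ⟨s, m, hs, rfl⟩
    obtain ⟨j, hj⟩ := hs.exists_of_iUnion hO hV hd
    refine ⟨{j}, fun F' hF' => ?_⟩
    rw [Finset.sum_eq_single_of_mem j (hF' (Finset.mem_singleton_self j)), restr_mk_single, if_pos hj]
    intro i _ hi
    rw [restr_mk_single, if_neg]
    exact fun h => (hd hi).le_bot ⟨h.2 fun _ => 0, hj.2 fun _ => 0⟩
  · simp only [map_zero, Finset.sum_const_zero]
  · rintro x y - - ⟨F, hF⟩ ⟨F₂, hF₂⟩
    refine ⟨F ∪ F₂, fun F' hF' => ?_⟩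
    simp only [map_add, Finset.sum_add_distrib]
    rw [hF F' (Finset.union_subset_left hF'), hF₂ F' (Finset.union_subset_right hF')]
  · rintro x - ⟨F, hF⟩
    refine ⟨F, fun F' hF' => ?_⟩
    simp only [map_neg, Finset.sum_neg_distrib]
    rw [hF F' hF']

/-- The faces of a cube lie in the same piece as the cube. The augmentation does not commute with
the projections, which is why degrees start at `n + 2`. -/
theorem d_restr (hO : ∀ j, IsOpen (O j))
    (hV : ∀ j, (⋃ i, V i) ∩ O j = V j) (hd : Pairwise fun i j => Disjoint (V i) (V j)) {n : ℕ}
    {c : Ch X M (n + 2)} (hc : c ∈ sub M (⋃ j, V j) (n + 2)) (j : J) :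
    d (n + 1) (restr M (V j) (n + 2) c) = restr M (V j) (n + 1) (d (n + 1) c) := by
  classical
  have := map_sub_mem ((d (n + 1)).comp (restr M (V j) (n + 2)) -
    (restr M (V j) (n + 1)).comp (d (n + 1))) ⊥ (fun s m hs => ?_) hc
  · exact sub_eq_zero.1 this
  · rw [AddSubgroup.mem_bot, AddMonoidHom.sub_apply, AddMonoidHom.comp_apply,
      AddMonoidHom.comp_apply, sub_eq_zero]
    obtain ⟨i, hi⟩ := hs.exists_of_iUnion hO hV hd
    have hm := d_mem_sub (mk_single_mem_sub hi m)
    by_cases hij : i = j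
    · subst hij
      rw [restr_mk_single, if_pos hi, restr_eq_self hm]
    · have h := restr_mem_sub_inter (A := V j) hm
      rw [Set.disjoint_iff_inter_eq_empty.1 (hd (Ne.symm hij))] at h
      rw [restr_mk_single, if_neg, map_zero, sub_empty h]
      exact fun h => (hd hij).le_bot ⟨hi.2 fun _ => 0, h.2 fun _ => 0⟩

end Disjoint
end MooreFlat

namespace MooreFlat

open Ch

section DisjointPairs

variable {X : Type u} [TopologicalSpace X] {J : Type u}

theorem comb_punit {X : Type u} {M : Type u} [AddCommGroup M] {n : ℕ}
    (v : PUnit.{u + 1} → Ch X (ULift.{u} ℤ) n) (w : PUnit.{u + 1} →₀ M) :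
    comb v M w = tens (v PUnit.unit) M (w PUnit.unit) := by
  have hw : w = Finsupp.single PUnit.unit (w PUnit.unit) := by
    ext
    simp
  rw [hw, comb_single, Finsupp.single_eq_same]

theorem restr_comb {M : Type u} [AddCommGroup M] {V : J → Set X}
    (hd : Pairwise fun i j => Disjoint (V i) (V j)) {n : ℕ} {v : J → Ch X (ULift.{u} ℤ) (n + 1)}
    (hv : ∀ j, v j ∈ sub _ (V j) (n + 1)) (w : J →₀ M) (j : J) :
    restr M (V j) (n + 1) (comb v M w) = tens (v j) M (w j) := by
  induction w using Finsupp.induction_linear with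
  | zero => rw [map_zero, map_zero, Finsupp.zero_apply, map_zero]
  | add x y hx hy => rw [map_add, map_add, hx, hy, Finsupp.add_apply, map_add]
  | single i m =>
    rw [comb_single]
    by_cases hij : i = j
    · subst hij
      rw [Finsupp.single_eq_same, restr_eq_self (tens_mem_sub (hv i) m)]
    · have h := restr_mem_sub_inter (A := V j) (tens_mem_sub (hv i) m)
      rw [Set.disjoint_iff_inter_eq_empty.1 (hd (Ne.symm hij))] at h
      rw [Finsupp.single_eq_of_ne (Ne.symm hij), map_zero, sub_empty h]

/-- A disjoint union of pairs with homology in a single degree. -/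
theorem CellPair.iUnion {p : ℕ} {v : J → Ch X (ULift.{u} ℤ) (p + 1)} {V O A : J → Set X}
    (hO : ∀ j, IsOpen (O j)) (hV : ∀ j, (⋃ i, V i) ∩ O j = V j)
    (hd : Pairwise fun i j => Disjoint (V i) (V j)) (hA : ∀ j, A j ⊆ V j)
    (h : ∀ j, CellPair p (fun _ : PUnit.{u + 1} => v j) (V j) (A j)) :
    CellPair p v (⋃ j, V j) (⋃ j, A j) := by
  have hVi : ∀ j, V j ⊆ ⋃ j, V j := Set.subset_iUnion V
  have hAi : ∀ j, A j ⊆ ⋃ j, A j := Set.subset_iUnion A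
  have hAV : (⋃ j, A j) ⊆ ⋃ j, V j := Set.iUnion_mono hA
  have hVA : ∀ j, V j ∩ ⋃ i, A i = A j := by
    intro j
    ext x
    constructor
    · rintro ⟨hx, hx'⟩
      obtain ⟨i, hi⟩ := Set.mem_iUnion.1 hx'
      by_cases hij : i = j
      · exact hij ▸ hi
      · exact ((hd hij).le_bot ⟨hA i hi, hx⟩).elim
    · exact fun hx => ⟨hA j hx, hAi j hx⟩
  have hres : ∀ {M : Type u} [AddCommGroup M] {n : ℕ} {c : Ch X M n}, c ∈ sub M (⋃ j, A j) n →
      ∀ j, restr M (V j) n c ∈ sub M (A j) n := by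
    intro M _ n c hc j
    rw [← hVA j]
    exact restr_mem_sub_inter hc
  have hresV : ∀ {M : Type u} [AddCommGroup M] {n : ℕ} {c : Ch X M n}, c ∈ sub M (⋃ j, V j) n →
      ∀ j, restr M (V j) n c ∈ sub M (V j) n := by
    intro M _ n c hc j
    exact sub_mono Set.inter_subset_left (restr_mem_sub_inter hc)
  have hdres : ∀ {M : Type u} [AddCommGroup M] {n : ℕ} {c : Ch X M (n + 1)},
      c ∈ sub M (⋃ j, V j) (n + 1) → d n c ∈ sub M (⋃ j, A j) n → ∀ j,
      d n (restr M (V j) (n + 1) c) ∈ sub M (A j) n := by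
    intro M _ n c hc hdc j
    cases n with
    | zero => exact mem_sub_zero _
    | succ n =>
      rw [d_restr hO hV hd hc]
      exact hres hdc j
  refine ⟨fun j => sub_mono (hVi j) ((h j).mem PUnit.unit),
    fun j => sub_mono (hAi j) ((h j).d_mem PUnit.unit), ?_, ?_, ?_⟩
  · intro i hi M _ c hc hdc
    obtain ⟨F, hF⟩ := exists_eq_sum_restr hO hV hd hc
    choose b hb hcb using fun j => (h j).exact i hi M _ (hresV hc j) (hdres hc hdc j)
    refine ⟨∑ j ∈ F, b j, sum_mem fun j _ => sub_mono (hVi j) (hb j), ?_⟩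
    rw [map_sum]
    nth_rw 1 [← hF F le_rfl]
    rw [← Finset.sum_sub_distrib]
    exact sum_mem fun j _ => sub_mono (hAi j) (hcb j)
  · intro M _ c hc hdc
    obtain ⟨F, hF⟩ := exists_eq_sum_restr hO hV hd hc
    choose w b hb hcb using fun j => (h j).gen M _ (hresV hc j) (hdres hc hdc j)
    refine ⟨∑ j ∈ F, Finsupp.single j (w j PUnit.unit), ∑ j ∈ F, b j,
      sum_mem fun j _ => sub_mono (hVi j) (hb j), ?_⟩
    rw [map_sum, map_sum]
    nth_rw 1 [← hF F le_rfl]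
    rw [← Finset.sum_sub_distrib, ← Finset.sum_sub_distrib]
    refine sum_mem fun j _ => sub_mono (hAi j) ?_
    rw [comb_single]
    have := hcb j
    rwa [comb_punit] at this
  · intro M _ w b hb hw
    ext j
    have h1 := hres hw j
    rw [map_sub, restr_comb hd (fun j => (h j).mem PUnit.unit), ← d_restr hO hV hd hb] at h1
    have h2 := (h j).inj M (Finsupp.single PUnit.unit (w j)) _ (hresV hb j) (by
      rwa [comb_single])
    simpa using h2

end DisjointPairs

/-! ### Skeleta and punctured skeleta of a CW-complex -/

section Cells

set_option linter.unusedSectionVars false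

open Topology Topology.RelCWComplex

variable (X : Type u) [TopologicalSpace X] [T2Space X] [CWComplex (Set.univ : Set X)]

/-- The cells of dimension `p`. -/
abbrev Cells (p : ℕ) : Type u := cell (Set.univ : Set X) p

/-- The union of the cells of dimension less than `p`. -/
def sk (p : ℕ) : Set X := (skeletonLT (Set.univ : Set X) (p : ℕ∞) : Set X)

variable {X}

theorem mem_sk_iff {p : ℕ} {x : X} : x ∈ sk X p ↔ ∃ m, m < p ∧ ∃ j : Cells X m, x ∈ openCell m j := by
  rw [sk, SetLike.mem_coe, CWComplex.mem_skeletonLT_iff]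
  simp only [Nat.cast_lt, exists_prop]

theorem sk_zero : sk X 0 = ∅ := by
  ext x
  simp [mem_sk_iff]

theorem sk_mono {p q : ℕ} (h : p ≤ q) : sk X p ⊆ sk X q := fun x hx => by
  obtain ⟨m, hm, j, hj⟩ := mem_sk_iff.1 hx
  exact mem_sk_iff.2 ⟨m, hm.trans_le h, j, hj⟩

theorem sk_succ (p : ℕ) : sk X (p + 1) = sk X p ∪ ⋃ j : Cells X p, openCell p j := by
  ext x
  rw [Set.mem_union, mem_sk_iff, mem_sk_iff, Set.mem_iUnion]
  constructor
  · rintro ⟨m, hm, j, hj⟩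
    rcases Nat.lt_succ_iff_lt_or_eq.1 hm with h | rfl
    · exact Or.inl ⟨m, h, j, hj⟩
    · exact Or.inr ⟨j, hj⟩
  · rintro (⟨m, hm, j, hj⟩ | ⟨j, hj⟩)
    · exact ⟨m, hm.trans (Nat.lt_succ_self p), j, hj⟩
    · exact ⟨p, Nat.lt_succ_self p, j, hj⟩

theorem disjoint_sk_openCell {p m : ℕ} (h : p ≤ m) (j : Cells X m) :
    Disjoint (sk X p) (openCell m j) :=
  disjoint_skeletonLT_openCell (Nat.cast_le.2 h)

theorem disjoint_openCell {p : ℕ} {i j : Cells X p} (h : i ≠ j) :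
    Disjoint (openCell p i) (openCell p j) :=
  disjoint_openCell_of_ne fun e => h (by simpa using e)

theorem cellFrontier_subset_sk {p : ℕ} (j : Cells X p) : cellFrontier p j ⊆ sk X p :=
  cellFrontier_subset_skeletonLT p j

theorem openCell_subset_sk {p : ℕ} (j : Cells X p) : openCell p j ⊆ sk X (p + 1) := by
  rw [sk_succ]
  exact fun x hx => Or.inr (Set.mem_iUnion.2 ⟨j, hx⟩)

theorem closedCell_eq {p : ℕ} (j : Cells X p) : closedCell p j = cellFrontier p j ∪ openCell p j :=
  (cellFrontier_union_openCell_eq_closedCell p j).symm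

theorem closedCell_subset_sk {p : ℕ} (j : Cells X p) : closedCell p j ⊆ sk X (p + 1) := by
  rw [closedCell_eq]
  exact Set.union_subset ((cellFrontier_subset_sk j).trans (sk_mono (Nat.le_succ p)))
    (openCell_subset_sk j)

theorem isClosed_sk (p : ℕ) : IsClosed (sk X p) :=
  (skeletonLT (Set.univ : Set X) (p : ℕ∞)).closed

/-- Closedness is tested on closed cells. For a subset of `sk X (p + 1)`, the cells of dimension
below `p` are governed by the intersection with `sk X p`, and the open cells of dimension above `p`
are not met. -/
theorem isClosed_of_inter_closedCell {p : ℕ} {A : Set X} (hA : A ⊆ sk X (p + 1))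
    (h : IsClosed (A ∩ sk X p)) (h' : ∀ j : Cells X p, IsClosed (A ∩ closedCell p j)) :
    IsClosed A := by
  refine CWComplex.isClosed_of_disjoint_openCell_or_isClosed_inter_closedCell
    (C := (Set.univ : Set X)) (Set.subset_univ A) fun n _ j => ?_
  rcases lt_trichotomy n p with hn | rfl | hn
  · right
    have : A ∩ closedCell n j = (A ∩ sk X p) ∩ closedCell n j := by
      rw [Set.inter_assoc, Set.inter_eq_right.2 ((closedCell_subset_sk j).trans (sk_mono hn))]
    rw [this]
    exact h.inter isClosed_closedCell
  · exact Or.inr (h' j)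
  · exact Or.inl ((disjoint_sk_openCell hn j).mono_left hA)

/-- The centre of a cell. -/
def center {p : ℕ} (j : Cells X p) : X := map p j 0

theorem center_mem {p : ℕ} (j : Cells X p) : center j ∈ openCell p j := map_zero_mem_openCell p j

theorem openCell_inter_closedCell {p : ℕ} {i j : Cells X p} (h : i ≠ j) :
    Disjoint (openCell p i) (closedCell p j) := by
  rw [closedCell_eq, Set.disjoint_union_right]
  exact ⟨((disjoint_sk_openCell le_rfl i).mono_left (cellFrontier_subset_sk j)).symm,
    disjoint_openCell h⟩

/-- Taking for `S` all `p`-cells but one, the complement is an open set that meets `sk X (p + 1)` in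
the remaining open cell. So the open `p`-cells are relatively open there. -/
theorem isClosed_sk_union {p : ℕ} (S : Set (Cells X p)) :
    IsClosed (sk X p ∪ ⋃ j ∈ S, openCell p j) := by
  refine isClosed_of_inter_closedCell (p := p) ?_ ?_ ?_
  · refine Set.union_subset (sk_mono (Nat.le_succ p)) (Set.iUnion₂_subset fun j _ => openCell_subset_sk j)
  · rw [Set.inter_eq_right.2 Set.subset_union_left]
    exact isClosed_sk p
  · intro j
    by_cases hj : j ∈ S
    · rw [Set.inter_eq_right.2]
      · exact isClosed_closedCell
      · rw [closedCell_eq]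
        exact Set.union_subset_union (cellFrontier_subset_sk j)
          (Set.subset_biUnion_of_mem (u := fun j => openCell p j) hj)
    · have : (sk X p ∪ ⋃ j ∈ S, openCell p j) ∩ closedCell p j = sk X p ∩ closedCell p j := by
        rw [Set.union_inter_distrib_right, Set.union_eq_left]
        rintro x ⟨hx, hx'⟩
        obtain ⟨i, hi, hxi⟩ := Set.mem_iUnion₂.1 hx
        exact ((openCell_inter_closedCell (by rintro rfl; exact hj hi)).le_bot ⟨hxi, hx'⟩).elim
      rw [this]
      exact (isClosed_sk p).inter isClosed_closedCell

theorem center_notMem_sk {p : ℕ} (j : Cells X p) : center j ∉ sk X p := fun h =>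
  (disjoint_sk_openCell le_rfl j).le_bot ⟨h, center_mem j⟩

theorem center_mem_closedCell_iff {p : ℕ} {i j : Cells X p} : center i ∈ closedCell p j ↔ i = j := by
  constructor
  · intro h
    by_contra hij
    exact (openCell_inter_closedCell hij).le_bot ⟨center_mem i, h⟩
  · rintro rfl
    exact openCell_subset_closedCell _ _ (center_mem i)

theorem map_mem_closedCell {p : ℕ} (j : Cells X p) {z : Fin p → ℝ} (hz : ‖z‖ ≤ 1) :
    map p j z ∈ closedCell p j := Set.mem_image_of_mem _ (mem_closedBall_zero_iff.2 hz)

theorem map_mem_openCell {p : ℕ} (j : Cells X p) {z : Fin p → ℝ} (hz : ‖z‖ < 1) :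
    map p j z ∈ openCell p j := Set.mem_image_of_mem _ (mem_ball_zero_iff.2 hz)

theorem map_mem_sk {p : ℕ} (j : Cells X p) {z : Fin p → ℝ} (hz : ‖z‖ = 1) :
    map p j z ∈ sk X p :=
  cellFrontier_subset_sk j (Set.mem_image_of_mem _ (mem_sphere_zero_iff_norm.2 hz))

theorem symm_map {p : ℕ} (j : Cells X p) {z : Fin p → ℝ} (hz : ‖z‖ < 1) :
    (map p j).symm (map p j z) = z :=
  (map p j).left_inv (by rw [source_eq]; exact mem_ball_zero_iff.2 hz)

theorem map_ne_center {p : ℕ} (i j : Cells X p) {z : Fin p → ℝ} (hz : ‖z‖ ≤ 1) (hz0 : z ≠ 0) :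
    map p j z ≠ center i := by
  intro h
  have hij : i = j := center_mem_closedCell_iff.1 (h ▸ map_mem_closedCell j hz)
  subst hij
  rcases hz.lt_or_eq with hz | hz
  · refine hz0 ?_
    rw [← symm_map i hz, h, center, symm_map i (by rw [norm_zero]; exact one_pos)]
  · exact center_notMem_sk i (h ▸ map_mem_sk i hz)

theorem isClosed_centers (p : ℕ) : IsClosed (Set.range (center (X := X) (p := p))) := by
  refine isClosed_of_inter_closedCell (p := p) ?_ ?_ ?_
  · rintro _ ⟨j, rfl⟩
    exact openCell_subset_sk j (center_mem j)
  · convert isClosed_empty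
    rw [Set.eq_empty_iff_forall_notMem]
    rintro _ ⟨⟨j, rfl⟩, hj⟩
    exact center_notMem_sk j hj
  · intro j
    convert isClosed_singleton (x := center j)
    ext x
    constructor
    · rintro ⟨⟨i, rfl⟩, hi⟩
      rw [center_mem_closedCell_iff.1 hi]
      rfl
    · rintro rfl
      exact ⟨⟨j, rfl⟩, center_mem_closedCell_iff.2 rfl⟩

variable (X) in
/-- The complement of the centres of the `p`-cells in the `p`-skeleton. -/
def punctured (p : ℕ) : Set X := sk X (p + 1) \ Set.range (center (X := X) (p := p))

theorem sk_subset_punctured (p : ℕ) : sk X p ⊆ punctured X p := fun x hx =>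
  ⟨sk_mono (Nat.le_succ p) hx, by rintro ⟨j, rfl⟩; exact center_notMem_sk j hx⟩

theorem map_mem_punctured {p : ℕ} (j : Cells X p) {z : Fin p → ℝ} (hz : ‖z‖ ≤ 1) (hz0 : z ≠ 0) :
    map p j z ∈ punctured X p :=
  ⟨closedCell_subset_sk j (map_mem_closedCell j hz), fun ⟨i, hi⟩ => map_ne_center i j hz hz0 hi.symm⟩

variable (X) in
/-- The presentation of the punctured skeleton by punctured balls. -/
def glue (p : ℕ) : (sk X p ⊕ Σ _ : Cells X p, {z : Fin p → ℝ // ‖z‖ ≤ 1 ∧ z ≠ 0}) → punctured X p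
  | Sum.inl x => ⟨x, sk_subset_punctured p x.2⟩
  | Sum.inr ⟨j, z⟩ => ⟨map p j z, map_mem_punctured j z.2.1 z.2.2⟩

theorem continuousOn_map {p : ℕ} (j : Cells X p) : ContinuousOn (map p j) {z | ‖z‖ ≤ 1} :=
  (continuousOn p j).mono fun _ hz => mem_closedBall_zero_iff.2 hz

/-- Quotient maps remain so after taking the product with the interval, hence the radial deformation
may be checked for continuity on the lower skeleton and on each punctured ball. To test closedness
in `X`, the centres are adjoined: a closed subset of a punctured closed ball becomes compact when
the origin is added, and so does its image. -/
theorem isQuotientMap_glue (p : ℕ) : IsQuotientMap (glue X p) := by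
  have hcont : Continuous (glue X p) := by
    refine continuous_sum_dom.2 ⟨?_, continuous_sigma fun j => ?_⟩
    · exact continuous_subtype_val.subtype_mk _
    · exact Continuous.subtype_mk ((continuousOn_map j).comp_continuous continuous_subtype_val
        fun z => z.2.1) _
  refine isQuotientMap_iff_isClosed.2 ⟨?_, fun s => ⟨fun h => h.preimage hcont, fun hs => ?_⟩⟩
  · rintro ⟨x, hx, hxc⟩
    rw [sk_succ] at hx
    rcases hx with hx | hx
    · exact ⟨Sum.inl ⟨x, hx⟩, rfl⟩
    · obtain ⟨j, z, hz, rfl⟩ := Set.mem_iUnion.1 hx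
      refine ⟨Sum.inr ⟨j, z, (mem_ball_zero_iff.1 hz).le, ?_⟩, rfl⟩
      rintro rfl
      exact hxc ⟨j, rfl⟩
  · have key : IsClosed (Subtype.val '' s ∪ Set.range (center (X := X) (p := p))) := by
      refine isClosed_of_inter_closedCell (p := p) ?_ ?_ fun j => ?_
      · rintro _ (⟨x, -, rfl⟩ | ⟨j, rfl⟩)
        · exact x.2.1
        · exact openCell_subset_sk j (center_mem j)
      · have h1 : IsClosed ((glue X p ∘ Sum.inl) ⁻¹' s) := hs.preimage continuous_inl
        convert (isClosed_sk p).isClosedEmbedding_subtypeVal.isClosedMap _ h1 using 1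
        ext x
        constructor
        · rintro ⟨⟨y, hy, rfl⟩ | ⟨j, rfl⟩, hx⟩
          · exact ⟨⟨y, hx⟩, hy, rfl⟩
          · exact (center_notMem_sk j hx).elim
        · rintro ⟨y, hy, rfl⟩
          exact ⟨Or.inl ⟨_, hy, rfl⟩, y.2⟩
      · have h1 : IsClosed ((fun z => glue X p (Sum.inr ⟨j, z⟩)) ⁻¹' s) :=
          hs.preimage (continuous_inr.comp continuous_sigmaMk)
        obtain ⟨T, hT, hTs⟩ := isClosed_induced_iff.1 h1
        have hcpt : IsCompact ((T ∪ {0}) ∩ Metric.closedBall (0 : Fin p → ℝ) 1) :=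
          (isCompact_closedBall 0 1).inter_left (hT.union isClosed_singleton)
        convert (hcpt.image_of_continuousOn ((continuousOn p j).mono Set.inter_subset_right)).isClosed
          using 1
        ext x
        constructor
        · rintro ⟨hx, z, hz, rfl⟩
          refine ⟨z, ⟨?_, hz⟩, rfl⟩
          by_cases hz0 : z = 0
          · exact Or.inr hz0
          · left
            have hz1 := mem_closedBall_zero_iff.1 hz
            rcases hx with ⟨y, hy, hyz⟩ | ⟨i, hi⟩
            · have : (⟨z, hz1, hz0⟩ : {z : Fin p → ℝ // ‖z‖ ≤ 1 ∧ z ≠ 0}) ∈ Subtype.val ⁻¹' T := by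
                rw [hTs]
                have hy' : y = glue X p (Sum.inr ⟨j, z, hz1, hz0⟩) := Subtype.ext hyz
                change glue X p (Sum.inr ⟨j, z, hz1, hz0⟩) ∈ s
                rwa [← hy']
              exact this
            · exact (map_ne_center i j hz1 hz0 hi.symm).elim
        · rintro ⟨z, ⟨hz, hz1⟩, rfl⟩
          refine ⟨?_, Set.mem_image_of_mem _ hz1⟩
          by_cases hz0 : z = 0
          · exact Or.inr ⟨j, by rw [hz0]; rfl⟩
          · left
            have hzT : z ∈ T := hz.resolve_right hz0
            have : (⟨z, mem_closedBall_zero_iff.1 hz1, hz0⟩ :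
                {z : Fin p → ℝ // ‖z‖ ≤ 1 ∧ z ≠ 0}) ∈ Subtype.val ⁻¹' T := hzT
            rw [hTs] at this
            exact ⟨_, this, rfl⟩
    have : s = Subtype.val ⁻¹' (Subtype.val '' s ∪ Set.range (center (X := X) (p := p))) := by
      ext x
      constructor
      · exact fun hx => Or.inl ⟨x, hx, rfl⟩
      · rintro (⟨y, hy, hyx⟩ | hx)
        · rwa [← Subtype.ext hyx]
        · exact (x.2.2 hx).elim
    rw [this]
    exact key.preimage continuous_subtype_val

end Cells
end MooreFlat

namespace MooreFlat

open Ch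

/-! ### The homology of successive skeleta -/

section CellularPairs

set_option linter.unusedSectionVars false

open Topology Topology.RelCWComplex

variable {X : Type u} [TopologicalSpace X] [T2Space X] [CWComplex (Set.univ : Set X)]

/-- The radial deformation of the punctured ball onto the sphere. -/
noncomputable def radial {p : ℕ} (z : Fin p → ℝ) (s : 𝕀) : Fin p → ℝ := (1 - s + s / ‖z‖ : ℝ) • z

theorem norm_radial {p : ℕ} {z : Fin p → ℝ} (hz : z ≠ 0) (s : 𝕀) :
    ‖radial z s‖ = (1 - s) * ‖z‖ + s := by
  have hz' : 0 < ‖z‖ := norm_pos_iff.2 hz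
  have : (0 : ℝ) ≤ 1 - s + s / ‖z‖ := add_nonneg (sub_nonneg.2 s.2.2) (div_nonneg s.2.1 hz'.le)
  rw [radial, norm_smul, Real.norm_of_nonneg this, add_mul, div_mul_cancel₀ _ hz'.ne']

theorem norm_radial_le {p : ℕ} {z : Fin p → ℝ} (hz : z ≠ 0) (hz1 : ‖z‖ ≤ 1) (s : 𝕀) :
    ‖radial z s‖ ≤ 1 := by
  rw [norm_radial hz]
  nlinarith [s.2.1, s.2.2]

theorem radial_ne_zero {p : ℕ} {z : Fin p → ℝ} (hz : z ≠ 0) (s : 𝕀) : radial z s ≠ 0 := by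
  have hz' : 0 < ‖z‖ := norm_pos_iff.2 hz
  rw [← norm_pos_iff, norm_radial hz]
  rcases eq_or_lt_of_le s.2.1 with h | h
  · rw [← h]; linarith
  · have := mul_nonneg (sub_nonneg.2 s.2.2) hz'.le
    linarith

theorem radial_of_norm_eq_one {p : ℕ} {z : Fin p → ℝ} (hz : ‖z‖ = 1) (s : 𝕀) : radial z s = z := by
  rw [radial, hz, div_one, sub_add_cancel, one_smul]

theorem radial_zero {p : ℕ} (z : Fin p → ℝ) : radial z 0 = z := by
  simp [radial]

open Classical in
/-- The deformation of the punctured skeleton. -/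
noncomputable def puncturedDeformation (p : ℕ) (x : X) (s : 𝕀) : X :=
  if h : ∃ j : Cells X p, x ∈ openCell p j then
    map p h.choose (radial ((map p h.choose).symm x) s)
  else x

theorem puncturedDeformation_of_mem_sk {p : ℕ} {x : X} (hx : x ∈ sk X p) (s : 𝕀) :
    puncturedDeformation p x s = x :=
  dif_neg fun ⟨j, hj⟩ => (disjoint_sk_openCell le_rfl j).le_bot ⟨hx, hj⟩

theorem puncturedDeformation_map {p : ℕ} (j : Cells X p) {z : Fin p → ℝ} (hz : ‖z‖ ≤ 1) (s : 𝕀) :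
    puncturedDeformation p (map p j z) s = map p j (radial z s) := by
  rcases hz.lt_or_eq with hz | hz
  · have h : ∃ i : Cells X p, map p j z ∈ openCell p i := ⟨j, map_mem_openCell j hz⟩
    have hj : h.choose = j := by
      by_contra hne
      exact (disjoint_openCell hne).le_bot ⟨h.choose_spec, map_mem_openCell j hz⟩
    rw [puncturedDeformation, dif_pos h, hj, symm_map j hz]
  · rw [puncturedDeformation_of_mem_sk (map_mem_sk j hz), radial_of_norm_eq_one hz]

theorem continuous_radial (p : ℕ) :
    Continuous fun q : {z : Fin p → ℝ // ‖z‖ ≤ 1 ∧ z ≠ 0} × 𝕀 => radial q.1.1 q.2 := by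
  have h1 : Continuous fun q : {z : Fin p → ℝ // ‖z‖ ≤ 1 ∧ z ≠ 0} × 𝕀 => q.1.1 := by fun_prop
  have h2 : Continuous fun q : {z : Fin p → ℝ // ‖z‖ ≤ 1 ∧ z ≠ 0} × 𝕀 => (q.2 : ℝ) := by fun_prop
  exact ((continuous_const.sub h2).add
    (h2.div h1.norm fun q => (norm_pos_iff.2 q.1.2.2).ne')).smul h1

theorem continuousOn_puncturedDeformation (p : ℕ) :
    ContinuousOn (fun q : X × 𝕀 => puncturedDeformation p q.1 q.2) (punctured X p ×ˢ Set.univ) := by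
  have key : Continuous fun q : punctured X p × 𝕀 => puncturedDeformation p q.1.1 q.2 := by
    refine (isQuotientMap_glue p).continuous_lift_prod_left ?_
    have e : Continuous fun q : (sk X p × 𝕀) ⊕
        (Σ _ : Cells X p, {z : Fin p → ℝ // ‖z‖ ≤ 1 ∧ z ≠ 0} × 𝕀) =>
        Sum.elim (fun q => (q.1 : X)) (fun q => map p q.1 (radial q.2.1.1 q.2.2)) q := by
      refine continuous_sum_dom.2 ⟨?_, continuous_sigma fun j => ?_⟩
      · exact continuous_subtype_val.comp continuous_fst
      · exact (continuousOn_map j).comp_continuous (continuous_radial p) fun q =>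
          norm_radial_le q.1.2.2 q.1.2.1 q.2
    let φ : ((sk X p ⊕ Σ _ : Cells X p, {z : Fin p → ℝ // ‖z‖ ≤ 1 ∧ z ≠ 0}) × 𝕀) ≃ₜ
        (sk X p × 𝕀) ⊕ (Σ _ : Cells X p, {z : Fin p → ℝ // ‖z‖ ≤ 1 ∧ z ≠ 0} × 𝕀) :=
      Homeomorph.sumProdDistrib.trans ((Homeomorph.refl _).sumCongr Homeomorph.sigmaProdDistrib)
    convert e.comp φ.continuous using 1
    funext q
    obtain ⟨x | ⟨j, z⟩, s⟩ := q
    · exact puncturedDeformation_of_mem_sk x.2 s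
    · exact puncturedDeformation_map j z.2.1 s
  rw [continuousOn_iff_continuous_domRestrict]
  exact key.comp (f := fun q : ↥(punctured X p ×ˢ (Set.univ : Set 𝕀)) =>
    ((⟨q.1.1, q.2.1⟩ : punctured X p), q.1.2)) (by fun_prop)

section Family

variable {ι : Type u} {p : ℕ} (κ : ι → Cells X p)

/-- The union of the skeleton and of a family of cells, without their centres. -/
def puncturedFamily : Set X := sk X p ∪ ⋃ i, (openCell p (κ i) \ {center (κ i)})

theorem puncturedFamily_subset : puncturedFamily κ ⊆ punctured X p := by
  refine Set.union_subset (sk_subset_punctured p) (Set.iUnion_subset fun i => ?_)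
  rintro _ ⟨⟨z, hz, rfl⟩, hzc⟩
  refine map_mem_punctured _ (mem_ball_zero_iff.1 hz).le ?_
  rintro rfl
  exact hzc rfl

/-- The radial deformation pushes each punctured cell out to its frontier and fixes the lower
skeleton. -/
theorem relExact_puncturedFamily (i : ℕ) : RelExact (puncturedFamily κ) (sk X p) i := by
  have key : ∀ x ∈ puncturedFamily κ, x ∈ sk X p ∨
      ∃ i z, ‖z‖ < 1 ∧ z ≠ 0 ∧ x = map p (κ i) z := by
    rintro x (hx | hx)
    · exact Or.inl hx
    · obtain ⟨i, ⟨z, hz, rfl⟩, hzc⟩ := Set.mem_iUnion.1 hx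
      refine Or.inr ⟨i, z, mem_ball_zero_iff.1 hz, ?_, rfl⟩
      rintro rfl
      exact hzc rfl
  refine RelExact.of_deformation (puncturedDeformation p)
    ((continuousOn_puncturedDeformation p).mono (Set.prod_mono (puncturedFamily_subset κ) le_rfl))
    ?_ ?_ ?_ (fun x hx s => by rwa [puncturedDeformation_of_mem_sk hx]) Set.subset_union_left i
  · intro x hx
    rcases key x hx with hx | ⟨i, z, hz, hz0, rfl⟩
    · exact puncturedDeformation_of_mem_sk hx 0
    · rw [puncturedDeformation_map _ hz.le, radial_zero]
  · intro x hx
    rcases key x hx with hx | ⟨i, z, hz, hz0, rfl⟩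
    · rwa [puncturedDeformation_of_mem_sk hx]
    · rw [puncturedDeformation_map _ hz.le]
      refine map_mem_sk _ ?_
      rw [norm_radial hz0]
      simp
  · intro x hx s
    rcases key x hx with hx | ⟨i, z, hz, hz0, rfl⟩
    · rw [puncturedDeformation_of_mem_sk hx]
      exact Or.inl hx
    · rw [puncturedDeformation_map _ hz.le]
      rcases (norm_radial_le hz0 hz.le s).lt_or_eq with h | h
      · refine Or.inr (Set.mem_iUnion.2 ⟨i, map_mem_openCell _ h, ?_⟩)
        exact map_ne_center _ _ h.le (radial_ne_zero hz0 s)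
      · exact Or.inl (map_mem_sk _ h)

theorem iUnion_inter_isOpen (hκ : Function.Injective κ) (i : ι) :
    (⋃ i, openCell p (κ i)) ∩ (sk X p ∪ ⋃ j ∈ ({κ i}ᶜ : Set (Cells X p)), openCell p j)ᶜ =
      openCell p (κ i) := by
  ext x
  constructor
  · rintro ⟨hx, hx'⟩
    obtain ⟨l, hl⟩ := Set.mem_iUnion.1 hx
    by_cases hli : l = i
    · exact hli ▸ hl
    · exact (hx' (Or.inr (Set.mem_iUnion₂.2 ⟨κ l, fun h => hli (hκ h), hl⟩))).elim
  · intro hx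
    refine ⟨Set.mem_iUnion.2 ⟨i, hx⟩, ?_⟩
    rintro (h | h)
    · exact (disjoint_sk_openCell le_rfl _).le_bot ⟨h, hx⟩
    · obtain ⟨j, hj, hxj⟩ := Set.mem_iUnion₂.1 h
      exact (disjoint_openCell hj).le_bot ⟨hxj, hx⟩

/-- Excision for the open sets complementary to the centres and to the lower skeleton, which cover
since no centre lies in the lower skeleton. -/
theorem quasiIso_excision_cells : QuasiIso (⋃ i, openCell p (κ i))
    (⋃ i, (openCell p (κ i) \ {center (κ i)})) (sk X p ∪ ⋃ i, openCell p (κ i))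
    (puncturedFamily κ) := by
  have q := QuasiIso.excision (W := sk X p ∪ ⋃ i, openCell p (κ i))
    (isClosed_centers (X := X) p).isOpen_compl (isClosed_sk (X := X) p).isOpen_compl (fun x hx => by
      by_cases h : x ∈ sk X p
      · left
        rintro ⟨j, rfl⟩
        exact center_notMem_sk j h
      · exact Or.inr h)
  have e2 : (sk X p ∪ ⋃ i, openCell p (κ i)) ∩ (sk X p)ᶜ = ⋃ i, openCell p (κ i) := by
    ext x
    constructor
    · rintro ⟨hx | hx, hx'⟩
      · exact (hx' hx).elim
      · exact hx
    · refine fun hx => ⟨Or.inr hx, fun h => ?_⟩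
      obtain ⟨i, hi⟩ := Set.mem_iUnion.1 hx
      exact (disjoint_sk_openCell le_rfl _).le_bot ⟨h, hi⟩
  have e1 : (sk X p ∪ ⋃ i, openCell p (κ i)) ∩ (Set.range (center (X := X) (p := p)))ᶜ =
      puncturedFamily κ := by
    ext x
    constructor
    · rintro ⟨hx | hx, hx'⟩
      · exact Or.inl hx
      · obtain ⟨i, hi⟩ := Set.mem_iUnion.1 hx
        exact Or.inr (Set.mem_iUnion.2 ⟨i, hi, fun h => hx' ⟨κ i, h.symm⟩⟩)
    · intro hx
      refine ⟨?_, (puncturedFamily_subset κ hx).2⟩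
      rcases hx with hx | hx
      · exact Or.inl hx
      · exact Or.inr (Set.iUnion_mono (fun i => Set.sdiff_subset) hx)
  have e3 : puncturedFamily κ ∩ (⋃ i, openCell p (κ i)) =
      ⋃ i, (openCell p (κ i) \ {center (κ i)}) := by
    ext x
    constructor
    · rintro ⟨hx | hx, hx'⟩
      · obtain ⟨i, hi⟩ := Set.mem_iUnion.1 hx'
        exact ((disjoint_sk_openCell le_rfl _).le_bot ⟨hx, hi⟩).elim
      · exact hx
    · exact fun hx => ⟨Or.inr hx, Set.iUnion_mono (fun i => Set.sdiff_subset) hx⟩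
  rw [e2, e1, e3] at q
  exact q

theorem quasiIso_puncturedFamily : QuasiIso (sk X p ∪ ⋃ i, openCell p (κ i)) (sk X p)
    (sk X p ∪ ⋃ i, openCell p (κ i)) (puncturedFamily κ) :=
  QuasiIso.of_relExact_right Set.subset_union_left
    (Set.union_subset_union_right _ (Set.iUnion_mono fun _ => Set.sdiff_subset))
    (relExact_puncturedFamily κ)

end Family

variable (X) in
-- The characteristic map restricts to a homeomorphism from the open ball to the open cell and takes
-- the origin to the centre.
theorem exists_cellPair_openCell (p : ℕ) : ∃ v : Cells X p → Ch X (ULift.{u} ℤ) (p + 1), ∀ j,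
    CellPair p (fun _ : PUnit.{u + 1} => v j) (openCell p j) (openCell p j \ {center j}) := by
  obtain ⟨u, hu⟩ := exists_cellPair_ball.{u} p
  refine ⟨fun j => push₁ (fun x : Euc.{u} p => map p j x.down) (p + 1) (u PUnit.unit), fun j => ?_⟩
  refine hu.map (fun x : Euc.{u} p => map p j x.down) (fun y => ⟨(map p j).symm y⟩)
    Set.inter_subset_right Set.sdiff_subset ?_ ?_ ?_ ?_ ?_ ?_ ?_ ?_
  · exact (continuousOn_map j).comp continuous_uliftDown.continuousOn
      fun x hx => (mem_ball_zero_iff.1 hx).le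
  · refine continuous_uliftUp.comp_continuousOn ((continuousOn_symm p j).mono ?_)
    rw [← (map p j).image_source_eq_target, source_eq]
    rfl
  · exact fun x hx => map_mem_openCell j (mem_ball_zero_iff.1 hx)
  · intro x hx
    refine ⟨map_mem_openCell j (mem_ball_zero_iff.1 hx.2), ?_⟩
    exact map_ne_center j j (mem_ball_zero_iff.1 hx.2).le fun h => hx.1 (ULift.ext _ _ h)
  · rintro _ ⟨z, hz, rfl⟩
    change (map p j).symm (map p j z) ∈ Metric.ball 0 1
    rwa [symm_map j (mem_ball_zero_iff.1 hz)]
  · rintro _ ⟨⟨z, hz, rfl⟩, hzc⟩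
    simp only [symm_map j (mem_ball_zero_iff.1 hz)]
    refine ⟨fun h => hzc ?_, hz⟩
    rw [show z = 0 from congrArg ULift.down h]
    rfl
  · intro x hx
    exact ULift.ext _ _ (symm_map j (mem_ball_zero_iff.1 hx))
  · rintro _ ⟨z, hz, rfl⟩
    simp only [symm_map j (mem_ball_zero_iff.1 hz)]

variable (X) in
/-- The relative homology of a skeleton modulo the preceding one is concentrated in one degree, where
it is free on classes which belong to the cells. -/
theorem exists_cellPair_sk (p : ℕ) : ∃ v : Cells X p → Ch X (ULift.{u} ℤ) (p + 1),
    ∀ {ι : Type u} (κ : ι → Cells X p), Function.Injective κ →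
      CellPair p (fun i => v (κ i)) (sk X p ∪ ⋃ i, openCell p (κ i)) (sk X p) := by
  obtain ⟨v₀, hv₀⟩ := exists_cellPair_openCell X p
  have h0 : ∀ {ι : Type u} (κ : ι → Cells X p), Function.Injective κ →
      CellPair p (fun i => v₀ (κ i)) (sk X p ∪ ⋃ i, openCell p (κ i)) (puncturedFamily κ) := by
    intro ι κ hκ
    refine CellPair.of_quasiIso ?_ (quasiIso_excision_cells κ)
    exact CellPair.iUnion (fun i => (isClosed_sk_union ({κ i}ᶜ : Set (Cells X p))).isOpen_compl)
      (iUnion_inter_isOpen κ hκ) (fun i j hij => disjoint_openCell (hκ.ne hij))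
      (fun i => Set.sdiff_subset) fun i => hv₀ (κ i)
  have hinj : ∀ j : Cells X p, Function.Injective fun _ : PUnit.{u + 1} => j := fun j _ _ _ => rfl
  -- The generator `v j` is chosen in the pair formed with the single cell `j`, before any family is
  -- given. It thus serves every family, and translates can later be compared one cell at a time.
  choose v hv hdv b hb hvb using fun j => (quasiIso_puncturedFamily fun _ : PUnit.{u + 1} => j).surj
    p _ (v₀ j) ((h0 _ (hinj j)).mem PUnit.unit) ((h0 _ (hinj j)).d_mem PUnit.unit)
  refine ⟨v, fun {ι} κ hκ => ?_⟩
  have hsub : ∀ i, sk X p ∪ ⋃ _ : PUnit.{u + 1}, openCell p (κ i) ⊆ sk X p ∪ ⋃ i, openCell p (κ i) :=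
    fun i => Set.union_subset_union_right _ (Set.iUnion_subset fun _ =>
      Set.subset_iUnion (fun i => openCell p (κ i)) i)
  have hsub' : ∀ i, puncturedFamily (fun _ : PUnit.{u + 1} => κ i) ⊆ puncturedFamily κ :=
    fun i => Set.union_subset_union_right _ (Set.iUnion_subset fun _ =>
      Set.subset_iUnion (fun i => openCell p (κ i) \ {center (κ i)}) i)
  exact (h0 κ hκ).of_quasiIso_of_homologous (quasiIso_puncturedFamily κ)
    (fun i => sub_mono (hsub i) (hv (κ i))) (fun i => hdv (κ i))
    fun i => ⟨b (κ i), sub_mono (hsub i) (hb (κ i)), sub_mono (hsub' i) (hvb (κ i))⟩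

end CellularPairs
end MooreFlat

namespace MooreFlat

open Ch

/-! ### Chains and relative homology as modules over the group ring -/

section ChainModules

variable {k : Type u} [CommRing k] {G : Type u} [Group G] {X : Type u} [MulAction G X]
variable {M : Type u} [AddCommGroup M] [Module (MonoidAlgebra k G) M]

variable (k G X M) in
/-- The action of the group ring on the chains with coefficients in a module. -/
noncomputable def Ch.toEnd (n : ℕ) : MonoidAlgebra k G →+* AddMonoid.End (Ch X M n) :=
  ringHomOfSingle (V := Ch X M n)
    (fun g c => push (fun x => g • x) (smulHom M (.single g c)) n)
    (by
      ext c
      have h1 : smulHom M (.single (1 : G) (1 : k)) = AddMonoidHom.id M := by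
        ext m
        simp [← MonoidAlgebra.one_def]
      have h2 : (fun x : X => (1 : G) • x) = fun x => x := funext fun x => one_smul G x
      rw [h1, h2, push_id]
      rfl)
    (fun g c g' c' => by
      ext x
      rw [AddMonoidHom.comp_apply, push_push]
      have h1 : smulHom M (.single (g * g') (c * c')) =
          (smulHom M (.single g c)).comp (smulHom M (.single g' c')) := by
        ext m
        simp [← MonoidAlgebra.single_mul_single, mul_smul]
      have h2 : (fun x : X => (g * g') • x) = fun x => g • g' • x := funext fun x => mul_smul g g' x
      rw [h1, h2])
    (fun g c c' => by
      ext x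
      have h1 : smulHom M (.single g (c + c')) = smulHom M (.single g c) + smulHom M (.single g c') := by
        ext m
        simp [MonoidAlgebra.single_add, add_smul]
      rw [h1, push_add]
      rfl)

noncomputable instance Ch.instModule (n : ℕ) : Module (MonoidAlgebra k G) (Ch X M n) :=
  Module.compHom (Ch X M n) (Ch.toEnd k G X M n)

theorem Ch.single_smul (g : G) (c : k) (n : ℕ) (x : Ch X M n) :
    (MonoidAlgebra.single g c : MonoidAlgebra k G) • x =
      push (fun x => g • x) (smulHom M (.single g c)) n x := by
  have h : Ch.toEnd k G X M n (MonoidAlgebra.single g c) =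
      push (fun x => g • x) (smulHom M (.single g c)) n := ringHomOfSingle_single ..
  exact DFunLike.congr_fun h x

theorem Ch.d_single_smul (g : G) (c : k) (n : ℕ) (x : Ch X M (n + 1)) :
    d n ((MonoidAlgebra.single g c : MonoidAlgebra k G) • x) =
      (MonoidAlgebra.single g c : MonoidAlgebra k G) • d n x := by
  rw [Ch.single_smul, Ch.single_smul, d_push]

variable [TopologicalSpace X]

theorem Ch.single_smul_mem_sub [ContinuousConstSMul G X] {A : Set X} (hA : ∀ g : G, ∀ x ∈ A, g • x ∈ A)
    (g : G) (c : k) {n : ℕ} {x : Ch X M n} (hx : x ∈ sub M A n) :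
    (MonoidAlgebra.single g c : MonoidAlgebra k G) • x ∈ sub M A n := by
  rw [Ch.single_smul]
  exact push_mem_sub (continuous_const_smul g).continuousOn (hA g) _ hx

/-- The relative cycles. -/
noncomputable def cycles {X : Type u} [TopologicalSpace X] (M : Type u) [AddCommGroup M] (B A : Set X) (i : ℕ) :
    AddSubgroup (Ch X M (i + 1)) :=
  sub M B (i + 1) ⊓ (sub M A i).comap (d i)

/-- The relative boundaries. -/
noncomputable def boundaries {X : Type u} [TopologicalSpace X] (M : Type u) [AddCommGroup M] (B A : Set X) (i : ℕ) :
    AddSubgroup (Ch X M (i + 1)) :=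
  (sub M B (i + 2)).map (d (i + 1)) ⊔ sub M A (i + 1)

theorem mem_boundaries_iff {X : Type u} [TopologicalSpace X] {M : Type u} [AddCommGroup M] {B A : Set X}
    {i : ℕ} {c : Ch X M (i + 1)} : c ∈ boundaries M B A i ↔ ∃ b ∈ sub M B (i + 2),
      c - d (i + 1) b ∈ sub M A (i + 1) := by
  rw [boundaries, AddSubgroup.mem_sup]
  constructor
  · rintro ⟨_, ⟨b, hb, rfl⟩, a, ha, rfl⟩
    exact ⟨b, hb, by rwa [add_sub_cancel_left]⟩
  · rintro ⟨b, hb, ha⟩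
    exact ⟨_, ⟨b, hb, rfl⟩, _, ha, add_sub_cancel _ _⟩

variable [ContinuousConstSMul G X]

/-- A pair of subsets stable under the action of a group. -/
structure StablePair (G : Type u) [Group G] {X : Type u} [MulAction G X] (B A : Set X) : Prop where
  subset : A ⊆ B
  left : ∀ g : G, ∀ x ∈ B, g • x ∈ B
  right : ∀ g : G, ∀ x ∈ A, g • x ∈ A

variable {B A : Set X}

/-- The module of relative cycles. -/
noncomputable def cycleModule (k : Type u) [CommRing k] (M : Type u) [AddCommGroup M] [Module (MonoidAlgebra k G) M]
    (h : StablePair G B A) (i : ℕ) : Submodule (MonoidAlgebra k G) (Ch X M (i + 1)) :=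
  submoduleOfSingle (cycles M B A i) fun g c x hx => by
    refine ⟨single_smul_mem_sub h.left g c hx.1, ?_⟩
    change d _ _ ∈ sub M _ _
    rw [d_single_smul]
    exact single_smul_mem_sub h.right g c hx.2

/-- The module of relative boundaries. -/
noncomputable def boundaryModule (k : Type u) [CommRing k] (M : Type u) [AddCommGroup M]
    [Module (MonoidAlgebra k G) M] (h : StablePair G B A) (i : ℕ) :
    Submodule (MonoidAlgebra k G) (Ch X M (i + 1)) :=
  submoduleOfSingle (boundaries M B A i) fun g c x hx => by
    obtain ⟨b, hb, ha⟩ := mem_boundaries_iff.1 hx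
    refine mem_boundaries_iff.2 ⟨(MonoidAlgebra.single g c : MonoidAlgebra k G) • b,
      single_smul_mem_sub h.left g c hb, ?_⟩
    rw [d_single_smul, ← smul_sub]
    exact single_smul_mem_sub h.right g c ha

/-- The relative homology of a stable pair, as a module. -/
abbrev RelHomology (k : Type u) [CommRing k] (M : Type u) [AddCommGroup M]
    [Module (MonoidAlgebra k G) M] (h : StablePair G B A) (i : ℕ) : Type u :=
  cycleModule k M h i ⧸ (boundaryModule k M h i).comap (cycleModule k M h i).subtype

namespace RelHomology

variable (h : StablePair G B A) (i : ℕ)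

/-- The class of a cycle. -/
noncomputable def mk (h : StablePair G B A) (i : ℕ) : cycleModule k M h i →ₗ[MonoidAlgebra k G] RelHomology k M h i :=
  Submodule.mkQ _

variable {h i}

theorem mk_surjective : Function.Surjective (mk (k := k) (M := M) h i) := Submodule.mkQ_surjective _

theorem mk_eq_zero_iff {c : cycleModule k M h i} :
    mk h i c = 0 ↔ (c : Ch X M (i + 1)) ∈ boundaries M B A i :=
  Submodule.Quotient.mk_eq_zero _

theorem mk_eq_zero_iff' {c : cycleModule k M h i} : mk h i c = 0 ↔ ∃ b ∈ sub M B (i + 2),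
    (c : Ch X M (i + 1)) - d (i + 1) b ∈ sub M A (i + 1) :=
  mk_eq_zero_iff.trans mem_boundaries_iff

/-- The map of relative homology modules induced by an equivariant map of chains. -/
noncomputable def lift {X' : Type u} [TopologicalSpace X'] [MulAction G X'] [ContinuousConstSMul G X']
    {B' A' : Set X'} {h' : StablePair G B' A'} {i' : ℕ}
    (f : Ch X M (i + 1) →+ Ch X' M (i' + 1))
    (hf : ∀ (g : G) (c : k) x, f ((MonoidAlgebra.single g c : MonoidAlgebra k G) • x) =
      (MonoidAlgebra.single g c : MonoidAlgebra k G) • f x)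
    (h1 : ∀ c ∈ cycles M B A i, f c ∈ cycles M B' A' i')
    (h2 : ∀ c ∈ cycles M B A i, c ∈ boundaries M B A i → f c ∈ boundaries M B' A' i') :
    RelHomology k M h i →ₗ[MonoidAlgebra k G] RelHomology k M h' i' :=
  Submodule.mapQ _ _
    ((linearMapOfSingle f hf).restrict (p := cycleModule k M h i) (q := cycleModule k M h' i') h1)
    fun c hc => h2 c c.2 hc

end RelHomology

/-- The exact sequence relating the homology of the pairs `(T, B)`, `(B, A)` and `(T, A)`, where the
homology of `(T, A)` is concentrated in one degree and that of `(T, B)` in the next one. -/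
theorem flatDimLE_relHomology_succ {T : Set X} (hTB : StablePair G T B) (hBA : StablePair G B A)
    (hTA : StablePair G T A) (i n : ℕ) (hA : RelExact T A (i + 1)) (hB : RelExact T B i)
    (hflat : IsFlat (MonoidAlgebra k G) (RelHomology k M hBA i))
    (hdim : FlatDimLE (MonoidAlgebra k G) n (RelHomology k M hTB (i + 1))) :
    FlatDimLE (MonoidAlgebra k G) (n + 1) (RelHomology k M hTA i) := by
  -- Here `α` is the boundary map of the triple and `β` is induced by the inclusion. Vanishing for
  -- `(T, A)` makes `α` injective and vanishing for `(T, B)` makes `β` surjective, which leaves a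
  -- short exact sequence.
  let α : RelHomology k M hTB (i + 1) →ₗ[MonoidAlgebra k G] RelHomology k M hBA i :=
    RelHomology.lift (d (i + 1)) (fun g c x => d_single_smul g c _ x)
      (fun c hc => ⟨hc.2, by
        change d _ _ ∈ sub M _ _
        rw [d_d]
        exact zero_mem _⟩)
      (fun c _ hc => by
        obtain ⟨b, hb, ha⟩ := mem_boundaries_iff.1 hc
        refine mem_boundaries_iff.2 ⟨_, ha, ?_⟩
        rw [map_sub, d_d, sub_zero, sub_self]
        exact zero_mem _)
  let β : RelHomology k M hBA i →ₗ[MonoidAlgebra k G] RelHomology k M hTA i :=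
    RelHomology.lift (AddMonoidHom.id _) (fun g c x => rfl)
      (fun c hc => ⟨sub_mono hTB.subset hc.1, hc.2⟩)
      (fun c _ hc => by
        obtain ⟨b, hb, ha⟩ := mem_boundaries_iff.1 hc
        exact mem_boundaries_iff.2 ⟨b, sub_mono hTB.subset hb, ha⟩)
  refine FlatDimLE.succ_of_exact (i := α) (f := β) ?_ ?_ ?_ hflat hdim
  · refine (injective_iff_map_eq_zero _).2 fun x hx => ?_
    obtain ⟨c, rfl⟩ := RelHomology.mk_surjective x
    obtain ⟨b, hb, ha⟩ := RelHomology.mk_eq_zero_iff'.1 hx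
    obtain ⟨y, hy, hya⟩ := hA M ((c : Ch X M (i + 2)) - b)
      (sub_mem c.2.1 (sub_mono hTB.subset hb)) (by rwa [map_sub])
    refine RelHomology.mk_eq_zero_iff'.2 ⟨y, hy, ?_⟩
    rw [← sub_add_cancel ((c : Ch X M (i + 2)) - d (i + 2) y) b, sub_right_comm]
    exact add_mem (sub_mono hBA.subset hya) hb
  · intro x
    obtain ⟨c, rfl⟩ := RelHomology.mk_surjective x
    obtain ⟨b, hb, ha⟩ := hB M c c.2.1 (sub_mono hBA.subset c.2.2)
    refine ⟨RelHomology.mk hBA i ⟨(c : Ch X M (i + 1)) - d (i + 1) b, ha, ?_⟩, ?_⟩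
    · change d _ _ ∈ sub M _ _
      rw [map_sub, d_d, sub_zero]
      exact c.2.2
    · rw [← sub_eq_zero]
      change RelHomology.mk hTA i _ - RelHomology.mk hTA i _ = 0
      rw [← map_sub]
      refine RelHomology.mk_eq_zero_iff'.2 ⟨-b, neg_mem hb, ?_⟩
      have : (c : Ch X M (i + 1)) - d (i + 1) b - c - d (i + 1) (-b) = 0 := by
        rw [map_neg]
        abel
      change (c : Ch X M (i + 1)) - d (i + 1) b - c - d (i + 1) (-b) ∈ _
      rw [this]
      exact zero_mem _
  · intro x
    obtain ⟨c, rfl⟩ := RelHomology.mk_surjective x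
    constructor
    · intro hx
      obtain ⟨b, hb, ha⟩ := RelHomology.mk_eq_zero_iff'.1 hx
      change (c : Ch X M (i + 1)) - d (i + 1) b ∈ _ at ha
      refine ⟨RelHomology.mk hTB (i + 1) ⟨b, hb, ?_⟩, ?_⟩
      · change d (i + 1) b ∈ sub M B (i + 1)
        rw [← sub_sub_cancel (c : Ch X M (i + 1)) (d (i + 1) b)]
        exact sub_mem c.2.1 (sub_mono hBA.subset ha)
      · symm
        rw [← sub_eq_zero]
        change RelHomology.mk hBA i _ - RelHomology.mk hBA i _ = 0
        rw [← map_sub]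
        refine RelHomology.mk_eq_zero_iff'.2 ⟨0, zero_mem _, ?_⟩
        rw [map_zero, sub_zero]
        exact ha
    · rintro ⟨y, hy⟩
      obtain ⟨b, rfl⟩ := RelHomology.mk_surjective y
      rw [← hy]
      refine RelHomology.mk_eq_zero_iff'.2 ⟨b, b.2.1, ?_⟩
      change d (i + 1) (b : Ch X M (i + 2)) - _ ∈ _
      rw [sub_self]
      exact zero_mem _

end ChainModules
end MooreFlat

namespace MooreFlat

open Ch

section Boundaries

variable {X Y : Type u} [TopologicalSpace X] [TopologicalSpace Y]
variable {M : Type u} [AddCommGroup M] {B A : Set X}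

theorem tens_mem_boundaries {i : ℕ} {c : Ch X (ULift.{u} ℤ) (i + 1)} (hc : c ∈ boundaries _ B A i)
    (m : M) : tens c M m ∈ boundaries M B A i := by
  obtain ⟨b, hb, ha⟩ := mem_boundaries_iff.1 hc
  refine mem_boundaries_iff.2 ⟨tens b M m, tens_mem_sub hb m, ?_⟩
  rw [d_tens, ← AddMonoidHom.sub_apply, ← tens_sub]
  exact tens_mem_sub ha m

theorem push_mem_boundaries {B' A' : Set Y} {f : X → Y} (hf : Continuous f) (hB : Set.MapsTo f B B')
    (hA : Set.MapsTo f A A') {i : ℕ} {c : Ch X M (i + 1)} (hc : c ∈ boundaries M B A i) :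
    push₁ f (i + 1) c ∈ boundaries M B' A' i := by
  obtain ⟨b, hb, ha⟩ := mem_boundaries_iff.1 hc
  refine mem_boundaries_iff.2 ⟨push₁ f _ b, push_mem_sub hf.continuousOn hB _ hb, ?_⟩
  rw [d_push, ← map_sub]
  exact push_mem_sub hf.continuousOn hA _ ha

theorem tens_zsmul {X : Type u} {n : ℕ} (c : Ch X (ULift.{u} ℤ) n) (a : ℤ) (m : M) :
    tens (a • c) M m = tens c M (a • m) := by
  rw [map_zsmul]
  exact map_zsmul (push (fun x : X => x) (coef m) n) a c

theorem tens_ulift {X : Type u} {n : ℕ} (c : Ch X (ULift.{u} ℤ) n) (z : ULift.{u} ℤ) :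
    tens c (ULift.{u} ℤ) z = z.down • c := by
  have h1 : tens c (ULift.{u} ℤ) (ULift.up 1) = c := by
    have : coef (ULift.up.{u} (1 : ℤ)) = AddMonoidHom.id _ := by
      ext y
      exact mul_one y.down
    rw [tens_apply, this, push_id]
  have h2 : z = z.down • ULift.up.{u} (1 : ℤ) := by
    ext
    exact (mul_one z.down).symm
  conv_lhs => rw [h2, map_zsmul, h1]

end Boundaries

/-! ### The action on cellular chains -/

section CellularAction

open Topology Topology.RelCWComplex

variable {k : Type u} [CommRing k] {G : Type u} [Group G]
variable {X : Type u} [TopologicalSpace X] [T2Space X] [CWComplex (Set.univ : Set X)]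
variable [MulAction G X]

theorem IsFlat.of_subsingleton {A : Type u} [Ring A] {M : Type u} [AddCommGroup M] [Module A M]
    [Subsingleton M] : IsFlat A M := by
  intro N _ _ N' _ _ f _
  have h0 : ∀ t : N ⊗[ℤ] M, t = 0 := fun t => by
    induction t using TensorProduct.induction_on with
    | zero => rfl
    | tmul n m => rw [Subsingleton.elim m 0, TensorProduct.tmul_zero]
    | add x y hx hy => rw [hx, hy, add_zero]
  have : Subsingleton (N ⊗[ℤ] M) := ⟨fun x y => (h0 x).trans (h0 y).symm⟩
  have : Subsingleton (BalancedTensor A N M) :=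
    (QuotientAddGroup.mk'_surjective (balancedRel A N M)).subsingleton
  exact fun x y _ => Subsingleton.elim x y

theorem eq_of_openCell_eq {p : ℕ} {i j : Cells X p} (h : openCell p i = openCell p j) : i = j := by
  by_contra hij
  have := disjoint_openCell hij
  rw [h, disjoint_self] at this
  exact (openCell_nonempty p j).ne_empty this

/-- The action of the group on the cells of dimension `p`. -/
noncomputable abbrev cellAction (hact : IsCellularAction G X) (p : ℕ) : MulAction G (Cells X p) where
  smul g j := (hact.2 g p j).choose
  one_smul j := by
    refine eq_of_openCell_eq ((hact.2 1 p j).choose_spec.symm.trans ?_)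
    simp
  mul_smul g g' j := by
    refine eq_of_openCell_eq ((hact.2 (g * g') p j).choose_spec.symm.trans ?_)
    rw [← (hact.2 g p _).choose_spec]
    have h2 : openCell p (hact.2 g' p j).choose = _ := (hact.2 g' p j).choose_spec.symm
    change _ = (fun x => g • x) '' openCell p (hact.2 g' p j).choose
    rw [h2, Set.image_image]
    simp only [mul_smul]

theorem image_openCell (hact : IsCellularAction G X) (g : G) {p : ℕ} (j : Cells X p) : letI := cellAction hact p
    (fun x : X => g • x) '' openCell p j = openCell p (g • j) := (hact.2 g p j).choose_spec

theorem stabilizer_cellAction (hact : IsCellularAction G X) {p : ℕ} (j : Cells X p) : letI := cellAction hact p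
    MulAction.stabilizer G j = cellIsotropy G X p j := by
  let := cellAction hact p
  ext g
  rw [MulAction.mem_stabilizer_iff]
  change g • j = j ↔ (fun x : X => g • x) '' openCell p j = openCell p j
  rw [image_openCell hact]
  exact ⟨fun h => by rw [h], eq_of_openCell_eq⟩

theorem smul_mem_sk (hact : IsCellularAction G X) (g : G) {p : ℕ} {x : X} (hx : x ∈ sk X p) : g • x ∈ sk X p := by
  obtain ⟨m, hm, j, hj⟩ := mem_sk_iff.1 hx
  let := cellAction hact m
  refine mem_sk_iff.2 ⟨m, hm, g • j, ?_⟩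
  rw [← image_openCell hact]
  exact Set.mem_image_of_mem _ hj

theorem stablePair_sk (hact : IsCellularAction G X) (p : ℕ) : StablePair G (sk X (p + 1)) (sk X p) :=
  ⟨sk_mono (Nat.le_succ p), fun g _ => smul_mem_sk hact g, fun g _ => smul_mem_sk hact g⟩

theorem stablePair_univ_sk (hact : IsCellularAction G X) (p : ℕ) : StablePair G (Set.univ : Set X) (sk X p) :=
  ⟨Set.subset_univ _, fun _ _ _ => trivial, fun g _ => smul_mem_sk hact g⟩

theorem cellPair_sk_succ {p : ℕ} {v : Cells X p → Ch X (ULift.{u} ℤ) (p + 1)}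
    (hv : ∀ {ι : Type u} (κ : ι → Cells X p), Function.Injective κ →
      CellPair p (fun i => v (κ i)) (sk X p ∪ ⋃ i, openCell p (κ i)) (sk X p)) :
    CellPair p v (sk X (p + 1)) (sk X p) := by
  rw [sk_succ]
  exact hv id Function.injective_id

/-- The group permutes the classes of the cells up to signs. -/
theorem exists_sign (hact : IsCellularAction G X) {p : ℕ} {v : Cells X p → Ch X (ULift.{u} ℤ) (p + 1)}
    (hv : ∀ {ι : Type u} (κ : ι → Cells X p), Function.Injective κ →
      CellPair p (fun i => v (κ i)) (sk X p ∪ ⋃ i, openCell p (κ i)) (sk X p)) :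
    letI := cellAction hact p
    ∃ ε : G → Cells X p → ℤˣ,
      (∀ (g g' : G) (j : Cells X p), ε (g * g') j = ε g (g' • j) * ε g' j) ∧
      ∀ g j, push₁ (fun x : X => g • x) (p + 1) (v j) - ((ε g j : ℤˣ) : ℤ) • v (g • j) ∈
        boundaries _ (sk X (p + 1)) (sk X p) p := by
  let := cellAction hact p
  have := hact.1
  have hfull := cellPair_sk_succ hv
  have hsk : ∀ g : G, Set.MapsTo (fun x : X => g • x) (sk X p) (sk X p) :=
    fun g x hx => smul_mem_sk hact g hx
  have hsk' : ∀ g : G, Set.MapsTo (fun x : X => g • x) (sk X (p + 1)) (sk X (p + 1)) :=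
    fun g x hx => smul_mem_sk hact g hx
  -- Translation by `g` carries the lower skeleton with the cell `j` to the lower skeleton with the
  -- cell `g • j`, and the homology of the latter pair is generated by `v (g • j)`.
  have hex : ∀ (g : G) (j : Cells X p), ∃ a : ℤ,
      push₁ (fun x : X => g • x) (p + 1) (v j) - a • v (g • j) ∈
        boundaries _ (sk X (p + 1)) (sk X p) p := by
    intro g j
    have h1 := hv (fun _ : PUnit.{u + 1} => j) fun _ _ _ => rfl
    have h2 := hv (fun _ : PUnit.{u + 1} => g • j) fun _ _ _ => rfl
    obtain ⟨w, b, hb, ha⟩ := h2.gen _ (push₁ (fun x : X => g • x) (p + 1) (v j))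
      (push_mem_sub (continuous_const_smul g).continuousOn (fun x hx => by
        rcases hx with hx | hx
        · exact Or.inl (hsk g hx)
        · refine Or.inr ?_
          obtain ⟨_, hx⟩ := Set.mem_iUnion.1 hx
          refine Set.mem_iUnion.2 ⟨PUnit.unit, ?_⟩
          rw [← image_openCell hact]
          exact Set.mem_image_of_mem _ hx) _ (h1.mem PUnit.unit))
      (by
        rw [d_push]
        exact push_mem_sub (continuous_const_smul g).continuousOn (hsk g) _ (h1.d_mem PUnit.unit))
    refine ⟨(w PUnit.unit).down, mem_boundaries_iff.2 ⟨b, sub_mono ?_ hb, ?_⟩⟩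
    · rw [sk_succ]
      exact Set.union_subset_union_right _ (Set.iUnion_subset fun _ =>
        Set.subset_iUnion (fun i => openCell p i) (g • j))
    · rw [comb_punit, tens_ulift] at ha
      exact ha
  -- Freeness makes the coefficient `a g j` unique. The cocycle rule and `a 1 j = 1` follow, and
  -- they force every coefficient to be a unit of `ℤ`.
  have huniq : ∀ (j : Cells X p) (a : ℤ), a • v j ∈ boundaries _ (sk X (p + 1)) (sk X p) p →
      a = 0 := by
    intro j a h
    obtain ⟨b, hb, ha⟩ := mem_boundaries_iff.1 h
    have := hfull.inj _ (Finsupp.single j (ULift.up a)) b hb (by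
      rwa [comb_single, tens_ulift])
    exact congrArg ULift.down (Finsupp.single_eq_zero.1 this)
  choose a ha using hex
  have hmul : ∀ (g g' : G) (j : Cells X p), a (g * g') j = a g (g' • j) * a g' j := by
    intro g g' j
    refine sub_eq_zero.1 (huniq ((g * g') • j) _ ?_)
    have h1 := ha (g * g') j
    have h2 := push_mem_boundaries (continuous_const_smul g) (hsk' g) (hsk g) (ha g' j)
    have h3 := zsmul_mem (ha g (g' • j)) (a g' j)
    rw [map_sub, push_push, map_zsmul] at h2
    have e1 : (fun x : X => g • g' • x) = fun x => (g * g') • x := funext fun x => (mul_smul g g' x).symm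
    rw [e1, AddMonoidHom.comp_id] at h2
    rw [smul_sub, smul_smul, ← mul_smul] at h3
    have := sub_mem (add_mem h2 h3) h1
    rw [sub_smul, mul_comm (a g (g' • j))]
    have key : ∀ x y z w : Ch X (ULift.{u} ℤ) (p + 1), x - y + (y - z) - (x - w) = w - z := by
      intro x y z w
      abel
    rwa [key] at this
  have hone : ∀ j, a 1 j = 1 := by
    intro j
    have h1 := ha 1 j
    have e1 : (fun x : X => (1 : G) • x) = fun x => x := funext fun x => one_smul G x
    rw [e1, push_id, one_smul] at h1
    have h2 := huniq j (1 - a 1 j) (by rwa [sub_smul, one_smul])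
    exact (sub_eq_zero.1 h2).symm
  have hunit : ∀ g j, IsUnit (a g j) := by
    intro g j
    have h1 := hmul g⁻¹ g j
    rw [inv_mul_cancel, hone] at h1
    exact IsUnit.of_mul_eq_one _ ((mul_comm _ _).trans h1.symm)
  refine ⟨fun g j => (hunit g j).unit, fun g g' j => Units.ext (hmul g g' j), fun g j => ?_⟩
  exact ha g j

variable {M : Type u} [AddCommGroup M] [Module (MonoidAlgebra k G) M]

/-- The cellular chain modules are flat, if `M` is flat over the isotropy groups of the cells. -/
theorem isFlat_relHomology_sk [ContinuousConstSMul G X] (hact : IsCellularAction G X) (p : ℕ)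
    (hM : ∀ j : Cells X p, IsFlat (MonoidAlgebra k (cellIsotropy G X p j))
      (Res k (cellIsotropy G X p j) M)) :
    IsFlat (MonoidAlgebra k G) (RelHomology k M (stablePair_sk hact p) p) := by
  let := cellAction hact p
  obtain ⟨v, hv⟩ := exists_cellPair_sk X p
  have hfull := cellPair_sk_succ hv
  obtain ⟨ε, hε, hεv⟩ := exists_sign hact hv
  -- The classes `v j` identify the relative homology with the direct sum of copies of `M` over the
  -- cells; by `exists_sign`, `G` permutes the summands up to signs while acting on the
  -- coefficients.
  let θ : (Cells X p →₀ M) →+ RelHomology k M (stablePair_sk hact p) p :=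
    AddMonoidHom.mk' (fun w => RelHomology.mk _ p ⟨comb v M w, hfull.comb_mem w, hfull.d_comb_mem w⟩)
      fun a b => by
        rw [← map_add]
        congr 1
        exact Subtype.ext (map_add (comb v M) a b)
  have hθ : Function.Bijective θ := by
    constructor
    · refine (injective_iff_map_eq_zero _).2 fun w hw => ?_
      obtain ⟨b, hb, ha⟩ := RelHomology.mk_eq_zero_iff'.1 hw
      exact hfull.inj M w b hb ha
    · intro x
      obtain ⟨c, rfl⟩ := RelHomology.mk_surjective x
      obtain ⟨w, b, hb, ha⟩ := hfull.gen M c c.2.1 c.2.2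
      refine ⟨w, ?_⟩
      symm
      rw [← sub_eq_zero]
      change RelHomology.mk _ p _ - RelHomology.mk _ p _ = 0
      rw [← map_sub]
      exact RelHomology.mk_eq_zero_iff'.2 ⟨b, hb, ha⟩
  refine isFlat_of_monomial (AddEquiv.ofBijective θ hθ) ε hε ?_ ?_
  · intro g c j m
    change (MonoidAlgebra.single g c : MonoidAlgebra k G) • RelHomology.mk _ p _ = RelHomology.mk _ p _
    rw [← sub_eq_zero, ← map_smul, ← map_sub]
    refine RelHomology.mk_eq_zero_iff.2 ?_
    change (MonoidAlgebra.single g c : MonoidAlgebra k G) • comb v M (Finsupp.single j m) -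
      comb v M _ ∈ _
    rw [comb_single, comb_single, Ch.single_smul, push_tens, ← tens_zsmul]
    have h := tens_mem_boundaries (hεv g j) ((MonoidAlgebra.single g c : MonoidAlgebra k G) • m)
    rw [tens_sub] at h
    exact h
  · intro j
    rw [stabilizer_cellAction hact j]
    exact hM j

end CellularAction
end MooreFlat

namespace MooreFlat

open Ch

/-! ### The flat resolution given by a contractible complex -/

section Acyclic

open Topology Topology.RelCWComplex

variable {X : Type u} [TopologicalSpace X]

theorem RelExact.trans {T B A : Set X} {i : ℕ} (hAB : A ⊆ B) (hBT : B ⊆ T) (h : RelExact B A i)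
    (h' : RelExact T B i) : RelExact T A i := by
  intro M _ c hc hdc
  obtain ⟨b, hb, hcb⟩ := h' M c hc (sub_mono hAB hdc)
  obtain ⟨b', hb', hcb'⟩ := h M _ hcb (by rwa [map_sub, d_d, sub_zero])
  exact ⟨b + b', add_mem hb (sub_mono hBT hb'), by rwa [map_add, ← sub_sub]⟩

/-- In the long exact sequence the homology of `(T, B)` in index `i + 1` lies between that of `(T,
A)` in the same index and that of `(B, A)` in index `i`. -/
theorem RelExact.of_succ {T B A : Set X} {i : ℕ} (hAB : A ⊆ B) (hBT : B ⊆ T) (h : RelExact B A i)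
    (h' : RelExact T A (i + 1)) : RelExact T B (i + 1) := by
  intro M _ c hc hdc
  obtain ⟨b, hb, hcb⟩ := h M _ hdc (by rw [d_d]; exact zero_mem _)
  obtain ⟨x, hx, hcx⟩ := h' M (c - b) (sub_mem hc (sub_mono hBT hb)) (by rwa [map_sub])
  refine ⟨x, hx, ?_⟩
  rw [← sub_add_cancel (c - d (i + 1 + 1) x) b, sub_right_comm]
  exact add_mem (sub_mono hAB hcx) hb

variable (X) in
theorem exists_contraction [ContractibleSpace X] : ∃ (x₀ : X) (h : X → 𝕀 → X),
    Continuous (fun q : X × 𝕀 => h q.1 q.2) ∧ (∀ x, h x 0 = x) ∧ ∀ x, h x 1 = x₀ := by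
  obtain ⟨x₀, ⟨F⟩⟩ := id_nullhomotopic X
  exact ⟨x₀, fun x t => F (t, x), F.continuous.comp continuous_swap, fun x => F.apply_zero x,
    fun x => F.apply_one x⟩

/-- The prism of a contraction joins the identity to a constant map, which is zero on cubes of
positive dimension. Index `0` is excluded: there the constant map still records the augmentation. -/
theorem relExact_univ_empty [ContractibleSpace X] {i : ℕ} (hi : i ≠ 0) :
    RelExact (Set.univ : Set X) ∅ i := by
  obtain ⟨x₀, h, hh, h0, h1⟩ := exists_contraction X
  obtain ⟨i, rfl⟩ := Nat.exists_eq_succ_of_ne_zero hi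
  intro M _ c hc hdc
  have key := d_prism h (i + 1) c
  rw [funext h0, funext h1, push_id, sub_empty hdc, map_zero, add_zero, push_cst_succ, zero_sub] at key
  refine ⟨-prism h (i + 2) c,
    neg_mem (prism_mem_sub hh.continuousOn (fun _ _ _ => Set.mem_univ _) hc), ?_⟩
  rw [map_neg, key, neg_neg, sub_self]
  exact zero_mem _

/-- On `0`-cubes the constant map factors through the augmentation, so the contraction exhibits a
chain of augmentation zero as a boundary. -/
theorem d_injective_of_contractible [ContractibleSpace X] {M : Type u} [AddCommGroup M] {c : Ch X M 1}
    (hc : c ∈ sub M (Set.univ : Set X) 1) (hdc : d 0 c = 0) :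
    ∃ b ∈ sub M (Set.univ : Set X) 2, c = d 1 b := by
  obtain ⟨x₀, h, hh, h0, h1⟩ := exists_contraction X
  have key := d_prism h 0 c
  rw [funext h0, funext h1, push_id, push_cst_one, hdc] at key
  change d 1 (prism h 1 c) + 0 = Ch.mk 0 (Finsupp.single (Cube.point x₀) 0) - c at key
  rw [Finsupp.single_zero, map_zero, zero_sub, add_zero] at key
  refine ⟨-prism h 1 c, neg_mem (prism_mem_sub hh.continuousOn (fun _ _ _ => Set.mem_univ _) hc), ?_⟩
  rw [map_neg, key, neg_neg]

variable [T2Space X] [CWComplex (Set.univ : Set X)]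

theorem exists_sk_eq_univ (hfin : RelCWComplex.FiniteDimensional (Set.univ : Set X)) :
    ∃ N, ∀ p, N ≤ p → sk X p = Set.univ := by
  obtain ⟨N, hN⟩ := Filter.eventually_atTop.1 hfin.eventually_isEmpty_cell
  refine ⟨N, fun p hp => Set.eq_univ_of_forall fun x => ?_⟩
  have hx : x ∈ ⋃ (n : ℕ) (j : Cells X n), openCell n j := by
    rw [CWComplex.iUnion_openCell_eq_complex]
    trivial
  obtain ⟨m, hx⟩ := Set.mem_iUnion.1 hx
  obtain ⟨j, hj⟩ := Set.mem_iUnion.1 hx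
  refine mem_sk_iff.2 ⟨m, lt_of_not_ge fun h => ?_, j, hj⟩
  exact (hN m (hp.trans h)).false j

/-- Successive skeleta contribute homology in index `p` only. For `i < p` one climbs from `sk X p`
to the whole space in finitely many stages; for `i > p` one climbs from the empty set, where
contractibility gives the vanishing. -/
theorem relExact_univ_sk [ContractibleSpace X]
    (hfin : RelCWComplex.FiniteDimensional (Set.univ : Set X)) {p i : ℕ} (h : i ≠ p) :
    RelExact (Set.univ : Set X) (sk X p) i := by
  have hsk : ∀ {p i : ℕ}, i ≠ p → RelExact (sk X (p + 1)) (sk X p) i := by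
    intro p i h
    obtain ⟨v, hv⟩ := exists_cellPair_sk X p
    exact (cellPair_sk_succ hv).exact i h
  have hmono : ∀ p, sk X p ⊆ sk X (p + 1) := fun p => sk_mono (Nat.le_succ p)
  rcases h.lt_or_gt with h | h
  · obtain ⟨N, hN⟩ := exists_sk_eq_univ hfin
    have key : ∀ n p, N ≤ p + n → i < p → RelExact (Set.univ : Set X) (sk X p) i := by
      intro n
      induction n with
      | zero =>
        intro p hp _
        rw [hN p hp]
        exact RelExact.refl _ i
      | succ n ih =>
        intro p hp hi
        exact RelExact.trans (hmono p) (Set.subset_univ _) (hsk hi.ne)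
          (ih (p + 1) (by omega) (by omega))
    exact key N p (Nat.le_add_left N p) h
  · induction p generalizing i with
    | zero =>
      rw [sk_zero]
      exact relExact_univ_empty (by omega)
    | succ p ih =>
      obtain ⟨i, rfl⟩ : ∃ i', i = i' + 1 := ⟨i - 1, by omega⟩
      exact RelExact.of_succ (hmono p) (Set.subset_univ _) (hsk (by omega))
        (ih (by omega) (by omega))

variable {k : Type u} [CommRing k] {G : Type u} [Group G] [MulAction G X]
variable {M : Type u} [AddCommGroup M] [Module (MonoidAlgebra k G) M]

/-- A module which is flat over the isotropy groups of a cellular action on a finite-dimensional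
contractible CW-complex has finite flat dimension. -/
theorem exists_flatDimLE_of_isCellularAction [ContractibleSpace X]
    (hfin : RelCWComplex.FiniteDimensional (Set.univ : Set X)) (hact : IsCellularAction G X)
    (hM : ∀ p (j : Cells X p), IsFlat (MonoidAlgebra k (cellIsotropy G X p j))
      (Res k (cellIsotropy G X p j) M)) :
    ∃ n, FlatDimLE (MonoidAlgebra k G) n M := by
  have := hact.1
  obtain ⟨N, hN⟩ := exists_sk_eq_univ hfin
  -- The homology of `(X, sk X p)` in index `p` plays the part of the `p`-th syzygy of the cellular
  -- resolution. It is zero for `p = N`, and for `p = 0` the augmentation identifies it with `M`;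
  -- hence the descending induction with `p + n = N`.
  have key : ∀ n p, p + n = N →
      FlatDimLE (MonoidAlgebra k G) n (RelHomology k M (stablePair_univ_sk hact p) p) := by
    intro n
    induction n with
    | zero =>
      intro p hp
      have h0 : ∀ x : RelHomology k M (stablePair_univ_sk hact p) p, x = 0 := by
        intro x
        obtain ⟨c, rfl⟩ := RelHomology.mk_surjective x
        refine RelHomology.mk_eq_zero_iff'.2 ⟨0, zero_mem _, ?_⟩
        rw [map_zero, sub_zero]
        exact sub_mono (hN p hp.ge).ge c.2.1
      have : Subsingleton (RelHomology k M (stablePair_univ_sk hact p) p) :=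
        ⟨fun x y => (h0 x).trans (h0 y).symm⟩
      exact IsFlat.of_subsingleton
    | succ n ih =>
      intro p hp
      exact flatDimLE_relHomology_succ (stablePair_univ_sk hact (p + 1)) (stablePair_sk hact p)
        (stablePair_univ_sk hact p) p n (relExact_univ_sk hfin (Nat.succ_ne_self p))
        (relExact_univ_sk hfin (Nat.succ_ne_self p).symm) (isFlat_relHomology_sk hact p (hM p))
        (ih (p + 1) (by omega))
  let δ : cycleModule k M (stablePair_univ_sk hact 0) 0 →ₗ[MonoidAlgebra k G] M :=
    (linearMapOfSingle (W := M) (d 0 : Ch X M 1 →+ Ch X M 0) fun g c x =>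
      (d_single_smul g c 0 x).trans (Ch.single_smul g c 0 _)).comp (Submodule.subtype _)
  let e : RelHomology k M (stablePair_univ_sk hact 0) 0 →ₗ[MonoidAlgebra k G] M :=
    Submodule.liftQ _ δ fun c hc => by
      obtain ⟨b, hb, ha⟩ := mem_boundaries_iff.1 hc
      have ha' := sub_empty (sub_mono (sk_zero (X := X)).le ha)
      change d 0 (c : Ch X M 1) = 0
      rw [show (c : Ch X M 1) = d 1 b from sub_eq_zero.1 ha']
      exact d_d 0 b
  have he : Function.Bijective e := by
    constructor
    · refine (injective_iff_map_eq_zero _).2 fun x hx => ?_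
      obtain ⟨c, rfl⟩ := RelHomology.mk_surjective x
      obtain ⟨b, hb, hcb⟩ := d_injective_of_contractible c.2.1 hx
      refine RelHomology.mk_eq_zero_iff'.2 ⟨b, hb, ?_⟩
      rw [← hcb, sub_self]
      exact zero_mem _
    · intro m
      obtain ⟨x₀, -⟩ := exists_contraction X
      refine ⟨RelHomology.mk _ 0 ⟨Ch.mk 0 (Finsupp.single (Cube.point x₀) m),
        mk_single_mem_sub (Cube.IsIn.mk (A := (Set.univ : Set X)) continuous_const
          fun _ => Set.mem_univ _) m,
        mem_sub_zero (A := sk X 0) _⟩, ?_⟩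
      exact aug_single _ m
  exact ⟨N, FlatDimLE.of_linearEquiv N (LinearEquiv.ofBijective e he) (key N 0 (zero_add N))⟩

end Acyclic

/-! ### Moore's condition and induction along the hierarchy -/

section Moore

variable {k : Type u} [CommRing k] {G K : Type u} [Group G] [Group K]

/-- An injective homomorphism preserves orders, and an element of `⟨φ g⟩ ∩ H` is the image of an
element of `⟨g⟩ ∩ φ⁻¹(H)`. -/
theorem MooreCondition.comap {H : Subgroup G} (h : MooreCondition k H) (φ : K →* G)
    (hφ : Function.Injective φ) : MooreCondition k (H.comap φ) := by
  intro g hg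
  rcases h (φ g) hg with h | ⟨h1, h2⟩
  · left
    contrapose! h
    rw [eq_bot_iff]
    rintro _ ⟨⟨n, rfl⟩, hn⟩
    have h3 : g ^ n ∈ Subgroup.zpowers g ⊓ H.comap φ :=
      ⟨⟨n, rfl⟩, by
        change φ (g ^ n) ∈ H
        rw [map_zpow]
        exact hn⟩
    rw [h, Subgroup.mem_bot] at h3
    change φ g ^ n = 1
    rw [← map_zpow, h3, map_one]
  · right
    rw [← orderOf_pos_iff, orderOf_injective φ hφ, orderOf_pos_iff] at h1
    rw [orderOf_injective φ hφ] at h2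
    exact ⟨h1, h2⟩

end Moore
end MooreFlat

namespace MooreFlat

section Main

open Topology

variable {k : Type u} [CommRing k] {G : Type u} [Group G]

theorem mapDomainRingHom_comp_apply {K L : Type u} [Group K] [Group L] (φ : L →* G) (ψ : K →* L)
    (a : MonoidAlgebra k K) : MonoidAlgebra.mapDomainRingHom k (φ.comp ψ) a =
      MonoidAlgebra.mapDomainRingHom k φ (MonoidAlgebra.mapDomainRingHom k ψ a) := by
  rw [MonoidAlgebra.mapDomainRingHom_comp]
  rfl

theorem finiteIndex_comap (H : Subgroup G) [H.FiniteIndex] {K : Type u} [Group K] (φ : K →* G) :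
    (H.comap φ).FiniteIndex :=
  ⟨by rw [Subgroup.index_comap]; exact (H.subgroupOf φ.range).index_ne_zero_of_finite⟩

/-- Flatness over `H` pulls back to flatness over the preimages of `H`. -/
theorem IsFlat.res_comap {H : Subgroup G} {K : Type u} [Group K] {φ : K →* G}
    (hφ : Function.Injective φ) {M' M : Type u} [AddCommGroup M'] [AddCommGroup M]
    [Module (MonoidAlgebra k K) M'] [Module (MonoidAlgebra k G) M] (e : M' ≃+ M)
    (he : ∀ a x, e (a • x) = MonoidAlgebra.mapDomainRingHom k φ a • e x)
    (h : IsFlat (MonoidAlgebra k H) (Res k H M)) :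
    IsFlat (MonoidAlgebra k (H.comap φ)) (Res k (H.comap φ) M') := by
  let ψ : H.comap φ →* H := (φ.comp (H.comap φ).subtype).codRestrict H fun x => x.2
  refine IsFlat.restrict (M := Res k H M) (M' := Res k (H.comap φ) M') ψ
    (fun x y hxy => Subtype.ext (hφ (congrArg Subtype.val hxy))) e (fun a x => ?_) h
  change e (MonoidAlgebra.mapDomainRingHom k (H.comap φ).subtype a • show M' from x) =
    MonoidAlgebra.mapDomainRingHom k H.subtype (MonoidAlgebra.mapDomainRingHom k ψ a) • e x
  rw [he, ← mapDomainRingHom_comp_apply, ← mapDomainRingHom_comp_apply]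
  rfl

/-- Finite index, Moore's condition and flatness all pull back to the preimage of `H` in `K`, where
the defining property of `MFlat` applies. -/
theorem isFlat_of_mFlat {H : Subgroup G} [H.FiniteIndex] (hH : MooreCondition k H) {K : Type u}
    [Group K] (hK : MFlat k K) {φ : K →* G} (hφ : Function.Injective φ) {M' M : Type u}
    [AddCommGroup M'] [AddCommGroup M] [Module (MonoidAlgebra k K) M']
    [Module (MonoidAlgebra k G) M] (e : M' ≃+ M)
    (he : ∀ a x, e (a • x) = MonoidAlgebra.mapDomainRingHom k φ a • e x)
    (h : IsFlat (MonoidAlgebra k H) (Res k H M)) : IsFlat (MonoidAlgebra k K) M' :=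
  hK (H.comap φ) (finiteIndex_comap H φ) (hH.comap φ hφ) M' (h.res_comap hφ e he)

/-- The group `K` is abstract, with an injective `φ : K → G` and a copy `M'` of `M`, so that the
isotropy groups, which are subgroups of `K`, fit the induction. In the inductive step `M'` is flat
over them, so it has finite flat dimension over `kK`; flatness over the preimage of `H` then
concludes. -/
theorem isFlat_of_hOrd {H : Subgroup G} [H.FiniteIndex] (hH : MooreCondition k H) {M : Type u}
    [AddCommGroup M] [Module (MonoidAlgebra k G) M] (h : IsFlat (MonoidAlgebra k H) (Res k H M))
    {α : Ordinal.{u}} {K : Type u} [Group K] (hK : HOrd (MFlat k) α K) :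
    ∀ {φ : K →* G} (_ : Function.Injective φ) {M' : Type u} [AddCommGroup M']
      [Module (MonoidAlgebra k K) M'] (e : M' ≃+ M)
      (_ : ∀ a x, e (a • x) = MonoidAlgebra.mapDomainRingHom k φ a • e x),
      IsFlat (MonoidAlgebra k K) M' := by
  induction hK with
  | zero K hK => exact fun hφ _ _ _ e he => isFlat_of_mFlat hH hK hφ e he h
  | step α _ K X hfin hact β _ _ ih =>
    intro φ hφ M' _ _ e he
    have := finiteIndex_comap H φ
    obtain ⟨n, hn⟩ := exists_flatDimLE_of_isCellularAction (k := k) (M := M') hfin hact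
      fun p j => ih p j (φ := φ.comp (cellIsotropy K X p j).subtype)
        (hφ.comp Subtype.val_injective) (M' := Res k (cellIsotropy K X p j) M') e fun a x => by
          rw [mapDomainRingHom_comp_apply]
          exact he _ _
    exact hn.isFlat_of_finiteIndex (H.comap φ) n (h.res_comap hφ e he)

end Main
end MooreFlat

theorem theorem5p4 (k : Type u) [CommRing k] (G : Type u) [Group G]
    (H : Subgroup G) (hH : H.FiniteIndex) (hMoore : MooreFlat.MooreCondition k H)
    (M : Type u) [AddCommGroup M] [Module (MonoidAlgebra k G) M]
    (hM : MooreFlat.IsFlat (MonoidAlgebra k H) (MooreFlat.Res k H M)) :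
    (∀ S : Subgroup G, MooreFlat.LHClass (MooreFlat.MFlat k) S →
      MooreFlat.IsFlat (MonoidAlgebra k S) (MooreFlat.Res k S M)) ∧
    (∀ S : Subgroup G, MooreFlat.PhiFlat k (MooreFlat.MFlat k) S →
      MooreFlat.IsFlat (MonoidAlgebra k S) (MooreFlat.Res k S M)) := by
  refine ⟨fun S hS => MooreFlat.isFlat_of_forall_fg fun F hF => ?_, fun S hS => ?_⟩
  -- A finitely generated subgroup lies in some `K` of the hierarchy; the module is flat over `K`,
  -- and flatness restricts to the smaller subgroup.
  · obtain ⟨K, hFK, α, hK⟩ := hS F hF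
    have h := MooreFlat.isFlat_of_hOrd hMoore hM hK (φ := S.subtype.comp K.subtype)
      (S.subtype_injective.comp K.subtype_injective)
      (M' := MooreFlat.Res k K (MooreFlat.Res k S M)) (AddEquiv.refl M) fun a x => by
        rw [MooreFlat.mapDomainRingHom_comp_apply]
        rfl
    refine h.restrict (M := MooreFlat.Res k K (MooreFlat.Res k S M))
      (M' := MooreFlat.Res k F (MooreFlat.Res k S M)) (Subgroup.inclusion hFK)
      (Subgroup.inclusion_injective hFK) (AddEquiv.refl _) fun a x => ?_
    change MonoidAlgebra.mapDomainRingHom k F.subtype a • (show MooreFlat.Res k S M from x) =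
      MonoidAlgebra.mapDomainRingHom k K.subtype
        (MonoidAlgebra.mapDomainRingHom k (Subgroup.inclusion hFK) a) •
          (show MooreFlat.Res k S M from x)
    rw [← MooreFlat.mapDomainRingHom_comp_apply, Subgroup.subtype_comp_inclusion]
  -- The module is flat over every `MFlat`-subgroup of `S`, so `0` is a uniform bound for the flat
  -- dimensions.
  · obtain ⟨n, hn⟩ := (hS (MooreFlat.Res k S M)).2 ⟨0, fun F hF =>
      MooreFlat.isFlat_of_mFlat hMoore hF (φ := S.subtype.comp F.subtype)
        (S.subtype_injective.comp F.subtype_injective)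
        (M' := MooreFlat.Res k F (MooreFlat.Res k S M)) (AddEquiv.refl M) (fun a x => by
          rw [MooreFlat.mapDomainRingHom_comp_apply]
          rfl) hM⟩
    have := MooreFlat.finiteIndex_comap H S.subtype
    exact hn.isFlat_of_finiteIndex (H.comap S.subtype) n
      (hM.res_comap (M' := MooreFlat.Res k S M) S.subtype_injective (AddEquiv.refl M)
        fun _ _ => rfl)
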